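/- **Setting.** Fix integers $m,d$, a compact interval $[a,b]$ ($a\le b$) and $\delta>2$. $\|\cdot\|$ is the Euclidean norm of a vector or the Frobenius norm of a matrix. For random variables $X_T$ and deterministic $r_T\ge 0$, $X_T=O_P(r_T)$ means: for every $\eta>0$ there is $M$ with $P(|X_T|>M r_T)\le\eta$ for all large $T$. *Innovations.* $(\epsilon_t)_{t\in\mathbb Z}$ are $\mathbb R^d$-valued random vectors on a probability space, integrable, and with $\mathcal F_t=\sigma(\epsilon_t,\epsilon_{t-1},\dots)$ they satisfy $E(\epsilon_t\mid\mathcal F_{t-1})=0$ and $E(\epsilon_t\epsilon_t^\top\mid\mathcal F_{t-1})=I_d$ a.s. for all $t\in\mathbb Z$, and $\sup_{t\ge1}E\|\epsilon_t\|^\delta<\infty$. *Process.* For each sample size $T\ge1$ and $t\ge1$, $$x_t=\mu_t+\sum_{j=0}^\infty B_{j,t}\,\epsilon_{t-j}\quad\text{a.s.},$$ with deterministic $\mu_t\in\mathbb R^d$ and $B_{j,t}\in\mathbb R^{d\times d}$, which may depend on $T$ (e.g. $B_{j,t}=B_j(t/T)$; the index $T$ is suppressed). Assume $$\sup_{T,t\ge1}\sum_{j\ge1}j\|B_{j,t}\|<\infty,\qquad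 \sup_{T,t\ge1}\|B_{0,t}\|<\infty,\qquad \sup_{T,t\ge 1}\|\mu_t\|<\infty,$$ $$\limsup_{T\to\infty}\sum_{t=1}^{T-1}\sum_{j\ge1}j\|B_{j,t+1}-B_{j,t}\|<\infty,\qquad \limsup_{T\to\infty}\sum_{t=1}^{T-1}\|\mu_{t+1}-\mu_t\|<\infty .$$ (If $\mu_t$ does not depend on $T$, its boundedness follows from the last condition.) *Weights.* For $1\le t\le T$ let $W_{T,t}:[a,b]\to\mathbb R^{m\times d}$ be deterministic with Lipschitz continuous entries. Put $d_T=\sup_{\tau\in[a,b],\,1\le t\le T}\|W_{T,t}(\tau)\|$ and assume, as $T\to\infty$, $$\sup_{\tau\in[a,b]}\sum_{t=1}^T\|W_{T,t}(\tau)\|=O(1),\qquad \sup_{\tau\in[a,b]}\sum_{t=1}^{T-1}\|W_{T,t+1}(\tau)-W_{T,t}(\tau)\|=O(d_T).$$ **Theorem 2.1.** Under these assumptions every $x_t$ is square integrable, and, as $T\to\infty$: 1. If $T^{2/\delta}d_T\log T\to0$, then $$\sup_{\tau\in[a,b]}\Big\|\sum_{t=1}^TW_{T,t}(\tau)\big(x_t-E(x_t)\big)\Big\|=O_P\big(\sqrt{d_T\log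 T}\big).$$ 2. If $T^{4/\delta}d_T\log T\to0$ and $\sup_{t\ge1}E(\|\epsilon_t\|^4\mid\mathcal F_{t-1})<\infty$ a.s., then for every fixed integer $p\ge0$ $$\sup_{\tau\in[a,b]}\Big\|\sum_{t=1}^TW_{T,t}(\tau)\big(x_tx_{t+p}^\top-E(x_tx_{t+p}^\top)\big)\Big\|=O_P\big(\sqrt{d_T\log T}\big).$$ -/

import Mathlib

open MeasureTheory ProbabilityTheory Filter Topology Set
open scoped ENNReal NNReal

/- Vectors live in `EuclideanSpace`, and matrices carry the Frobenius norm. -/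
attribute [local instance] Matrix.frobeniusNormedAddCommGroup

/-- `X T = O_P(r T)` as `T → ∞`, for real random variables `X T` on one probability space and a
deterministic nonnegative rate `r`: for every `η > 0` there is a constant `M` such that
`P(|X T| > M * r T) ≤ η` for all large `T`. -/
def IsBigOP {Ω : Type*} [MeasurableSpace Ω] (P : Measure Ω) (X : ℕ → Ω → ℝ) (r : ℕ → ℝ) : Prop :=
  ∀ η : ℝ, 0 < η → ∃ M : ℝ, ∀ᶠ T in atTop, P {ω | M * r T < |X T ω|} ≤ ENNReal.ofReal η

/-- The `σ`-field `F_t = σ(ε_t, ε_{t-1}, …)` of the innovations, for all integer times `t`. -/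
noncomputable def innovFiltration {Ω : Type*} [MeasurableSpace Ω] {d : ℕ}
    (ε : ℤ → Ω → EuclideanSpace ℝ (Fin d)) (hε : ∀ t, StronglyMeasurable (ε t)) :
    Filtration ℤ ‹MeasurableSpace Ω› :=
  Filtration.natural ε hε

/-- The innovations `(ε_t)`, `t ∈ ℤ`, form a martingale difference sequence for
`F_t = σ(ε_t, ε_{t-1}, …)` with `E(ε_t ε_tᵀ | F_{t-1}) = I_d` a.s., and
`max_{t ≥ 1} E ‖ε_t‖^δ < ∞`. -/
structure IsInnovation {Ω : Type*} [MeasurableSpace Ω] (P : Measure Ω) {d : ℕ}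
    (ε : ℤ → Ω → EuclideanSpace ℝ (Fin d)) (hε : ∀ t, StronglyMeasurable (ε t)) (δ : ℝ) :
    Prop where
  integrable : ∀ t, Integrable (ε t) P
  mds : ∀ t, P[ε t | innovFiltration ε hε (t - 1)] =ᵐ[P] 0
  condCov : ∀ t, ∀ i k : Fin d,
    P[fun ω => ε t ω i * ε t ω k | innovFiltration ε hε (t - 1)]
      =ᵐ[P] fun _ => (1 : Matrix (Fin d) (Fin d) ℝ) i k
  moment : ∃ C : ℝ≥0, ∀ t : ℤ, 1 ≤ t → ∫⁻ ω, ‖ε t ω‖ₑ ^ δ ∂P ≤ C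

/-- `max_{t ≥ 1} E(‖ε_t‖⁴ | F_{t-1}) < ∞` a.s. The conditional expectation is the one of a
`[0, ∞]`-valued random variable, so no integrability of `‖ε_t‖⁴` is presupposed. -/
def BddCondFourthMoment {Ω : Type*} [MeasurableSpace Ω] (P : Measure Ω) {d : ℕ}
    (ε : ℤ → Ω → EuclideanSpace ℝ (Fin d)) (hε : ∀ t, StronglyMeasurable (ε t)) : Prop :=
  ∀ᵐ ω ∂P, (⨆ (t : ℤ) (_ : 1 ≤ t),
    condLExp (innovFiltration ε hε (t - 1)) P (fun ω' => ‖ε t ω'‖ₑ ^ 4) ω) < ∞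

/-- Conditions on the deterministic coefficients `B_{j,t}` and trend `μ_t`. Both are arrays whose
first index `T` is the sample size, so that rescaled-time coefficients such as `B_j(t/T)` are
covered; arrays that do not depend on `T` are the special case of a single sequence, and then
`bdd_trend` follows from `var_trend`. -/
structure IsVMACoeff {d : ℕ} (μ : ℕ → ℕ → EuclideanSpace ℝ (Fin d))
    (B : ℕ → ℕ → ℕ → Matrix (Fin d) (Fin d) ℝ) : Prop where
  /-- `max_{t ≥ 1} ∑_{j ≥ 1} j ‖B_{j,t}‖ < ∞` -/
  bdd_coeff : ∃ C : ℝ≥0, ∀ T t : ℕ, 1 ≤ T → 1 ≤ t → ∑' j : ℕ, (j : ℝ≥0∞) * ‖B T j t‖ₑ ≤ C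
  /-- `max_{t ≥ 1} ‖B_{0,t}‖ < ∞` -/
  bdd_coeff_zero : ∃ C : ℝ≥0, ∀ T t : ℕ, 1 ≤ T → 1 ≤ t → ‖B T 0 t‖ₑ ≤ C
  /-- `limsup_T ∑_{t=1}^{T-1} ∑_{j ≥ 1} j ‖B_{j,t+1} - B_{j,t}‖ < ∞` -/
  var_coeff : limsup (fun T : ℕ => ∑ t ∈ Finset.Ico 1 T,
    ∑' j : ℕ, (j : ℝ≥0∞) * ‖B T j (t + 1) - B T j t‖ₑ) atTop < ∞
  /-- `limsup_T ∑_{t=1}^{T-1} ‖μ_{t+1} - μ_t‖ < ∞` -/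
  var_trend : limsup (fun T : ℕ => ∑ t ∈ Finset.Ico 1 T, ‖μ T (t + 1) - μ T t‖ₑ) atTop < ∞
  /-- `max_{t ≥ 1} ‖μ_t‖ < ∞` -/
  bdd_trend : ∃ C : ℝ≥0, ∀ T t : ℕ, 1 ≤ T → 1 ≤ t → ‖μ T t‖ₑ ≤ C

/-- `x` is the time-varying VMA(∞) process `x_t = μ_t + ∑_{j ≥ 0} B_{j,t} ε_{t-j}`, `t ≥ 1`, the
series converging almost surely. -/
def IsTVVMA {Ω : Type*} [MeasurableSpace Ω] (P : Measure Ω) {d : ℕ}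
    (μ : ℕ → ℕ → EuclideanSpace ℝ (Fin d)) (B : ℕ → ℕ → ℕ → Matrix (Fin d) (Fin d) ℝ)
    (ε : ℤ → Ω → EuclideanSpace ℝ (Fin d)) (x : ℕ → ℕ → Ω → EuclideanSpace ℝ (Fin d)) : Prop :=
  ∀ T t : ℕ, 1 ≤ T → 1 ≤ t → ∀ᵐ ω ∂P,
    HasSum (fun j : ℕ => Matrix.toEuclideanLin (B T j t) (ε ((t : ℤ) - (j : ℤ)) ω))
      (x T t ω - μ T t)

/-- `d_T = sup_{τ ∈ [a,b], 1 ≤ t ≤ T} ‖W_{T,t}(τ)‖`. -/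
noncomputable def weightSup {m d : ℕ} (a b : ℝ)
    (W : ℕ → ℕ → ℝ → Matrix (Fin m) (Fin d) ℝ) (T : ℕ) : ℝ :=
  ⨆ q : Icc a b × Finset.Icc 1 T, ‖W T q.2 q.1‖

/-- Conditions on the deterministic weights `W_{T,t}(τ)`, `1 ≤ t ≤ T`, `τ ∈ [a,b]`. -/
structure IsWeight {m d : ℕ} (a b : ℝ)
    (W : ℕ → ℕ → ℝ → Matrix (Fin m) (Fin d) ℝ) : Prop where
  /-- every entry of every `W_{T,t}` is Lipschitz on `[a,b]` -/
  lipschitz : ∀ T t : ℕ, 1 ≤ t → t ≤ T → ∀ (i : Fin m) (k : Fin d),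
    ∃ K : ℝ≥0, LipschitzOnWith K (fun τ => W T t τ i k) (Icc a b)
  /-- `sup_τ ∑_{t=1}^T ‖W_{T,t}(τ)‖ = O(1)` -/
  sum_bdd : (fun T : ℕ => ⨆ τ : Icc a b, ∑ t ∈ Finset.Icc 1 T, ‖W T t τ‖)
    =O[atTop] (fun _ => (1 : ℝ))
  /-- `sup_τ ∑_{t=1}^{T-1} ‖W_{T,t+1}(τ) - W_{T,t}(τ)‖ = O(d_T)` -/
  var_bdd : (fun T : ℕ => ⨆ τ : Icc a b, ∑ t ∈ Finset.Ico 1 T, ‖W T (t + 1) τ - W T t τ‖)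
    =O[atTop] (fun T => weightSup a b W T)

/-- `sup_{τ ∈ [a,b]} ‖∑_{t=1}^T W_{T,t}(τ) (x_t - E x_t)‖`. -/
noncomputable def supWeightedSum {Ω : Type*} [MeasurableSpace Ω] (P : Measure Ω) {m d : ℕ}
    (a b : ℝ) (W : ℕ → ℕ → ℝ → Matrix (Fin m) (Fin d) ℝ)
    (x : ℕ → ℕ → Ω → EuclideanSpace ℝ (Fin d)) (T : ℕ) (ω : Ω) : ℝ :=
  ⨆ τ : Icc a b, ‖∑ t ∈ Finset.Icc 1 T,
    Matrix.toEuclideanLin (W T t τ) (x T t ω - ∫ ω', x T t ω' ∂P)‖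

/-- The random matrix `y zᵀ - E(y zᵀ)`, for random vectors `y`, `z`; the expectation is taken
entry by entry. -/
noncomputable def centredOuter {Ω : Type*} [MeasurableSpace Ω] (P : Measure Ω) {d : ℕ}
    (y z : Ω → EuclideanSpace ℝ (Fin d)) (ω : Ω) : Matrix (Fin d) (Fin d) ℝ :=
  Matrix.of fun i k => y ω i * z ω k - ∫ ω', y ω' i * z ω' k ∂P

/-- `sup_{τ ∈ [a,b]} ‖∑_{t=1}^T W_{T,t}(τ) (x_t x_{t+p}ᵀ - E(x_t x_{t+p}ᵀ))‖`. -/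
noncomputable def supWeightedCross {Ω : Type*} [MeasurableSpace Ω] (P : Measure Ω) {m d : ℕ}
    (a b : ℝ) (W : ℕ → ℕ → ℝ → Matrix (Fin m) (Fin d) ℝ)
    (x : ℕ → ℕ → Ω → EuclideanSpace ℝ (Fin d)) (p : ℕ) (T : ℕ) (ω : Ω) : ℝ :=
  ⨆ τ : Icc a b, ‖∑ t ∈ Finset.Icc 1 T, W T t τ * centredOuter P (x T t) (x T (t + p)) ω‖

/-!
The trend part of `x_t` is deterministic, so everything reduces to scalar linear processes
`∑ⱼ a_{j,t} z_{t-j}` in martingale differences `z`, to their products, and to scalar weights `v`,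
the entries of `W_{T,t}(τ)`. The only features of the weights that matter are `∑ |v_t| ≤ G` and
that their supremum and total variation are at most `G d_T` (`IsLocalWeight`), and all bounds are
uniform over this class. Hence no grid of points `τ` is needed, and the size of the Lipschitz
constants of the weights plays no role: Lipschitz continuity only makes the weights bounded.

Uniformity comes from summation by parts over blocks (`abs_sum_mul_le_of_blockSum_le`). If all sums
of `z` over intervals of length at most `ℓ` in `{1, …, T}` are at most `Λ`, then
`|∑ v_t z_t| ≤ Λ (G / ℓ + 3 G d_T)`. With `ℓ` of order `1 / d_T` this is of order `d_T Λ`, and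
`Λ` is a maximum over polynomially many interval sums, which a union bound controls by a multiple
of `√(log T / d_T)`; together this is the rate `θ = √(d_T log T)`.

The interval sums are estimated by truncating their terms at `θ⁻¹`, recentring, and applying
Freedman's exponential inequality (`measure_martingaleTransform_gt_le`). For single innovations
the conditional variances are constants (`measure_exists_blockSum_gt_le`). For products
(`measure_exists_blockSum_mul_gt_le`) there are two cases. Two factors at the same time form a
centred product whose conditional variance is bounded by the conditional fourth moment. At
different times the earlier factor is a predictable multiplier of the later one, and the
conditional variance of an interval sum is a multiple of the sum of squares of the earlier factor,
which the first case controls. The condition `T ^ (2 / δ) d_T log T → 0`, with `4 / δ` for products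
since their factors are truncated at `θ ^ (-1 / 2)`, says that the probability that some innovation
exceeds the truncation level, at most a multiple of `T θ ^ δ`, or of `T θ ^ (δ / 2)` for products,
tends to `0`.

A coefficient sequence that is bounded and of bounded variation is absorbed into the weights. The
lag `j` costs at most a factor `j + 1`, because innovations with nonpositive index are treated
separately in mean: at most `j` of the terms `z_{t-j}`, `1 ≤ t ≤ T`, are of this kind, and each has
weight at most a multiple of `d_T`. Summability of `j ‖B_{j,t}‖` then gives
`isUniformBigOP_linearProcess` and `isUniformBigOP_linearProcess_mul`. The variation of `B_{0,t}` in
`t` is not assumed to be bounded, so `B_{0,t} ε_t` is treated as a further innovation, stacked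
below `ε_t`; the stacked innovations have coefficient arrays of bounded variation.
-/

/-! ### Summation by parts over blocks -/

theorem sum_mul_eq_sub_sum_partialSum (g z : ℕ → ℝ) {a n : ℕ} (han : a ≤ n) :
    ∑ t ∈ Finset.Ico a n, g t * z t = g n * ∑ s ∈ Finset.Ico a n, z s
      - ∑ t ∈ Finset.Ico a n, (g (t + 1) - g t) * ∑ s ∈ Finset.Ico a (t + 1), z s := by
  induction n, han using Nat.le_induction with
  | base => simp
  | succ n hn ih =>
    rw [Finset.sum_Ico_succ_top hn, ih, Finset.sum_Ico_succ_top hn (fun t => (g (t + 1) - g t) * _),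
      Finset.sum_Ico_succ_top hn z]
    ring

theorem abs_sum_mul_le_of_partialSum_le {g z : ℕ → ℝ} {a n : ℕ} (han : a ≤ n) {Λ : ℝ}
    (h : ∀ k, a ≤ k → k ≤ n → |∑ t ∈ Finset.Ico a k, z t| ≤ Λ) :
    |∑ t ∈ Finset.Ico a n, g t * z t|
      ≤ Λ * (∑ t ∈ Finset.Ico a n, |g (t + 1) - g t| + |g n|) := by
  rw [sum_mul_eq_sub_sum_partialSum g z han]
  have h1 : |g n * ∑ s ∈ Finset.Ico a n, z s| ≤ Λ * |g n| := by
    rw [abs_mul, mul_comm]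
    exact mul_le_mul_of_nonneg_right (h n han le_rfl) (abs_nonneg _)
  have h2 : |∑ t ∈ Finset.Ico a n, (g (t + 1) - g t) * ∑ s ∈ Finset.Ico a (t + 1), z s|
      ≤ Λ * ∑ t ∈ Finset.Ico a n, |g (t + 1) - g t| := by
    rw [Finset.mul_sum]
    refine (Finset.abs_sum_le_sum_abs _ _).trans (Finset.sum_le_sum fun t ht => ?_)
    rw [abs_mul, mul_comm]
    rw [Finset.mem_Ico] at ht
    exact mul_le_mul_of_nonneg_right (h (t + 1) (by omega) (by omega)) (abs_nonneg _)
  rw [sub_eq_add_neg, mul_add, add_comm]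
  refine (abs_add_le _ _).trans ?_
  rw [abs_neg]
  exact add_le_add h2 h1

theorem abs_le_abs_add_variation (g : ℕ → ℝ) {a t n : ℕ} (hat : a ≤ t) (htn : t ≤ n) :
    |g n| ≤ |g t| + ∑ s ∈ Finset.Ico a n, |g (s + 1) - g s| := by
  have h1 : g n = g t + ∑ s ∈ Finset.Ico t n, (g (s + 1) - g s) := by
    rw [Finset.sum_Ico_sub g htn]; ring
  calc |g n| ≤ |g t| + |∑ s ∈ Finset.Ico t n, (g (s + 1) - g s)| := by
        conv_lhs => rw [h1]
        exact abs_add_le _ _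
    _ ≤ |g t| + ∑ s ∈ Finset.Ico t n, |g (s + 1) - g s| := by
        gcongr; exact Finset.abs_sum_le_sum_abs _ _
    _ ≤ _ := by
        gcongr

/-- Summation by parts block by block. A weighted sum is controlled by the sums of `z` over
intervals of length at most `ℓ` alone: in each block the last weight is at most the average
weight of the block plus the variation over the block. -/
theorem abs_sum_mul_le_of_blockSum_le (g z : ℕ → ℝ) (n : ℕ) {ℓ : ℕ} (hℓ : 1 ≤ ℓ) {Λ : ℝ}
    (hΛ : 0 ≤ Λ) (a : ℕ) (han : a ≤ n)
    (h : ∀ i k, a ≤ i → i ≤ k → k ≤ n → k ≤ i + ℓ → |∑ t ∈ Finset.Ico i k, z t| ≤ Λ) :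
    |∑ t ∈ Finset.Ico a n, g t * z t|
      ≤ Λ * ((∑ t ∈ Finset.Ico a n, |g t|) / ℓ
          + 2 * ∑ t ∈ Finset.Ico a n, |g (t + 1) - g t| + |g n|) := by
  induction hk : n - a using Nat.strong_induction_on generalizing a with
  | _ k ih =>
    subst hk
    by_cases hn : n ≤ a + ℓ
    · refine (abs_sum_mul_le_of_partialSum_le han
        fun k hk hkn => h a k le_rfl hk hkn (by omega)).trans ?_
      have h1 : 0 ≤ ∑ t ∈ Finset.Ico a n, |g (t + 1) - g t| :=
        Finset.sum_nonneg fun _ _ => abs_nonneg _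
      have h2 : 0 ≤ (∑ t ∈ Finset.Ico a n, |g t|) / ℓ := by positivity
      exact mul_le_mul_of_nonneg_left (by linarith) hΛ
    · push Not at hn
      have hrest := ih (n - (a + ℓ)) (by omega) (a + ℓ) hn.le
        (fun i k hi => h i k (by omega)) rfl
      have hblock := abs_sum_mul_le_of_partialSum_le (g := g) (z := z) (a := a) (n := a + ℓ)
        (by omega) (Λ := Λ) fun k hk hkn => h a k le_rfl hk (by omega) hkn
      have hav : |g (a + ℓ)| ≤ (∑ t ∈ Finset.Ico a (a + ℓ), |g t|) / ℓ
          + ∑ t ∈ Finset.Ico a (a + ℓ), |g (t + 1) - g t| := by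
        have hsum : ∑ _t ∈ Finset.Ico a (a + ℓ), |g (a + ℓ)|
            ≤ ∑ t ∈ Finset.Ico a (a + ℓ),
              (|g t| + ∑ t ∈ Finset.Ico a (a + ℓ), |g (t + 1) - g t|) :=
          Finset.sum_le_sum fun t ht => by
            rw [Finset.mem_Ico] at ht
            exact abs_le_abs_add_variation g ht.1 ht.2.le
        rw [Finset.sum_add_distrib] at hsum
        simp only [Finset.sum_const, Nat.card_Ico, nsmul_eq_mul, add_tsub_cancel_left] at hsum
        have hpos : (0 : ℝ) < ℓ := by exact_mod_cast hℓ
        rw [← sub_le_iff_le_add, le_div_iff₀ hpos]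
        linarith
      have hsplit (f : ℕ → ℝ) : ∑ t ∈ Finset.Ico a n, f t
          = ∑ t ∈ Finset.Ico a (a + ℓ), f t + ∑ t ∈ Finset.Ico (a + ℓ) n, f t :=
        (Finset.sum_Ico_consecutive f (by omega) hn.le).symm
      rw [hsplit, hsplit fun t => |g t|, hsplit fun t => |g (t + 1) - g t|]
      refine (abs_add_le _ _).trans ((add_le_add hblock hrest).trans ?_)
      rw [← mul_add]
      refine mul_le_mul_of_nonneg_left ?_ hΛ
      rw [add_div]
      linarith

/-- `a` is bounded by `b` on `{1, …, T}` and has total variation at most `b` there. -/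
structure IsBVBdd (a : ℕ → ℝ) (T : ℕ) (b : ℝ) : Prop where
  sup : ∀ t, 1 ≤ t → t ≤ T → |a t| ≤ b
  var : ∑ t ∈ Finset.Ico 1 T, |a (t + 1) - a t| ≤ b

/-- The scalar weights for which bounds are uniform: total mass at most `G` on `{1, …, T}`, and
supremum and total variation at most `H`. -/
structure IsLocalWeight (v : ℕ → ℝ) (T : ℕ) (G H : ℝ) : Prop extends IsBVBdd v T H where
  mass : ∑ t ∈ Finset.Icc 1 T, |v t| ≤ G

theorem IsBVBdd.variation_mul_le {a b : ℕ → ℝ} {T : ℕ} {A B : ℝ} (hB0 : 0 ≤ B) (hA0 : 0 ≤ A)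
    (ha : IsBVBdd a T A) (hb : IsBVBdd b T B) :
    ∑ t ∈ Finset.Ico 1 T, |a (t + 1) * b (t + 1) - a t * b t| ≤ 2 * (A * B) := by
  calc _ ≤ ∑ t ∈ Finset.Ico 1 T, (|a (t + 1) - a t| * B + A * |b (t + 1) - b t|) := by
        refine Finset.sum_le_sum fun t ht => ?_
        rw [Finset.mem_Ico] at ht
        have e : a (t + 1) * b (t + 1) - a t * b t
            = (a (t + 1) - a t) * b (t + 1) + a t * (b (t + 1) - b t) := by ring
        rw [e]
        refine (abs_add_le _ _).trans ?_
        rw [abs_mul, abs_mul]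
        gcongr
        · exact hb.sup _ (by omega) (by omega)
        · exact ha.sup _ (by omega) (by omega)
    _ = (∑ t ∈ Finset.Ico 1 T, |a (t + 1) - a t|) * B
        + A * ∑ t ∈ Finset.Ico 1 T, |b (t + 1) - b t| := by
        rw [Finset.sum_add_distrib, Finset.sum_mul, Finset.mul_sum]
    _ ≤ A * B + A * B := by
        gcongr
        · exact ha.var
        · exact hb.var
    _ = _ := by ring

theorem IsBVBdd.mul {a b : ℕ → ℝ} {T : ℕ} {A B : ℝ} (hA0 : 0 ≤ A) (hB0 : 0 ≤ B)
    (ha : IsBVBdd a T A) (hb : IsBVBdd b T B) : IsBVBdd (fun t => a t * b t) T (2 * (A * B)) where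
  sup t h1 h2 := by
    rw [abs_mul]
    have := mul_le_mul (ha.sup t h1 h2) (hb.sup t h1 h2) (abs_nonneg _) hA0
    nlinarith [mul_nonneg hA0 hB0]
  var := IsBVBdd.variation_mul_le hB0 hA0 ha hb

theorem IsLocalWeight.mul {v b : ℕ → ℝ} {T : ℕ} {G H B : ℝ} (hH0 : 0 ≤ H) (hB0 : 0 ≤ B)
    (hv : IsLocalWeight v T G H) (hb : IsBVBdd b T B) :
    IsLocalWeight (fun t => v t * b t) T (G * B) (2 * (H * B)) where
  toIsBVBdd := hv.toIsBVBdd.mul hH0 hB0 hb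
  mass := by
    calc _ ≤ ∑ t ∈ Finset.Icc 1 T, |v t| * B := by
          refine Finset.sum_le_sum fun t ht => ?_
          rw [Finset.mem_Icc] at ht
          rw [abs_mul]
          gcongr
          exact hb.sup t ht.1 ht.2
      _ = (∑ t ∈ Finset.Icc 1 T, |v t|) * B := by rw [Finset.sum_mul]
      _ ≤ _ := by gcongr; exact hv.mass

theorem IsLocalWeight.abs_sum_mul_le {v z : ℕ → ℝ} {T a ℓ : ℕ} {G H Λ : ℝ}
    (hv : IsLocalWeight v T G H) (hH0 : 0 ≤ H) (ha : 1 ≤ a) (hℓ : 1 ≤ ℓ) (hΛ : 0 ≤ Λ)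
    (h : ∀ i k, a ≤ i → i ≤ k → k ≤ T + 1 → k ≤ i + ℓ → |∑ t ∈ Finset.Ico i k, z t| ≤ Λ) :
    |∑ t ∈ Finset.Ico a (T + 1), v t * z t| ≤ Λ * (G / ℓ + 4 * H) := by
  have hG0 : 0 ≤ G := (Finset.sum_nonneg fun _ _ => abs_nonneg _).trans hv.mass
  rcases le_or_gt a T with haT | haT
  swap
  · rw [Finset.Ico_eq_empty (by omega)]
    simp only [Finset.sum_empty, abs_zero]
    positivity
  -- Setting the weight to zero beyond `T` adds at most `H` to the variation.
  set g : ℕ → ℝ := fun t => if t ≤ T then v t else 0 with hg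
  have hgv : ∀ t, t ≤ T → g t = v t := fun t ht => by simp [hg, ht]
  have hgT : g (T + 1) = 0 := by simp [hg]
  have key := abs_sum_mul_le_of_blockSum_le g z (T + 1) hℓ hΛ a (by omega) h
  have e1 : ∑ t ∈ Finset.Ico a (T + 1), v t * z t = ∑ t ∈ Finset.Ico a (T + 1), g t * z t :=
    Finset.sum_congr rfl fun t ht => by
      rw [Finset.mem_Ico] at ht
      rw [hgv t (by omega)]
  rw [e1]
  refine key.trans (mul_le_mul_of_nonneg_left ?_ hΛ)
  have e2 : ∑ t ∈ Finset.Ico a (T + 1), |g t| ≤ G := by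
    refine le_trans ?_ hv.mass
    calc _ = ∑ t ∈ Finset.Ico a (T + 1), |v t| := Finset.sum_congr rfl fun t ht => by
          rw [Finset.mem_Ico] at ht
          rw [hgv t (by omega)]
      _ ≤ _ := Finset.sum_le_sum_of_subset_of_nonneg
          (fun t ht => by rw [Finset.mem_Ico] at ht; rw [Finset.mem_Icc]; omega)
          fun _ _ _ => abs_nonneg _
  have e3 : ∑ t ∈ Finset.Ico a (T + 1), |g (t + 1) - g t| ≤ 2 * H := by
    rw [Finset.sum_Ico_succ_top haT, hgT, hgv T le_rfl, zero_sub, abs_neg]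
    have h1 := hv.sup T (by omega) le_rfl
    have h2 : ∑ t ∈ Finset.Ico a T, |g (t + 1) - g t| ≤ H := by
      refine le_trans ?_ hv.var
      calc _ = ∑ t ∈ Finset.Ico a T, |v (t + 1) - v t| := Finset.sum_congr rfl fun t ht => by
            rw [Finset.mem_Ico] at ht
            rw [hgv t (by omega), hgv (t + 1) (by omega)]
        _ ≤ _ := Finset.sum_le_sum_of_subset_of_nonneg
            (Finset.Ico_subset_Ico_left ha) fun _ _ _ => abs_nonneg _
    linarith
  rw [hgT, abs_zero]
  have e4 : (∑ t ∈ Finset.Ico a (T + 1), |g t|) / ℓ ≤ G / ℓ := by gcongr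
  linarith
/-! ### An exponential inequality for truncated martingale differences -/

section Freedman

variable {Ω : Type*} {m0 : MeasurableSpace Ω} {P : Measure Ω} [IsProbabilityMeasure P]

/-- The one-step bound behind Freedman's inequality, from `exp y ≤ 1 + y + y ^ 2` for `|y| ≤ 1`. -/
theorem condExp_exp_mul_le {m : MeasurableSpace Ω} (hm : m ≤ m0) {ψ v : Ω → ℝ} {c θ : ℝ}
    (hψ : StronglyMeasurable[m0] ψ) (hc : ∀ ω, |ψ ω| ≤ c) (hθ : |θ| * c ≤ 1)
    (hv : P[fun ω => ψ ω ^ 2 | m] ≤ᵐ[P] v) :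
    P[fun ω => Real.exp (θ * ψ ω) | m]
      ≤ᵐ[P] fun ω => Real.exp (θ * (P[ψ | m]) ω + θ ^ 2 * v ω) := by
  have hθψ : ∀ ω, |θ * ψ ω| ≤ 1 := fun ω => by
    rw [abs_mul]
    exact (mul_le_mul_of_nonneg_left (hc ω) (abs_nonneg _)).trans hθ
  have hi : Integrable ψ P := .of_bound hψ.aestronglyMeasurable c (ae_of_all _ hc)
  have hi2 : Integrable (fun ω => ψ ω ^ 2) P :=
    .of_bound (hψ.pow 2).aestronglyMeasurable (c ^ 2) (ae_of_all _ fun ω => by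
      rw [Real.norm_eq_abs, abs_pow]
      exact pow_le_pow_left₀ (abs_nonneg _) (hc ω) 2)
  have hie : Integrable (fun ω => Real.exp (θ * ψ ω)) P :=
    .of_bound (Real.continuous_exp.comp_stronglyMeasurable
      (hψ.const_mul θ)).aestronglyMeasurable (Real.exp 1) (ae_of_all _ fun ω => by
        rw [Real.norm_eq_abs, Real.abs_exp]
        exact Real.exp_le_exp.mpr ((le_abs_self _).trans (hθψ ω)))
  have hquad : (fun ω => Real.exp (θ * ψ ω))
      ≤ᵐ[P] (fun _ => (1 : ℝ)) + (θ • ψ + θ ^ 2 • fun ω => ψ ω ^ 2) := ae_of_all _ fun ω => by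
    have := (abs_le.mp (Real.abs_exp_sub_one_sub_id_le (hθψ ω))).2
    simp only [Pi.add_apply, Pi.smul_apply, smul_eq_mul]
    nlinarith
  have h1 := condExp_mono (m := m) hie
    ((integrable_const (1 : ℝ)).add ((hi.smul θ).add (hi2.smul (θ ^ 2)))) hquad
  have h2 := condExp_add (integrable_const (1 : ℝ)) ((hi.smul θ).add (hi2.smul (θ ^ 2))) m
  have h3 := condExp_add (hi.smul θ) (hi2.smul (θ ^ 2)) m
  have h4 := condExp_smul (μ := P) θ ψ m
  have h5 := condExp_smul (μ := P) (θ ^ 2) (fun ω => ψ ω ^ 2) m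
  filter_upwards [h1, h2, h3, h4, h5, hv] with ω h1 h2 h3 h4 h5 hv
  refine h1.trans ?_
  rw [h2, Pi.add_apply, h3, Pi.add_apply, h4, h5, condExp_const hm]
  simp only [Pi.smul_apply, smul_eq_mul]
  refine le_trans ?_ (Real.add_one_le_exp _)
  nlinarith [mul_le_mul_of_nonneg_left hv (sq_nonneg θ)]

/-- The process `exp (θ ∑ (ψ_t - E(ψ_t | F_{t-1})) - θ² ∑ v_t)` is a supermartingale when `v_t`
dominates the conditional second moment of `ψ_t` and `|θ ψ_t| ≤ 1`. -/
theorem integral_exp_compensated_sum_le_one (ℱ : Filtration ℤ m0) {ψ v : ℤ → Ω → ℝ} {c θ : ℝ}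
    (hψ : ∀ t, StronglyMeasurable[ℱ t] (ψ t)) (hc : ∀ t ω, |ψ t ω| ≤ c) (hθ : |θ| * c ≤ 1)
    (s : ℤ) (hvm : ∀ t, s < t → StronglyMeasurable[ℱ (t - 1)] (v t))
    (hv : ∀ t, s < t → P[fun ω => ψ t ω ^ 2 | ℱ (t - 1)] ≤ᵐ[P] v t) (n : ℕ) :
    Integrable (fun ω => Real.exp (∑ i ∈ Finset.range n, (θ * ψ (s + 1 + i) ω
        - θ * (P[ψ (s + 1 + i) | ℱ (s + 1 + i - 1)]) ω - θ ^ 2 * v (s + 1 + i) ω))) P ∧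
      ∫ ω, Real.exp (∑ i ∈ Finset.range n, (θ * ψ (s + 1 + i) ω
        - θ * (P[ψ (s + 1 + i) | ℱ (s + 1 + i - 1)]) ω - θ ^ 2 * v (s + 1 + i) ω)) ∂P ≤ 1 := by
  induction n with
  | zero => simp
  | succ n ih =>
    obtain ⟨ih1, ih2⟩ := ih
    set t : ℤ := s + 1 + n with ht
    have hst : s < t := by omega
    set Y : Ω → ℝ := fun ω => Real.exp (∑ i ∈ Finset.range n, (θ * ψ (s + 1 + i) ω
        - θ * (P[ψ (s + 1 + i) | ℱ (s + 1 + i - 1)]) ω - θ ^ 2 * v (s + 1 + i) ω)) with hY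
    set g : Ω → ℝ := fun ω => Real.exp (-(θ * (P[ψ t | ℱ (t - 1)]) ω + θ ^ 2 * v t ω)) with hg
    set e : Ω → ℝ := fun ω => Real.exp (θ * ψ t ω) with he
    have hfun : (fun ω => Real.exp (∑ i ∈ Finset.range (n + 1), (θ * ψ (s + 1 + i) ω
        - θ * (P[ψ (s + 1 + i) | ℱ (s + 1 + i - 1)]) ω - θ ^ 2 * v (s + 1 + i) ω)))
        = fun ω => (Y ω * g ω) * e ω := by
      funext ω
      simp only [hY, hg, he, ← Real.exp_add]
      rw [Finset.sum_range_succ]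
      congr 1
      rw [← ht]
      ring
    rw [hfun]
    have hYm : StronglyMeasurable[ℱ (t - 1)] Y := by
      refine Real.continuous_exp.comp_stronglyMeasurable
        (Finset.stronglyMeasurable_fun_sum _ fun i hi => ?_)
      rw [Finset.mem_range] at hi
      have h1 : s + 1 + (i : ℤ) ≤ t - 1 := by omega
      have h2 : s + 1 + (i : ℤ) - 1 ≤ t - 1 := by omega
      exact ((((hψ _).mono (ℱ.mono h1)).const_mul θ).sub
        ((stronglyMeasurable_condExp.mono (ℱ.mono h2)).const_mul θ)).sub
        (((hvm _ (by omega)).mono (ℱ.mono h2)).const_mul _)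
    have hgm : StronglyMeasurable[ℱ (t - 1)] g :=
      Real.continuous_exp.comp_stronglyMeasurable
        ((stronglyMeasurable_condExp.const_mul θ).add ((hvm t hst).const_mul _)).neg
    have hψm : StronglyMeasurable (ψ t) := (hψ t).mono (ℱ.le t)
    have heb : ∀ ω, |e ω| ≤ Real.exp 1 := fun ω => by
      rw [he, Real.abs_exp]
      refine Real.exp_le_exp.mpr ((le_abs_self _).trans ?_)
      rw [abs_mul]
      exact (mul_le_mul_of_nonneg_left (hc t ω) (abs_nonneg _)).trans hθ
    have hem : StronglyMeasurable e :=
      Real.continuous_exp.comp_stronglyMeasurable (hψm.const_mul θ)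
    have hei : Integrable e P := .of_bound hem.aestronglyMeasurable _ (ae_of_all _ heb)
    have hcond := condExp_exp_mul_le (ℱ.le (t - 1)) hψm (hc t) hθ (hv t hst)
    have hgb : ∀ᵐ ω ∂P, ‖g ω‖ ≤ Real.exp 1 := by
      have h2 := ae_bdd_abs_condExp_of_ae_bdd_abs (m := ℱ (t - 1)) (ae_of_all P (hc t))
      have h3 : (0 : Ω → ℝ) ≤ᵐ[P] P[fun ω => ψ t ω ^ 2 | ℱ (t - 1)] :=
        condExp_nonneg (ae_of_all _ fun ω => sq_nonneg _)
      filter_upwards [h2, h3, hv t hst] with ω h2 h3 h4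
      rw [Real.norm_eq_abs, hg, Real.abs_exp]
      refine Real.exp_le_exp.mpr ?_
      have h5 : |θ * (P[ψ t | ℱ (t - 1)]) ω| ≤ 1 := by
        rw [abs_mul]
        exact (mul_le_mul_of_nonneg_left h2 (abs_nonneg _)).trans hθ
      have h6 : 0 ≤ θ ^ 2 * v t ω := mul_nonneg (sq_nonneg _) (h3.trans h4)
      linarith [(abs_le.mp h5).1]
    have hYg : Integrable (fun ω => Y ω * g ω) P :=
      ih1.mul_bdd (hgm.mono (ℱ.le _)).aestronglyMeasurable hgb
    have hYge : Integrable (fun ω => (Y ω * g ω) * e ω) P :=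
      hYg.mul_bdd hem.aestronglyMeasurable (ae_of_all _ heb)
    refine ⟨hYge, ?_⟩
    have hpull := condExp_mul_of_stronglyMeasurable_left (μ := P) (m := ℱ (t - 1))
      (hYm.mul hgm) hYge hei
    calc ∫ ω, (Y ω * g ω) * e ω ∂P
        = ∫ ω, (P[(fun ω => Y ω * g ω) * e | ℱ (t - 1)]) ω ∂P :=
          (integral_condExp (ℱ.le (t - 1))).symm
      _ ≤ ∫ ω, Y ω ∂P := by
          refine integral_mono_ae integrable_condExp ih1 ?_
          refine hpull.trans_le ?_
          filter_upwards [hcond] with ω h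
          simp only [Pi.mul_apply]
          have hY0 : 0 ≤ Y ω := (Real.exp_pos _).le
          have hg0 : 0 ≤ g ω := (Real.exp_pos _).le
          calc Y ω * g ω * (P[e | ℱ (t - 1)]) ω
              ≤ Y ω * g ω * Real.exp (θ * (P[ψ t | ℱ (t - 1)]) ω + θ ^ 2 * v t ω) :=
                mul_le_mul_of_nonneg_left h (mul_nonneg hY0 hg0)
            _ = Y ω := by
                rw [hg, mul_assoc, ← Real.exp_add, neg_add_cancel, Real.exp_zero, mul_one]
      _ ≤ 1 := ih2

theorem measure_compensated_sum_ge_le (ℱ : Filtration ℤ m0) {ψ v : ℤ → Ω → ℝ} {c θ : ℝ}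
    (hψ : ∀ t, StronglyMeasurable[ℱ t] (ψ t)) (hc : ∀ t ω, |ψ t ω| ≤ c) (hθ : |θ| * c ≤ 1)
    (s : ℤ) (hvm : ∀ t, s < t → StronglyMeasurable[ℱ (t - 1)] (v t))
    (hv : ∀ t, s < t → P[fun ω => ψ t ω ^ 2 | ℱ (t - 1)] ≤ᵐ[P] v t) (n : ℕ) (x V : ℝ) :
    P {ω | x ≤ θ * ∑ i ∈ Finset.range n,
          (ψ (s + 1 + i) ω - (P[ψ (s + 1 + i) | ℱ (s + 1 + i - 1)]) ω) ∧
        ∑ i ∈ Finset.range n, v (s + 1 + i) ω ≤ V}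
      ≤ ENNReal.ofReal (Real.exp (-x + θ ^ 2 * V)) := by
  obtain ⟨h1, h2⟩ := integral_exp_compensated_sum_le_one ℱ hψ hc hθ s hvm hv n
  set Y : Ω → ℝ := fun ω => Real.exp (∑ i ∈ Finset.range n, (θ * ψ (s + 1 + i) ω
        - θ * (P[ψ (s + 1 + i) | ℱ (s + 1 + i - 1)]) ω - θ ^ 2 * v (s + 1 + i) ω)) with hY
  have hsub : {ω | x ≤ θ * ∑ i ∈ Finset.range n,
          (ψ (s + 1 + i) ω - (P[ψ (s + 1 + i) | ℱ (s + 1 + i - 1)]) ω) ∧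
        ∑ i ∈ Finset.range n, v (s + 1 + i) ω ≤ V}
      ⊆ {ω | Real.exp (x - θ ^ 2 * V) ≤ Y ω} := by
    rintro ω ⟨hω1, hω2⟩
    refine Real.exp_le_exp.mpr ?_
    simp only [Finset.sum_sub_distrib, ← Finset.mul_sum] at hω1 ⊢
    nlinarith [mul_le_mul_of_nonneg_left hω2 (sq_nonneg θ)]
  have hmk := mul_meas_ge_le_integral_of_nonneg (μ := P) (f := Y)
    (ae_of_all _ fun ω => (Real.exp_pos _).le) h1 (Real.exp (x - θ ^ 2 * V))
  refine (measure_mono hsub).trans ?_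
  rw [← ofReal_measureReal]
  refine ENNReal.ofReal_le_ofReal ?_
  have hpos := Real.exp_pos (x - θ ^ 2 * V)
  have h3 : Real.exp (x - θ ^ 2 * V) * P.real {ω | Real.exp (x - θ ^ 2 * V) ≤ Y ω} ≤ 1 :=
    hmk.trans h2
  rw [show -x + θ ^ 2 * V = -(x - θ ^ 2 * V) by ring, Real.exp_neg, ← one_div, le_div_iff₀ hpos]
  linarith

/-- Freedman's inequality for the compensated sums of a bounded adapted sequence. -/
theorem measure_abs_compensated_sum_gt_le (ℱ : Filtration ℤ m0) {ψ v : ℤ → Ω → ℝ} {c θ : ℝ}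
    (hψ : ∀ t, StronglyMeasurable[ℱ t] (ψ t)) (hc : ∀ t ω, |ψ t ω| ≤ c) (hθ0 : 0 ≤ θ)
    (hθ : θ * c ≤ 1)
    (s : ℤ) (hvm : ∀ t, s < t → StronglyMeasurable[ℱ (t - 1)] (v t))
    (hv : ∀ t, s < t → P[fun ω => ψ t ω ^ 2 | ℱ (t - 1)] ≤ᵐ[P] v t) (n : ℕ) (x V : ℝ) :
    P {ω | x < |∑ i ∈ Finset.range n,
          (ψ (s + 1 + i) ω - (P[ψ (s + 1 + i) | ℱ (s + 1 + i - 1)]) ω)| ∧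
        ∑ i ∈ Finset.range n, v (s + 1 + i) ω ≤ V}
      ≤ ENNReal.ofReal (2 * Real.exp (-(θ * x) + θ ^ 2 * V)) := by
  have h1 := measure_compensated_sum_ge_le (P := P) ℱ hψ hc (θ := θ)
    (by rwa [abs_of_nonneg hθ0]) s hvm hv n (θ * x) V
  have h2 := measure_compensated_sum_ge_le (P := P) ℱ hψ hc (θ := -θ)
    (by rwa [abs_neg, abs_of_nonneg hθ0]) s hvm hv n (θ * x) V
  rw [neg_sq] at h2
  rw [two_mul, ENNReal.ofReal_add (Real.exp_pos _).le (Real.exp_pos _).le]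
  refine le_trans (measure_mono ?_) ((measure_union_le _ _).trans (add_le_add h1 h2))
  rintro ω ⟨hω1, hω2⟩
  rcases lt_abs.mp hω1 with h | h
  · exact Or.inl ⟨mul_le_mul_of_nonneg_left h.le hθ0, hω2⟩
  · refine Or.inr ⟨?_, hω2⟩
    rw [neg_mul_comm]
    exact mul_le_mul_of_nonneg_left h.le hθ0

end Freedman

/-! ### Truncation and predictable multipliers -/

section Truncation

variable {Ω : Type*} {m0 : MeasurableSpace Ω} {P : Measure Ω}

/-- The part of a moment beyond the truncation level `s` is controlled by the `δ`-th moment. -/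
theorem lintegral_tail_pow_le {N : Ω → ℝ} (hN0 : ∀ ω, 0 ≤ N ω) {δ s : ℝ} {C : ℝ≥0} (hs : 0 < s)
    (hC : ∫⁻ ω, ‖N ω‖ₑ ^ δ ∂P ≤ C) (q : ℕ) (hq : (q : ℝ) ≤ δ) :
    ∫⁻ ω, ENNReal.ofReal ({ω | s < N ω}.indicator (fun ω => N ω ^ q) ω) ∂P
      ≤ ENNReal.ofReal (C * s ^ ((q : ℝ) - δ)) := by
  have hδ0 : 0 ≤ δ := (Nat.cast_nonneg q).trans hq
  calc ∫⁻ ω, ENNReal.ofReal ({ω | s < N ω}.indicator (fun ω => N ω ^ q) ω) ∂P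
      ≤ ∫⁻ ω, ENNReal.ofReal (s ^ ((q : ℝ) - δ)) * ‖N ω‖ₑ ^ δ ∂P := by
        refine lintegral_mono fun ω => ?_
        by_cases h : s < N ω
        · rw [indicator_of_mem (show ω ∈ {ω | s < N ω} from h), Real.enorm_eq_ofReal (hN0 ω),
            ENNReal.ofReal_rpow_of_nonneg (hN0 ω) hδ0,
            ← ENNReal.ofReal_mul (Real.rpow_nonneg hs.le _)]
          refine ENNReal.ofReal_le_ofReal ?_
          have hNpos : 0 < N ω := hs.trans h
          have h1 : N ω ^ ((q : ℝ) - δ) ≤ s ^ ((q : ℝ) - δ) :=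
            Real.rpow_le_rpow_of_nonpos hs h.le (by linarith)
          calc N ω ^ q = N ω ^ ((q : ℝ) - δ) * N ω ^ δ := by
                rw [← Real.rpow_add hNpos, sub_add_cancel, Real.rpow_natCast]
            _ ≤ _ := mul_le_mul_of_nonneg_right h1 (Real.rpow_nonneg hNpos.le _)
        · rw [indicator_of_notMem (show ω ∉ {ω | s < N ω} from h)]
          simp
    _ ≤ ENNReal.ofReal (s ^ ((q : ℝ) - δ)) * C := by
        rw [lintegral_const_mul' _ _ ENNReal.ofReal_ne_top]
        gcongr
    _ = _ := by
        rw [mul_comm, ENNReal.ofReal_mul C.coe_nonneg, ENNReal.ofReal_coe_nnreal]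

theorem measure_gt_le_of_moment {N : Ω → ℝ} (hN : Measurable N) (hN0 : ∀ ω, 0 ≤ N ω) {δ s : ℝ}
    {C : ℝ≥0} (hs : 0 < s) (hδ0 : 0 ≤ δ) (hC : ∫⁻ ω, ‖N ω‖ₑ ^ δ ∂P ≤ C) :
    P {ω | s < N ω} ≤ ENNReal.ofReal (C * s ^ (-δ)) := by
  have h := lintegral_tail_pow_le (P := P) hN0 hs hC 0 (by simpa using hδ0)
  simp only [pow_zero, Nat.cast_zero, zero_sub] at h
  refine le_trans (le_of_eq ?_) h
  have hm : MeasurableSet {ω | s < N ω} := measurableSet_lt measurable_const hN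
  rw [← lintegral_indicator_one hm]
  refine lintegral_congr fun ω => ?_
  by_cases h : s < N ω <;> simp [h]

/-- The accumulated truncation bias `∑ |E(f_t 1{N_t > s} | F_{t-1})|` is small in probability. -/
theorem measure_sum_abs_condExp_tail_gt_le (ℱ : Filtration ℤ m0) {f N : ℤ → Ω → ℝ}
    {δ s y : ℝ} {C : ℝ≥0} (hs : 0 < s) (hy : 0 < y) (q : ℕ) (hq : (q : ℝ) ≤ δ)
    (hfN : ∀ t ω, |f t ω| ≤ N t ω ^ q) (hN0 : ∀ t ω, 0 ≤ N t ω)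
    (hC : ∀ t, 1 ≤ t → ∫⁻ ω, ‖N t ω‖ₑ ^ δ ∂P ≤ C) (n : ℕ) :
    P {ω | y < ∑ i ∈ Finset.range n,
        |(P[{ω | N (1 + i) ω ≤ s}ᶜ.indicator (f (1 + i)) | ℱ (1 + i - 1)]) ω|}
      ≤ ENNReal.ofReal (n * (C * s ^ ((q : ℝ) - δ)) / y) := by
  set r : ℕ → Ω → ℝ := fun i =>
    P[{ω | N (1 + i) ω ≤ s}ᶜ.indicator (f (1 + i)) | ℱ (1 + i - 1)] with hr
  have hb : 0 ≤ C * s ^ ((q : ℝ) - δ) := mul_nonneg C.coe_nonneg (Real.rpow_nonneg hs.le _)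
  have hri : ∀ i, ∫⁻ ω, ‖r i ω‖ₑ ∂P ≤ ENNReal.ofReal (C * s ^ ((q : ℝ) - δ)) := fun i => by
    have h1 := eLpNorm_condExp_le_eLpNorm (μ := P) (m := ℱ (1 + i - 1))
      ({ω | N (1 + i) ω ≤ s}ᶜ.indicator (f (1 + i))) le_rfl
    rw [eLpNorm_one_eq_lintegral_enorm, eLpNorm_one_eq_lintegral_enorm] at h1
    refine h1.trans (le_trans (lintegral_mono fun ω => ?_)
      (lintegral_tail_pow_le (P := P) (hN0 (1 + i)) hs (hC (1 + i) (by omega)) q hq))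
    by_cases h : s < N (1 + i) ω
    · rw [indicator_of_mem (show ω ∈ {ω | N (1 + i) ω ≤ s}ᶜ from not_le.mpr h),
        indicator_of_mem (show ω ∈ {ω | s < N (1 + i) ω} from h), Real.enorm_eq_ofReal_abs]
      exact ENNReal.ofReal_le_ofReal (hfN _ _)
    · rw [indicator_of_notMem (show ω ∉ {ω | N (1 + i) ω ≤ s}ᶜ from fun h' => h (not_le.mp h'))]
      simp
  have hrm : ∀ i, Measurable fun ω => ‖r i ω‖ₑ := fun i =>
    (stronglyMeasurable_condExp.mono (ℱ.le _)).measurable.enorm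
  have hset : {ω | y < ∑ i ∈ Finset.range n, |r i ω|}
      ⊆ {ω | ENNReal.ofReal y ≤ ∑ i ∈ Finset.range n, ‖r i ω‖ₑ} := fun ω hω => by
    have h1 : ∑ i ∈ Finset.range n, ‖r i ω‖ₑ = ENNReal.ofReal (∑ i ∈ Finset.range n, |r i ω|) := by
      rw [ENNReal.ofReal_sum_of_nonneg fun _ _ => abs_nonneg _]
      simp only [Real.enorm_eq_ofReal_abs]
    rw [mem_ofPred_eq, h1]
    exact ENNReal.ofReal_le_ofReal (le_of_lt hω)
  refine (measure_mono hset).trans ((meas_ge_le_lintegral_div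
    (Finset.measurable_sum _ fun i _ => hrm i).aemeasurable
    (ENNReal.ofReal_pos.mpr hy).ne' ENNReal.ofReal_ne_top).trans ?_)
  rw [ENNReal.ofReal_div_of_pos hy, lintegral_finsetSum _ fun i _ => hrm i]
  gcongr
  refine (Finset.sum_le_sum fun i _ => hri i).trans (le_of_eq ?_)
  rw [Finset.sum_const, Finset.card_range, nsmul_eq_mul, ENNReal.ofReal_mul (Nat.cast_nonneg n),
    ENNReal.ofReal_natCast]

variable [IsProbabilityMeasure P]

/-- The compensator of the truncated term `g f 1_K` differs from `g σ` by a tail term only. -/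
theorem condExp_mul_indicator {m : MeasurableSpace Ω} {f g : Ω → ℝ} {K : Set Ω} {σ cg : ℝ}
    (hm : m ≤ m0) (hf : Integrable f P) (hσ : P[f | m] =ᵐ[P] fun _ => σ) (hK : MeasurableSet[m0] K)
    (hg : StronglyMeasurable[m] g) (hgb : ∀ ω, |g ω| ≤ cg) :
    P[fun ω => g ω * K.indicator f ω | m]
      =ᵐ[P] fun ω => g ω * (σ - (P[Kᶜ.indicator f | m]) ω) := by
  have h1 : P[fun ω => g ω * K.indicator f ω | m] =ᵐ[P] g * P[K.indicator f | m] :=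
    condExp_stronglyMeasurable_mul_of_bound hm hg (hf.indicator hK) cg
      (ae_of_all _ fun ω => hgb ω)
  have h2 := condExp_add (hf.indicator hK) (hf.indicator hK.compl) m
  have h3 : K.indicator f + Kᶜ.indicator f = f := indicator_self_add_compl K f
  rw [h3] at h2
  filter_upwards [h1, h2, hσ] with ω h1 h2 h3
  rw [h1, Pi.mul_apply]
  rw [h3, Pi.add_apply] at h2
  rw [h2]
  ring

theorem condExp_sq_mul_indicator_le {m : MeasurableSpace Ω} {f g : Ω → ℝ} {K : Set Ω} {S cg : ℝ}
    (hm : m ≤ m0) (hf : Integrable (fun ω => f ω ^ 2) P)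
    (hS : P[fun ω => f ω ^ 2 | m] ≤ᵐ[P] fun _ => S) (hK : MeasurableSet[m0] K)
    (hg : StronglyMeasurable[m] g) (hgb : ∀ ω, |g ω| ≤ cg) :
    P[fun ω => (g ω * K.indicator f ω) ^ 2 | m] ≤ᵐ[P] fun ω => S * g ω ^ 2 := by
  have e : (fun ω => (g ω * K.indicator f ω) ^ 2)
      = (fun ω => g ω ^ 2) * K.indicator fun ω => f ω ^ 2 := by
    funext ω
    by_cases h : ω ∈ K <;> simp [h, mul_pow]
  have h1 : P[(fun ω => g ω ^ 2) * K.indicator (fun ω => f ω ^ 2) | m]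
      =ᵐ[P] (fun ω => g ω ^ 2) * P[K.indicator fun ω => f ω ^ 2 | m] :=
    condExp_stronglyMeasurable_mul_of_bound hm (hg.pow 2) (hf.indicator hK) (cg ^ 2)
      (ae_of_all _ fun ω => by
        rw [Real.norm_eq_abs, abs_pow]
        exact pow_le_pow_left₀ (abs_nonneg _) (hgb ω) 2)
  have h2 : P[K.indicator (fun ω => f ω ^ 2) | m] ≤ᵐ[P] P[fun ω => f ω ^ 2 | m] :=
    condExp_mono (hf.indicator hK) hf
      (ae_of_all _ fun ω => indicator_le_self' (fun _ _ => sq_nonneg _) ω)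
  rw [e]
  filter_upwards [h1, h2, hS] with ω h1 h2 h3
  rw [h1, Pi.mul_apply, mul_comm]
  exact mul_le_mul_of_nonneg_right (h2.trans h3) (sq_nonneg _)

/-- One block of a martingale transform `∑ g_t (f_t - σ_t)`. Outside the events where the
truncation sets `K_t` are left, where the accumulated conditional second moment exceeds `V`, or
where the compensator of the truncated part exceeds `y`, it is at most `x + y` with the
probability given by Freedman's inequality. -/
theorem measure_martingaleTransform_gt_le (ℱ : Filtration ℤ m0) {f g v : ℤ → Ω → ℝ}
    {K : ℤ → Set Ω} {σ : ℤ → ℝ} {c cg θ : ℝ}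
    (hf : ∀ t, StronglyMeasurable[ℱ t] (f t)) (hfi : ∀ t, Integrable (f t) P)
    (hσ : ∀ t, P[f t | ℱ (t - 1)] =ᵐ[P] fun _ => σ t)
    (hK : ∀ t, MeasurableSet[ℱ t] (K t))
    (hg : ∀ t, StronglyMeasurable[ℱ (t - 1)] (g t)) (hgb : ∀ t ω, |g t ω| ≤ cg)
    (hc : ∀ t ω, |g t ω * (K t).indicator (f t) ω| ≤ c) (hθ0 : 0 ≤ θ) (hθ : θ * c ≤ 1) (s : ℤ)
    (hvm : ∀ t, s < t → StronglyMeasurable[ℱ (t - 1)] (v t))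
    (hv : ∀ t, s < t → P[fun ω => (g t ω * (K t).indicator (f t) ω) ^ 2 | ℱ (t - 1)] ≤ᵐ[P] v t)
    (n : ℕ) (x y V : ℝ) :
    P {ω | (∀ i < n, ω ∈ K (s + 1 + i)) ∧ ∑ i ∈ Finset.range n, v (s + 1 + i) ω ≤ V ∧
        ∑ i ∈ Finset.range n, |g (s + 1 + i) ω *
          (P[(K (s + 1 + i))ᶜ.indicator (f (s + 1 + i)) | ℱ (s + 1 + i - 1)]) ω| ≤ y ∧
        x + y < |∑ i ∈ Finset.range n, g (s + 1 + i) ω * (f (s + 1 + i) ω - σ (s + 1 + i))|}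
      ≤ ENNReal.ofReal (2 * Real.exp (-(θ * x) + θ ^ 2 * V)) := by
  set ψ : ℤ → Ω → ℝ := fun t ω => g t ω * (K t).indicator (f t) ω with hψ
  have hψm : ∀ t, StronglyMeasurable[ℱ t] (ψ t) := fun t =>
    ((hg t).mono (ℱ.mono (by omega))).mul ((hf t).indicator (hK t))
  refine le_trans (measure_mono_ae ?_)
    (measure_abs_compensated_sum_gt_le (P := P) ℱ hψm hc hθ0 hθ s hvm hv n x V)
  have hm : ∀ᵐ ω ∂P, ∀ i : ℕ, (P[ψ (s + 1 + i) | ℱ (s + 1 + i - 1)]) ω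
      = g (s + 1 + i) ω * (σ (s + 1 + i)
        - (P[(K (s + 1 + i))ᶜ.indicator (f (s + 1 + i)) | ℱ (s + 1 + i - 1)]) ω) :=
    ae_all_iff.mpr fun i => condExp_mul_indicator (ℱ.le _) (hfi _) (hσ _)
      (ℱ.le _ _ (hK _)) (hg _) (hgb _)
  filter_upwards [hm] with ω hm
  rintro ⟨hω1, hω2, hω3, hω4⟩
  refine ⟨?_, hω2⟩
  have e : ∑ i ∈ Finset.range n, g (s + 1 + i) ω * (f (s + 1 + i) ω - σ (s + 1 + i))
      = ∑ i ∈ Finset.range n, (ψ (s + 1 + i) ω - (P[ψ (s + 1 + i) | ℱ (s + 1 + i - 1)]) ω)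
        - ∑ i ∈ Finset.range n, g (s + 1 + i) ω *
          (P[(K (s + 1 + i))ᶜ.indicator (f (s + 1 + i)) | ℱ (s + 1 + i - 1)]) ω := by
    rw [← Finset.sum_sub_distrib]
    refine Finset.sum_congr rfl fun i hi => ?_
    rw [hm i, hψ]
    simp only
    rw [indicator_of_mem (hω1 i (Finset.mem_range.mp hi))]
    ring
  have h1 := (Finset.abs_sum_le_sum_abs _ _).trans hω3
  rw [e, sub_eq_add_neg] at hω4
  have h2 := hω4.trans_le (abs_add_le _ _)
  rw [abs_neg] at h2
  show x < _
  linarith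

/-- The conditional second moment of `f 1_K` is at most `A` on the event that the conditional
fourth moment of the envelope `N` is at most `A`, when `|f| ≤ N ^ 2`. No integrability of `N ^ 4`
is needed. -/
theorem condExp_sq_indicator_le_of_condLExp {m : MeasurableSpace Ω} (hm : m ≤ m0) {f N : Ω → ℝ}
    {K : Set Ω} {c A : ℝ} (hA : 0 ≤ A) (hf : StronglyMeasurable[m0] f) (hfN : ∀ ω, |f ω| ≤ N ω ^ 2)
    (hK : MeasurableSet[m0] K) (hc : ∀ ω, |K.indicator f ω| ≤ c) :
    P[fun ω => ({ω | condLExp m P (fun ω' => ‖N ω'‖ₑ ^ 4) ω ≤ ENNReal.ofReal A}.indicator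
        (fun _ => (1 : ℝ)) ω * K.indicator f ω) ^ 2 | m] ≤ᵐ[P] fun _ => A := by
  set H : Set Ω := {ω | condLExp m P (fun ω' => ‖N ω'‖ₑ ^ 4) ω ≤ ENNReal.ofReal A} with hH
  have hHm : MeasurableSet[m] H := (measurable_condLExp m P _) measurableSet_Iic
  set φ : Ω → ℝ := fun ω => (H.indicator (fun _ => (1 : ℝ)) ω * K.indicator f ω) ^ 2 with hφ
  have hφm : StronglyMeasurable[m0] φ :=
    ((stronglyMeasurable_const.indicator (hm _ hHm)).mul (hf.indicator hK)).pow 2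
  have hφb : ∀ ω, ‖φ ω‖ ≤ c ^ 2 := fun ω => by
    rw [Real.norm_eq_abs, abs_pow, abs_mul]
    refine pow_le_pow_left₀ (by positivity) ?_ 2
    refine (mul_le_of_le_one_left (abs_nonneg _) ?_).trans (hc ω)
    by_cases h : ω ∈ H <;> simp [h]
  have hφi : Integrable φ P := .of_bound hφm.aestronglyMeasurable _ (ae_of_all _ hφb)
  have hφ0 : ∀ ω, 0 ≤ φ ω := fun ω => sq_nonneg _
  have hle : ∀ ω, ENNReal.ofReal (φ ω) ≤ H.indicator (fun ω => ‖N ω‖ₑ ^ 4) ω := fun ω => by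
    by_cases h : ω ∈ H
    · rw [indicator_of_mem h]
      simp only [hφ, indicator_of_mem h, one_mul]
      rw [Real.enorm_eq_ofReal_abs, ← ENNReal.ofReal_pow (abs_nonneg _)]
      refine ENNReal.ofReal_le_ofReal ?_
      by_cases hk : ω ∈ K
      · rw [indicator_of_mem hk, ← sq_abs, show |N ω| ^ 4 = (N ω ^ 2) ^ 2 by
          rw [← sq_abs (N ω)]; ring]
        exact pow_le_pow_left₀ (abs_nonneg _) (hfN ω) 2
      · rw [indicator_of_notMem hk, zero_pow two_ne_zero]
        positivity
    · simp [hφ, h]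
  refine ae_le_of_ae_le_trim (hm := hm) ?_
  refine ae_le_of_forall_setIntegral_le (integrable_condExp.trim hm stronglyMeasurable_condExp)
    (integrable_const A) fun B hB _ => ?_
  rw [← setIntegral_trim hm stronglyMeasurable_condExp hB, setIntegral_condExp hm hφi hB,
    ← setIntegral_trim hm stronglyMeasurable_const hB, setIntegral_const, smul_eq_mul,
    integral_eq_lintegral_of_nonneg_ae (ae_of_all _ hφ0) hφi.aestronglyMeasurable.restrict]
  refine ENNReal.toReal_le_of_le_ofReal (by positivity) ?_
  calc ∫⁻ ω in B, ENNReal.ofReal (φ ω) ∂P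
      ≤ ∫⁻ ω in B, H.indicator (fun ω => ‖N ω‖ₑ ^ 4) ω ∂P := lintegral_mono hle
    _ = ∫⁻ ω in H ∩ B, ‖N ω‖ₑ ^ 4 ∂P := by
        rw [lintegral_indicator (hm _ hHm), Measure.restrict_restrict (hm _ hHm)]
    _ = ∫⁻ ω in H ∩ B, condLExp m P (fun ω' => ‖N ω'‖ₑ ^ 4) ω ∂P :=
        (setLIntegral_condLExp hm P _ (hHm.inter hB)).symm
    _ ≤ ∫⁻ _ω in H ∩ B, ENNReal.ofReal A ∂P :=
        setLIntegral_mono' (hm _ (hHm.inter hB)) fun ω hω => hω.1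
    _ ≤ ENNReal.ofReal A * P B := by
        rw [setLIntegral_const]
        gcongr
        exact inter_subset_right
    _ = _ := by
        rw [mul_comm, ENNReal.ofReal_mul (by positivity), ofReal_measureReal]

end Truncation

/-! ### Uniform bounds for block sums of innovations and of their products -/

section Blocks

variable {Ω : Type*} {m0 : MeasurableSpace Ω} {P : Measure Ω} {ι : Type*}

/-- A family of real martingale differences with deterministic conditional covariances, dominated
by a common square integrable envelope `N` with `E N_t ^ 2 ≤ S`. -/
structure IsMDFamily (P : Measure Ω) (ℱ : Filtration ℤ m0) (u : ι → ℤ → Ω → ℝ)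
    (N : ℤ → Ω → ℝ) (S : ℝ) : Prop where
  adapted : ∀ c t, StronglyMeasurable[ℱ t] (u c t)
  adapted_env : ∀ t, StronglyMeasurable[ℱ t] (N t)
  abs_le : ∀ c t ω, |u c t ω| ≤ N t ω
  env_nonneg : ∀ t ω, 0 ≤ N t ω
  integrable_env_sq : ∀ t, Integrable (fun ω => N t ω ^ 2) P
  integral_env_sq_le : ∀ t, ∫ ω, N t ω ^ 2 ∂P ≤ S
  condExp_eq_zero : ∀ c t, P[u c t | ℱ (t - 1)] =ᵐ[P] fun _ => 0
  condExp_mul : ∀ c e t, P[fun ω => u c t ω * u e t ω | ℱ (t - 1)]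
    =ᵐ[P] fun _ => ∫ ω, u c t ω * u e t ω ∂P

namespace IsMDFamily

variable {ℱ : Filtration ℤ m0} {u : ι → ℤ → Ω → ℝ} {N : ℤ → Ω → ℝ} {S : ℝ}

theorem stronglyMeasurable (hu : IsMDFamily P ℱ u N S) (c : ι) (t : ℤ) :
    StronglyMeasurable (u c t) := (hu.adapted c t).mono (ℱ.le t)

theorem stronglyMeasurable_env (hu : IsMDFamily P ℱ u N S) (t : ℤ) :
    StronglyMeasurable (N t) := (hu.adapted_env t).mono (ℱ.le t)

theorem memLp_env (hu : IsMDFamily P ℱ u N S) (t : ℤ) : MemLp (N t) 2 P :=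
  (memLp_two_iff_integrable_sq (hu.stronglyMeasurable_env t).aestronglyMeasurable).mpr
    (hu.integrable_env_sq t)

theorem memLp (hu : IsMDFamily P ℱ u N S) (c : ι) (t : ℤ) : MemLp (u c t) 2 P :=
  (hu.memLp_env t).of_le (hu.stronglyMeasurable c t).aestronglyMeasurable
    (ae_of_all _ fun ω => by
      rw [Real.norm_eq_abs, Real.norm_eq_abs, abs_of_nonneg (hu.env_nonneg t ω)]
      exact hu.abs_le c t ω)

theorem integrable_mul (hu : IsMDFamily P ℱ u N S) (c e : ι) (t t' : ℤ) :
    Integrable (fun ω => u c t ω * u e t' ω) P := (hu.memLp c t).integrable_mul (hu.memLp e t')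

theorem nonneg (hu : IsMDFamily P ℱ u N S) : 0 ≤ S :=
  (integral_nonneg fun _ => sq_nonneg _).trans (hu.integral_env_sq_le 0)

theorem abs_mul_le (hu : IsMDFamily P ℱ u N S) (c e : ι) (t : ℤ) (ω : Ω) :
    |u c t ω * u e t ω| ≤ N t ω ^ 2 := by
  rw [abs_mul, sq]
  exact mul_le_mul (hu.abs_le c t ω) (hu.abs_le e t ω) (abs_nonneg _) (hu.env_nonneg t ω)

theorem integral_sq_le (hu : IsMDFamily P ℱ u N S) (c : ι) (t : ℤ) :
    ∫ ω, u c t ω * u c t ω ∂P ≤ S :=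
  (integral_mono (hu.integrable_mul c c t t) (hu.integrable_env_sq t) fun ω =>
    (le_abs_self _).trans (hu.abs_mul_le c c t ω)).trans (hu.integral_env_sq_le t)

theorem integral_abs_mul_le (hu : IsMDFamily P ℱ u N S) (c e : ι) (t t' : ℤ) :
    ∫ ω, |u c t ω * u e t' ω| ∂P ≤ S := by
  have h : ∀ ω, |u c t ω * u e t' ω| ≤ (N t ω ^ 2 + N t' ω ^ 2) / 2 := fun ω => by
    rw [abs_mul]
    have h1 := mul_le_mul (hu.abs_le c t ω) (hu.abs_le e t' ω) (abs_nonneg _) (hu.env_nonneg t ω)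
    nlinarith [sq_nonneg (N t ω - N t' ω)]
  have hi := ((hu.integrable_env_sq t).add (hu.integrable_env_sq t')).div_const 2
  refine (integral_mono (hu.integrable_mul c e t t').abs hi h).trans ?_
  simp only [Pi.add_apply]
  rw [integral_div, integral_add (hu.integrable_env_sq t) (hu.integrable_env_sq t')]
  linarith [hu.integral_env_sq_le t, hu.integral_env_sq_le t']

variable [IsProbabilityMeasure P]

theorem integrable (hu : IsMDFamily P ℱ u N S) (c : ι) (t : ℤ) : Integrable (u c t) P :=
  (hu.memLp c t).integrable (by norm_num)

theorem integral_eq_zero (hu : IsMDFamily P ℱ u N S) (c : ι) (t : ℤ) :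
    ∫ ω, u c t ω ∂P = 0 := by
  rw [← integral_condExp (ℱ.le (t - 1)), integral_congr_ae (hu.condExp_eq_zero c t)]
  simp

theorem integral_mul_eq_zero_of_lt (hu : IsMDFamily P ℱ u N S) (c e : ι) {t t' : ℤ}
    (h : t' < t) : ∫ ω, u c t ω * u e t' ω ∂P = 0 := by
  have h1 : P[fun ω => u e t' ω * u c t ω | ℱ (t - 1)] =ᵐ[P] fun _ => 0 := by
    have h2 := condExp_mul_of_stronglyMeasurable_left (μ := P) (m := ℱ (t - 1))
      ((hu.adapted e t').mono (ℱ.mono (show t' ≤ t - 1 by omega)))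
      (hu.integrable_mul e c t' t) (hu.integrable c t)
    filter_upwards [h2, hu.condExp_eq_zero c t] with ω h2 h3
    rw [show (fun ω => u e t' ω * u c t ω) = u e t' * u c t from rfl, h2, Pi.mul_apply, h3,
      mul_zero]
  simp only [mul_comm (u c t _)]
  rw [← integral_condExp (ℱ.le (t - 1)), integral_congr_ae h1]
  simp

end IsMDFamily

theorem measure_iUnion_le_card_mul {κ : Type*} [Fintype κ] (A : κ → Set Ω) {b : ℝ}
    (h : ∀ i, P (A i) ≤ ENNReal.ofReal b) :
    P (⋃ i, A i) ≤ ENNReal.ofReal (Fintype.card κ * b) := by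
  refine (measure_iUnion_fintype_le P A).trans ((Finset.sum_le_sum fun i _ => h i).trans ?_)
  rw [Finset.sum_const, Finset.card_univ, nsmul_eq_mul, ENNReal.ofReal_mul (Nat.cast_nonneg _),
    ENNReal.ofReal_natCast]

theorem sum_range_shift_le_sum_range {a : ℤ → ℝ} (ha : ∀ t, 0 ≤ a t) {α len n : ℕ}
    (h : α + len ≤ n) :
    ∑ i ∈ Finset.range len, a ((α : ℤ) + 1 + i) ≤ ∑ i ∈ Finset.range n, a (1 + i) := by
  have e : ∑ i ∈ Finset.range len, a ((α : ℤ) + 1 + i)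
      = ∑ i ∈ Finset.Ico α (α + len), a (1 + i) := by
    rw [Finset.sum_Ico_eq_sum_range, add_tsub_cancel_left]
    refine Finset.sum_congr rfl fun i _ => ?_
    congr 1
    push_cast
    ring
  rw [e, Finset.range_eq_Ico]
  exact Finset.sum_le_sum_of_subset_of_nonneg (Finset.Ico_subset_Ico (Nat.zero_le _) h)
    fun _ _ _ => ha _

theorem mul_rpow_sub_div_pow {s : ℝ} (hs : 0 < s) (n C δ : ℝ) (q : ℕ) :
    n * (C * s ^ ((q : ℝ) - δ)) / s ^ q = n * (C * s ^ (-δ)) := by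
  rw [sub_eq_add_neg, Real.rpow_add hs, Real.rpow_natCast]
  have : s ^ q ≠ 0 := (pow_pos hs q).ne'
  field_simp

variable {ℱ : Filtration ℤ m0} {u : ι → ℤ → Ω → ℝ} {N : ℤ → Ω → ℝ} {S δ : ℝ} {C : ℝ≥0}

theorem measure_exists_env_gt_le (hu : IsMDFamily P ℱ u N S) (hδ : 0 ≤ δ)
    (hC : ∀ t, 1 ≤ t → ∫⁻ ω, ‖N t ω‖ₑ ^ δ ∂P ≤ C) {s : ℝ} (hs : 0 < s) (n : ℕ) :
    P (⋃ i : Fin n, {ω | s < N (1 + (i : ℕ)) ω}) ≤ ENNReal.ofReal (n * (C * s ^ (-δ))) := by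
  simpa using measure_iUnion_le_card_mul (P := P) (fun i : Fin n => {ω | s < N (1 + (i : ℕ)) ω})
    fun i => measure_gt_le_of_moment (hu.stronglyMeasurable_env _).measurable
      (hu.env_nonneg _) hs hδ (hC _ (by omega))

variable [IsProbabilityMeasure P]

/-- All sums of innovations over intervals of length at most `ℓ` in `{1, …, n}` are bounded by
`x + s`, where `s` is the truncation level. -/
theorem measure_exists_blockSum_gt_le [Fintype ι] (hu : IsMDFamily P ℱ u N S) (hδ : 1 ≤ δ)
    (hC : ∀ t, 1 ≤ t → ∫⁻ ω, ‖N t ω‖ₑ ^ δ ∂P ≤ C) {s : ℝ} (hs : 0 < s) (x : ℝ) (n ℓ : ℕ) :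
    P {ω | ∃ (c : ι) (α len : ℕ), len ≤ ℓ ∧ α + len ≤ n ∧
        x + s < |∑ i ∈ Finset.range len, u c ((α : ℤ) + 1 + i) ω|}
      ≤ ENNReal.ofReal ((1 + Fintype.card ι) * (n * (C * s ^ (-δ)))
        + Fintype.card ι * (n + 1) ^ 2
          * (2 * Real.exp (-(s⁻¹ * x) + s⁻¹ ^ 2 * (S * ℓ)))) := by
  set K : ℤ → Set Ω := fun t => {ω | N t ω ≤ s} with hK
  have hKm : ∀ t, MeasurableSet[ℱ t] (K t) := fun t =>
    (hu.adapted_env t).measurable measurableSet_Iic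
  have h0 := measure_exists_env_gt_le hu (by linarith) hC hs n
  have h1 := measure_iUnion_le_card_mul (P := P) (fun c : ι =>
      {ω | s < ∑ i ∈ Finset.range n,
        |(P[{ω | N (1 + i) ω ≤ s}ᶜ.indicator (u c (1 + i)) | ℱ (1 + i - 1)]) ω|})
    fun c => measure_sum_abs_condExp_tail_gt_le (P := P) ℱ hs hs 1 (by exact_mod_cast hδ)
      (fun t ω => by rw [pow_one]; exact hu.abs_le c t ω) hu.env_nonneg hC n
  have e1 := mul_rpow_sub_div_pow hs n C δ 1
  rw [pow_one] at e1
  rw [e1] at h1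
  set blk : ι × Fin (n + 1) × Fin (n + 1) → Set Ω := fun q =>
    {ω | (∀ i < (q.2.2 : ℕ), ω ∈ K ((q.2.1 : ℕ) + 1 + i)) ∧
      ∑ i ∈ Finset.range q.2.2, S ≤ S * ℓ ∧
      ∑ i ∈ Finset.range q.2.2, |1 *
          (P[(K ((q.2.1 : ℕ) + 1 + i))ᶜ.indicator (u q.1 ((q.2.1 : ℕ) + 1 + i)) |
            ℱ ((q.2.1 : ℕ) + 1 + i - 1)]) ω| ≤ s ∧
      x + s < |∑ i ∈ Finset.range q.2.2, 1 * (u q.1 ((q.2.1 : ℕ) + 1 + i) ω - 0)|} with hblk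
  have h2 := measure_iUnion_le_card_mul (P := P) blk
    (b := 2 * Real.exp (-(s⁻¹ * x) + s⁻¹ ^ 2 * (S * ℓ))) fun q => by
      refine measure_martingaleTransform_gt_le (P := P) ℱ (f := u q.1) (g := fun _ _ => 1)
        (v := fun _ _ => S) (K := K) (σ := fun _ => 0) (c := s) (cg := 1) (θ := s⁻¹)
        (hu.adapted q.1) (hu.integrable q.1) (hu.condExp_eq_zero q.1) hKm
        (fun _ => stronglyMeasurable_const) (fun _ _ => by simp) (fun t ω => ?_)
        (inv_nonneg.mpr hs.le) (inv_mul_cancel₀ hs.ne').le (q.2.1 : ℕ)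
        (fun _ _ => stronglyMeasurable_const) (fun t _ => ?_) q.2.2 x s (S * ℓ)
      · rw [one_mul]
        by_cases h : ω ∈ K t
        · rw [indicator_of_mem h]
          exact (hu.abs_le q.1 t ω).trans h
        · rw [indicator_of_notMem h, abs_zero]
          exact hs.le
      · have := condExp_sq_mul_indicator_le (P := P) (m := ℱ (t - 1)) (f := u q.1 t)
          (g := fun _ => 1) (K := K t) (S := S) (cg := 1) (ℱ.le _) (hu.memLp q.1 t).integrable_sq
          (by
            simp only [sq]
            filter_upwards [hu.condExp_mul q.1 q.1 t] with ω h
            rw [h]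
            exact hu.integral_sq_le q.1 t)
          (ℱ.le t _ (hKm t)) stronglyMeasurable_const (fun _ => by simp)
        simpa using this
  have hsub : {ω | ∃ (c : ι) (α len : ℕ), len ≤ ℓ ∧ α + len ≤ n ∧
        x + s < |∑ i ∈ Finset.range len, u c ((α : ℤ) + 1 + i) ω|}
      ⊆ ((⋃ i : Fin n, {ω | s < N (1 + (i : ℕ)) ω}) ∪
        ⋃ c : ι, {ω | s < ∑ i ∈ Finset.range n,
          |(P[{ω | N (1 + i) ω ≤ s}ᶜ.indicator (u c (1 + i)) | ℱ (1 + i - 1)]) ω|})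
        ∪ ⋃ q, blk q := by
    rintro ω ⟨c, α, len, hlen, hn, hω⟩
    by_contra hcon
    simp only [mem_union, mem_iUnion, not_or, not_exists, mem_ofPred_eq, not_lt] at hcon
    obtain ⟨⟨hc0, hc1⟩, hc2⟩ := hcon
    refine hc2 (c, ⟨α, by omega⟩, ⟨len, by omega⟩) ⟨fun i hi => ?_, ?_, ?_, ?_⟩
    · show N ((α : ℤ) + 1 + i) ω ≤ s
      rw [show (α : ℤ) + 1 + i = 1 + ((α + i : ℕ) : ℤ) by push_cast; ring]
      exact hc0 ⟨α + i, by simp only at hi; omega⟩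
    · rw [Finset.sum_const, Finset.card_range, nsmul_eq_mul, mul_comm]
      exact mul_le_mul_of_nonneg_left (by exact_mod_cast hlen) hu.nonneg
    · simp only [one_mul]
      exact (sum_range_shift_le_sum_range
        (a := fun t => |(P[(K t)ᶜ.indicator (u c t) | ℱ (t - 1)]) ω|)
        (fun _ => abs_nonneg _) hn).trans (hc1 c)
    · simpa using hω
  refine (measure_mono hsub).trans ((measure_union_le _ _).trans
    ((add_le_add ((measure_union_le _ _).trans (add_le_add h0 h1)) h2).trans ?_))
  have hb : 0 ≤ n * (C * s ^ (-δ)) :=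
    mul_nonneg (Nat.cast_nonneg _) (mul_nonneg C.coe_nonneg (Real.rpow_nonneg hs.le _))
  rw [← ENNReal.ofReal_add hb (by positivity), ← ENNReal.ofReal_add (by positivity)
    (by positivity)]
  refine ENNReal.ofReal_le_ofReal (le_of_eq ?_)
  simp only [Fintype.card_prod, Fintype.card_fin]
  push_cast
  ring

/-- All centred sums of products of two innovations, along two intervals of the same length at
most `ℓ` in `{1, …, n}`, are bounded by `x + s ^ 2` on the event that the conditional fourth
moments of the envelope are at most `A`. For coinciding intervals the conditional second moment
is at most `A`; for shifted intervals it is `S` times a sum of squares, which the bound for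
coinciding intervals controls. -/
theorem measure_exists_blockSum_mul_gt_le [Fintype ι] (hu : IsMDFamily P ℱ u N S) (hδ : 2 ≤ δ)
    (hC : ∀ t, 1 ≤ t → ∫⁻ ω, ‖N t ω‖ₑ ^ δ ∂P ≤ C) {s A : ℝ} (hs : 0 < s) (hA : 0 ≤ A) (x : ℝ)
    (n ℓ : ℕ) :
    P {ω | (∀ t : ℤ, 1 ≤ t →
          condLExp (ℱ (t - 1)) P (fun ω' => ‖N t ω'‖ₑ ^ 4) ω ≤ ENNReal.ofReal A) ∧
        ∃ (c e : ι) (α β len : ℕ), len ≤ ℓ ∧ α + len ≤ n ∧ β + len ≤ n ∧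
          x + s ^ 2 < |∑ i ∈ Finset.range len,
            (u c ((α : ℤ) + 1 + i) ω * u e ((β : ℤ) + 1 + i) ω
              - ∫ ω', u c ((α : ℤ) + 1 + i) ω' * u e ((β : ℤ) + 1 + i) ω' ∂P)|}
      ≤ ENNReal.ofReal ((1 + Fintype.card ι + Fintype.card ι ^ 2) * (n * (C * s ^ (-δ)))
        + Fintype.card ι ^ 2 * (n + 1) ^ 2
          * (2 * Real.exp (-((s ^ 2)⁻¹ * x) + (s ^ 2)⁻¹ ^ 2 * (A * ℓ)))
        + Fintype.card ι ^ 2 * (n + 1) ^ 3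
          * (2 * Real.exp (-((s ^ 2)⁻¹ * x)
            + (s ^ 2)⁻¹ ^ 2 * (S * (S * ℓ + (x + s ^ 2)))))) := by
  have hs2 : 0 < s ^ 2 := pow_pos hs 2
  set K : ℤ → Set Ω := fun t => {ω | N t ω ≤ s} with hK
  set H : ℤ → Set Ω := fun t =>
    {ω | condLExp (ℱ (t - 1)) P (fun ω' => ‖N t ω'‖ₑ ^ 4) ω ≤ ENNReal.ofReal A} with hH
  have hKm : ∀ t, MeasurableSet[ℱ t] (K t) := fun t =>
    (hu.adapted_env t).measurable measurableSet_Iic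
  have hHm : ∀ t, MeasurableSet[ℱ (t - 1)] (H t) := fun t =>
    (measurable_condLExp (ℱ (t - 1)) P _) measurableSet_Iic
  have hKu : ∀ e t ω, |(K t).indicator (u e t) ω| ≤ s := fun e t ω => by
    by_cases h : ω ∈ K t
    · rw [indicator_of_mem h]
      exact (hu.abs_le e t ω).trans h
    · rw [indicator_of_notMem h, abs_zero]
      exact hs.le
  have hKuu : ∀ c e t ω, |(K t).indicator (fun ω => u c t ω * u e t ω) ω| ≤ s ^ 2 :=
    fun c e t ω => by
      by_cases h : ω ∈ K t
      · rw [indicator_of_mem h]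
        exact (hu.abs_mul_le c e t ω).trans (pow_le_pow_left₀ (hu.env_nonneg t ω) h 2)
      · rw [indicator_of_notMem h, abs_zero]
        exact hs2.le
  have h0 := measure_exists_env_gt_le hu (by linarith) hC hs n
  have h1 := measure_iUnion_le_card_mul (P := P) (fun c : ι =>
      {ω | s < ∑ i ∈ Finset.range n,
        |(P[{ω | N (1 + i) ω ≤ s}ᶜ.indicator (u c (1 + i)) | ℱ (1 + i - 1)]) ω|})
    fun c => measure_sum_abs_condExp_tail_gt_le (P := P) ℱ hs hs 1
      (by rw [Nat.cast_one]; linarith)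
      (fun t ω => by rw [pow_one]; exact hu.abs_le c t ω) hu.env_nonneg hC n
  have h2 := measure_iUnion_le_card_mul (P := P) (fun q : ι × ι =>
      {ω | s ^ 2 < ∑ i ∈ Finset.range n,
        |(P[{ω | N (1 + i) ω ≤ s}ᶜ.indicator (fun ω => u q.1 (1 + i) ω * u q.2 (1 + i) ω) |
          ℱ (1 + i - 1)]) ω|})
    fun q => measure_sum_abs_condExp_tail_gt_le (P := P) ℱ
      (f := fun t ω => u q.1 t ω * u q.2 t ω) hs hs2 2
      (by exact_mod_cast hδ) (fun t ω => hu.abs_mul_le _ _ t ω) hu.env_nonneg hC n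
  have e1 := mul_rpow_sub_div_pow hs n C δ 1
  rw [pow_one] at e1
  rw [e1] at h1
  rw [mul_rpow_sub_div_pow hs n C δ 2] at h2
  -- coinciding intervals
  set blk : (ι × ι) × Fin (n + 1) × Fin (n + 1) → Set Ω := fun q =>
    {ω | (∀ i < (q.2.2 : ℕ), ω ∈ K ((q.2.1 : ℕ) + 1 + i)) ∧
      ∑ i ∈ Finset.range q.2.2, A ≤ A * ℓ ∧
      ∑ i ∈ Finset.range q.2.2,
        |(H ((q.2.1 : ℕ) + 1 + i)).indicator (fun _ => (1 : ℝ)) ω *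
          (P[(K ((q.2.1 : ℕ) + 1 + i))ᶜ.indicator (fun ω =>
            u q.1.1 ((q.2.1 : ℕ) + 1 + i) ω * u q.1.2 ((q.2.1 : ℕ) + 1 + i) ω) |
            ℱ ((q.2.1 : ℕ) + 1 + i - 1)]) ω| ≤ s ^ 2 ∧
      x + s ^ 2 < |∑ i ∈ Finset.range q.2.2,
        (H ((q.2.1 : ℕ) + 1 + i)).indicator (fun _ => (1 : ℝ)) ω *
          (u q.1.1 ((q.2.1 : ℕ) + 1 + i) ω * u q.1.2 ((q.2.1 : ℕ) + 1 + i) ω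
          - ∫ ω', u q.1.1 ((q.2.1 : ℕ) + 1 + i) ω' * u q.1.2 ((q.2.1 : ℕ) + 1 + i) ω' ∂P)|}
    with hblk
  have h3 := measure_iUnion_le_card_mul (P := P) blk
    (b := 2 * Real.exp (-((s ^ 2)⁻¹ * x) + (s ^ 2)⁻¹ ^ 2 * (A * ℓ))) fun q => by
      refine measure_martingaleTransform_gt_le (P := P) ℱ
        (f := fun t ω => u q.1.1 t ω * u q.1.2 t ω)
        (g := fun t => (H t).indicator (fun _ => (1 : ℝ)))
        (v := fun _ _ => A) (K := K) (σ := fun t => ∫ ω', u q.1.1 t ω' * u q.1.2 t ω' ∂P)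
        (c := s ^ 2) (cg := 1) (θ := (s ^ 2)⁻¹)
        (fun t => (hu.adapted _ t).mul (hu.adapted _ t)) (fun t => hu.integrable_mul _ _ t t)
        (fun t => hu.condExp_mul _ _ t) hKm
        (fun t => stronglyMeasurable_const.indicator (hHm t)) (fun t ω => ?_) (fun t ω => ?_)
        (inv_nonneg.mpr hs2.le) (inv_mul_cancel₀ hs2.ne').le (q.2.1 : ℕ)
        (fun _ _ => stronglyMeasurable_const) (fun t _ => ?_) q.2.2 x (s ^ 2) (A * ℓ)
      · by_cases h : ω ∈ H t <;> simp [h]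
      · rw [abs_mul]
        refine (mul_le_of_le_one_left (abs_nonneg _) ?_).trans (hKuu _ _ t ω)
        by_cases h : ω ∈ H t <;> simp [h]
      · exact condExp_sq_indicator_le_of_condLExp (ℱ.le _) hA
          ((hu.stronglyMeasurable _ t).mul (hu.stronglyMeasurable _ t))
          (hu.abs_mul_le _ _ t) (ℱ.le t _ (hKm t)) (hKuu _ _ t)
  -- intervals shifted by `k = α - β > 0`
  set w : ι → ℕ → ℤ → Ω → ℝ := fun e k t => (K (t - k)).indicator (u e (t - k)) with hw
  set lag : (ι × ι) × Fin (n + 1) × Fin (n + 1) × Fin (n + 1) → Set Ω := fun q =>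
    {ω | (q.2.2.1 : ℕ) < q.2.1 ∧ (∀ i < (q.2.2.2 : ℕ), ω ∈ K ((q.2.1 : ℕ) + 1 + i)) ∧
      ∑ i ∈ Finset.range q.2.2.2,
        S * w q.1.2 (q.2.1 - q.2.2.1) ((q.2.1 : ℕ) + 1 + i) ω ^ 2
          ≤ S * (S * ℓ + (x + s ^ 2)) ∧
      ∑ i ∈ Finset.range q.2.2.2,
        |w q.1.2 (q.2.1 - q.2.2.1) ((q.2.1 : ℕ) + 1 + i) ω *
          (P[(K ((q.2.1 : ℕ) + 1 + i))ᶜ.indicator (u q.1.1 ((q.2.1 : ℕ) + 1 + i)) |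
            ℱ ((q.2.1 : ℕ) + 1 + i - 1)]) ω| ≤ s ^ 2 ∧
      x + s ^ 2 < |∑ i ∈ Finset.range q.2.2.2,
        w q.1.2 (q.2.1 - q.2.2.1) ((q.2.1 : ℕ) + 1 + i) ω *
          (u q.1.1 ((q.2.1 : ℕ) + 1 + i) ω - 0)|}
    with hlag
  have h4 := measure_iUnion_le_card_mul (P := P) lag
    (b := 2 * Real.exp (-((s ^ 2)⁻¹ * x) + (s ^ 2)⁻¹ ^ 2 * (S * (S * ℓ + (x + s ^ 2)))))
    fun q => by
      by_cases hq : (q.2.2.1 : ℕ) < q.2.1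
      swap
      · have : lag q = ∅ := eq_empty_of_forall_notMem fun ω hω => hq hω.1
        rw [this, measure_empty]
        exact zero_le
      have hk : (1 : ℤ) ≤ ((q.2.1 - q.2.2.1 : ℕ) : ℤ) := by omega
      have hwm : ∀ t, StronglyMeasurable[ℱ (t - 1)] (w q.1.2 (q.2.1 - q.2.2.1) t) := fun t =>
        ((hu.adapted _ _).indicator (hKm _)).mono (ℱ.mono (by omega))
      refine (measure_mono fun ω hω => hω.2).trans
        (measure_martingaleTransform_gt_le (P := P) ℱ (f := u q.1.1)
        (g := w q.1.2 (q.2.1 - q.2.2.1))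
        (v := fun t ω => S * w q.1.2 (q.2.1 - q.2.2.1) t ω ^ 2) (K := K) (σ := fun _ => 0)
        (c := s ^ 2) (cg := s) (θ := (s ^ 2)⁻¹)
        (hu.adapted _) (hu.integrable _) (hu.condExp_eq_zero _) hKm hwm
        (fun t ω => hKu _ _ ω) (fun t ω => ?_)
        (inv_nonneg.mpr hs2.le) (inv_mul_cancel₀ hs2.ne').le (q.2.1 : ℕ)
        (fun t _ => ((hwm t).pow 2).const_mul S) (fun t _ => ?_) q.2.2.2 x (s ^ 2)
        (S * (S * ℓ + (x + s ^ 2))))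
      · rw [abs_mul, sq]
        exact mul_le_mul (hKu _ _ ω) (hKu _ _ ω) (abs_nonneg _) hs.le
      · exact condExp_sq_mul_indicator_le (P := P) (m := ℱ (t - 1)) (cg := s) (ℱ.le _)
          (hu.memLp q.1.1 t).integrable_sq
          (by
            simp only [sq]
            filter_upwards [hu.condExp_mul q.1.1 q.1.1 t] with ω h
            rw [h]
            exact hu.integral_sq_le q.1.1 t)
          (ℱ.le t _ (hKm t)) (hwm t) (fun ω => hKu _ _ ω)
  have hsub : {ω | (∀ t : ℤ, 1 ≤ t →
          condLExp (ℱ (t - 1)) P (fun ω' => ‖N t ω'‖ₑ ^ 4) ω ≤ ENNReal.ofReal A) ∧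
        ∃ (c e : ι) (α β len : ℕ), len ≤ ℓ ∧ α + len ≤ n ∧ β + len ≤ n ∧
          x + s ^ 2 < |∑ i ∈ Finset.range len,
            (u c ((α : ℤ) + 1 + i) ω * u e ((β : ℤ) + 1 + i) ω
              - ∫ ω', u c ((α : ℤ) + 1 + i) ω' * u e ((β : ℤ) + 1 + i) ω' ∂P)|}
      ⊆ (((⋃ i : Fin n, {ω | s < N (1 + (i : ℕ)) ω}) ∪
        ⋃ c : ι, {ω | s < ∑ i ∈ Finset.range n,
          |(P[{ω | N (1 + i) ω ≤ s}ᶜ.indicator (u c (1 + i)) | ℱ (1 + i - 1)]) ω|})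
        ∪ ⋃ q : ι × ι, {ω | s ^ 2 < ∑ i ∈ Finset.range n,
        |(P[{ω | N (1 + i) ω ≤ s}ᶜ.indicator (fun ω => u q.1 (1 + i) ω * u q.2 (1 + i) ω) |
          ℱ (1 + i - 1)]) ω|})
        ∪ (⋃ q, blk q) ∪ ⋃ q, lag q := by
    rintro ω ⟨hωH, hω⟩
    by_contra hcon
    simp only [mem_union, mem_iUnion, not_or, not_exists, mem_ofPred_eq, not_lt] at hcon
    obtain ⟨⟨⟨⟨hc0, hc1⟩, hc2⟩, hc3⟩, hc4⟩ := hcon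
    have hmemK : ∀ α len : ℕ, α + len ≤ n → ∀ i < len, N ((α : ℤ) + 1 + i) ω ≤ s :=
      fun α len h i hi => by
        rw [show (α : ℤ) + 1 + i = 1 + ((α + i : ℕ) : ℤ) by push_cast; ring]
        exact hc0 ⟨α + i, by omega⟩
    have hdiag : ∀ (c e : ι) (α len : ℕ), len ≤ ℓ → α + len ≤ n →
        |∑ i ∈ Finset.range len, (u c ((α : ℤ) + 1 + i) ω * u e ((α : ℤ) + 1 + i) ω
          - ∫ ω', u c ((α : ℤ) + 1 + i) ω' * u e ((α : ℤ) + 1 + i) ω' ∂P)| ≤ x + s ^ 2 := by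
      intro c e α len hlen hn
      by_contra hlt
      push Not at hlt
      refine hc3 ((c, e), ⟨α, by omega⟩, ⟨len, by omega⟩)
        ⟨fun i hi => hmemK α len hn i hi, ?_, ?_, ?_⟩
      · rw [Finset.sum_const, Finset.card_range, nsmul_eq_mul, mul_comm]
        exact mul_le_mul_of_nonneg_left (by exact_mod_cast hlen) hA
      · refine le_trans (Finset.sum_le_sum fun i hi => ?_) ((sum_range_shift_le_sum_range
          (a := fun t => |(P[(K t)ᶜ.indicator (fun ω => u c t ω * u e t ω) | ℱ (t - 1)]) ω|)
          (fun _ => abs_nonneg _) hn).trans (hc2 (c, e)))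
        rw [abs_mul]
        refine mul_le_of_le_one_left (abs_nonneg _) ?_
        by_cases h : ω ∈ H ((α : ℤ) + 1 + i) <;> simp [h]
      · refine hlt.trans_eq ?_
        congr 1
        refine Finset.sum_congr rfl fun i _ => ?_
        rw [indicator_of_mem (show ω ∈ H _ from hωH _ (by simp only; omega)), one_mul]
    have hshift : ∀ (c e : ι) (α β len : ℕ), β < α → len ≤ ℓ → α + len ≤ n →
        |∑ i ∈ Finset.range len, (u c ((α : ℤ) + 1 + i) ω * u e ((β : ℤ) + 1 + i) ω
          - ∫ ω', u c ((α : ℤ) + 1 + i) ω' * u e ((β : ℤ) + 1 + i) ω' ∂P)| ≤ x + s ^ 2 := by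
      intro c e α β len hβ hlen hn
      by_contra hlt
      push Not at hlt
      have hidx : ∀ i : ℕ, (α : ℤ) + 1 + i - ((α - β : ℕ) : ℤ) = (β : ℤ) + 1 + i := fun i => by
        omega
      have hwe : ∀ i < len, w e (α - β) ((α : ℤ) + 1 + i) ω = u e ((β : ℤ) + 1 + i) ω :=
        fun i hi => by
          rw [hw]
          simp only [hidx]
          exact indicator_of_mem (show ω ∈ K _ from hmemK β len (by omega) i hi) _
      refine hc4 ((c, e), ⟨α, by omega⟩, ⟨β, by omega⟩, ⟨len, by omega⟩)
        ⟨hβ, fun i hi => hmemK α len hn i hi, ?_, ?_, ?_⟩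
      · rw [← Finset.mul_sum]
        refine mul_le_mul_of_nonneg_left ?_ hu.nonneg
        have hd := (le_abs_self _).trans (hdiag e e β len hlen (by omega))
        rw [Finset.sum_sub_distrib, sub_le_iff_le_add] at hd
        calc ∑ i ∈ Finset.range len, w e (α - β) ((α : ℤ) + 1 + i) ω ^ 2
            = ∑ i ∈ Finset.range len, u e ((β : ℤ) + 1 + i) ω * u e ((β : ℤ) + 1 + i) ω :=
              Finset.sum_congr rfl fun i hi => by
                rw [hwe i (Finset.mem_range.mp hi), sq]
          _ ≤ _ := hd
          _ ≤ x + s ^ 2 + ∑ i ∈ Finset.range len, S := by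
              gcongr
              exact hu.integral_sq_le e _
          _ ≤ _ := by
              rw [Finset.sum_const, Finset.card_range, nsmul_eq_mul, add_comm, mul_comm]
              gcongr
              exact hu.nonneg
      · calc ∑ i ∈ Finset.range len, |w e (α - β) ((α : ℤ) + 1 + i) ω *
            (P[(K ((α : ℤ) + 1 + i))ᶜ.indicator (u c ((α : ℤ) + 1 + i)) |
              ℱ ((α : ℤ) + 1 + i - 1)]) ω|
            ≤ s * ∑ i ∈ Finset.range len,
              |(P[(K ((α : ℤ) + 1 + i))ᶜ.indicator (u c ((α : ℤ) + 1 + i)) |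
              ℱ ((α : ℤ) + 1 + i - 1)]) ω| := by
              rw [Finset.mul_sum]
              refine Finset.sum_le_sum fun i _ => ?_
              rw [abs_mul]
              exact mul_le_mul_of_nonneg_right (hKu _ _ ω) (abs_nonneg _)
          _ ≤ s * s := by
              refine mul_le_mul_of_nonneg_left ?_ hs.le
              exact (sum_range_shift_le_sum_range
                (a := fun t => |(P[(K t)ᶜ.indicator (u c t) | ℱ (t - 1)]) ω|)
                (fun _ => abs_nonneg _) hn).trans (hc1 c)
          _ = s ^ 2 := (sq s).symm
      · refine hlt.trans_eq ?_
        congr 1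
        refine Finset.sum_congr rfl fun i hi => ?_
        rw [hwe i (Finset.mem_range.mp hi), hu.integral_mul_eq_zero_of_lt c e (by omega)]
        ring
    obtain ⟨c, e, α, β, len, hlen, hα, hβ, hlt⟩ := hω
    refine hlt.not_ge ?_
    rcases lt_trichotomy α β with h | h | h
    · have := hshift e c β α len h hlen hβ
      simp only [mul_comm (u e _ _)] at this
      exact this
    · subst h
      exact hdiag c e α len hlen hα
    · exact hshift c e α β len h hlen hα
  have hunion := (measure_union_le (μ := P) _ _).trans (add_le_add ((measure_union_le _ _).trans
    (add_le_add ((measure_union_le _ _).trans (add_le_add ((measure_union_le _ _).trans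
      (add_le_add h0 h1)) h2)) h3)) h4)
  refine (measure_mono hsub).trans (hunion.trans ?_)
  have hb : 0 ≤ n * (C * s ^ (-δ)) :=
    mul_nonneg (Nat.cast_nonneg _) (mul_nonneg C.coe_nonneg (Real.rpow_nonneg hs.le _))
  rw [← ENNReal.ofReal_add hb (by positivity), ← ENNReal.ofReal_add (by positivity)
    (by positivity), ← ENNReal.ofReal_add (by positivity) (by positivity),
    ← ENNReal.ofReal_add (by positivity) (by positivity)]
  refine ENNReal.ofReal_le_ofReal (le_of_eq ?_)
  simp only [Fintype.card_prod, Fintype.card_fin]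
  push_cast
  ring

end Blocks

/-! ### Weighted sums of series -/

theorem IsBVBdd.shift {a : ℕ → ℝ} {n T p : ℕ} {b : ℝ} (ha : IsBVBdd a n b) (h : T + p ≤ n) :
    IsBVBdd (fun t => a (t + p)) T b where
  sup t h1 h2 := ha.sup (t + p) (by omega) (by omega)
  var := by
    refine le_trans (le_trans (le_of_eq ?_) (Finset.sum_le_sum_of_subset_of_nonneg
      (show Finset.Ico (1 + p) (T + p) ⊆ Finset.Ico 1 n from
        Finset.Ico_subset_Ico (by omega) h) fun _ _ _ => abs_nonneg _)) ha.var
    rw [← Finset.sum_Ico_add' (fun t => |a (t + 1) - a t|)]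
    simp only [add_right_comm]

theorem IsBVBdd.mono {a : ℕ → ℝ} {T : ℕ} {b b' : ℝ} (ha : IsBVBdd a T b) (h : b ≤ b') :
    IsBVBdd a T b' where
  sup t h1 h2 := (ha.sup t h1 h2).trans h
  var := ha.var.trans h

/-- The coefficient `a` is absorbed into the weight. Summation by parts is used from time `t₀` on,
and the terms before `t₀` are bounded one by one. -/
theorem enorm_sum_weight_mul_le {v a z : ℕ → ℝ} {T t₀ ℓ : ℕ} {G H Λ b : ℝ}
    (hv : IsLocalWeight v T G H) (hH0 : 0 ≤ H) (hb0 : 0 ≤ b) (ha : IsBVBdd a T b) (ht₀ : 1 ≤ t₀)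
    (hℓ : 1 ≤ ℓ) (hΛ : 0 ≤ Λ)
    (h : ∀ i k, t₀ ≤ i → i ≤ k → k ≤ T + 1 → k ≤ i + ℓ → |∑ t ∈ Finset.Ico i k, z t| ≤ Λ) :
    ‖∑ t ∈ Finset.Icc 1 T, v t * (a t * z t)‖ₑ
      ≤ ENNReal.ofReal (Λ * (G / ℓ + 8 * H)) * ENNReal.ofReal b
        + ENNReal.ofReal H * (ENNReal.ofReal b * ∑ t ∈ Finset.Ico 1 t₀, ‖z t‖ₑ) := by
  have hG0 : 0 ≤ G := (Finset.sum_nonneg fun _ _ => abs_nonneg _).trans hv.mass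
  have hset : Finset.Icc 1 T = Finset.Ico 1 (T + 1) := by
    ext t; simp only [Finset.mem_Icc, Finset.mem_Ico]; omega
  have hsplit : ∑ t ∈ Finset.Icc 1 T, v t * (a t * z t)
      = ∑ t ∈ (Finset.Icc 1 T).filter (· < t₀), v t * (a t * z t)
        + ∑ t ∈ Finset.Ico t₀ (T + 1), v t * a t * z t := by
    rw [← Finset.sum_filter_add_sum_filter_not (Finset.Icc 1 T) (· < t₀)]
    congr 1
    refine Finset.sum_congr ?_ fun t _ => (mul_assoc _ _ _).symm
    ext t
    simp only [Finset.mem_filter, Finset.mem_Icc, Finset.mem_Ico]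
    omega
  rw [hsplit, add_comm]
  refine (enorm_add_le _ _).trans (add_le_add ?_ ?_)
  · have h1 := (hv.mul hH0 hb0 ha).abs_sum_mul_le (by positivity) ht₀ hℓ hΛ h
    rw [Real.enorm_eq_ofReal_abs, ← ENNReal.ofReal_mul (by positivity)]
    refine ENNReal.ofReal_le_ofReal (h1.trans (le_of_eq ?_))
    ring
  · rw [Finset.mul_sum, Finset.mul_sum]
    refine (enorm_sum_le _ _).trans ((Finset.sum_le_sum (g := fun t =>
      ENNReal.ofReal H * (ENNReal.ofReal b * ‖z t‖ₑ)) fun t ht => ?_).trans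
      (Finset.sum_le_sum_of_subset fun t ht => ?_))
    · simp only [Finset.mem_filter, Finset.mem_Icc] at ht
      rw [enorm_mul, enorm_mul, Real.enorm_eq_ofReal_abs, Real.enorm_eq_ofReal_abs (a t)]
      gcongr
      · exact hv.sup t ht.1.1 ht.1.2
      · exact ha.sup t ht.1.1 ht.1.2
    · simp only [Finset.mem_filter, Finset.mem_Icc, Finset.mem_Ico] at ht ⊢
      exact ⟨ht.1.1, ht.2⟩

/-- The bound of a weighted sum of series `∑ₖ A_k(t) z_k(t)`, with coefficients of bounded
variation in `t`. The block sums of `z_k` are at most `Λ` from time `t₀ k` on; the terms before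
that time are kept as they are. -/
theorem enorm_sum_weight_mul_tsum_le {κ : Type*} {v : ℕ → ℝ} {A z : κ → ℕ → ℝ} {X : ℕ → ℝ}
    {b : κ → ℝ} {t₀ : κ → ℕ} {T ℓ : ℕ} {G H Λ : ℝ}
    (hv : IsLocalWeight v T G H) (hH0 : 0 ≤ H) (hb0 : ∀ k, 0 ≤ b k)
    (hA : ∀ k, IsBVBdd (A k) T (b k)) (ht₀ : ∀ k, 1 ≤ t₀ k) (hℓ : 1 ≤ ℓ) (hΛ : 0 ≤ Λ)
    (h : ∀ k i j, t₀ k ≤ i → i ≤ j → j ≤ T + 1 → j ≤ i + ℓ → |∑ t ∈ Finset.Ico i j, z k t| ≤ Λ)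
    (hX : ∀ t, 1 ≤ t → t ≤ T → HasSum (fun k => A k t * z k t) (X t)) :
    ‖∑ t ∈ Finset.Icc 1 T, v t * X t‖ₑ
      ≤ ENNReal.ofReal (Λ * (G / ℓ + 8 * H)) * ∑' k, ENNReal.ofReal (b k)
        + ENNReal.ofReal H * ∑' k, ENNReal.ofReal (b k) * ∑ t ∈ Finset.Ico 1 (t₀ k), ‖z k t‖ₑ := by
  have hsum : HasSum (fun k => ∑ t ∈ Finset.Icc 1 T, v t * (A k t * z k t))
      (∑ t ∈ Finset.Icc 1 T, v t * X t) :=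
    hasSum_sum fun t ht => (hX t (Finset.mem_Icc.mp ht).1 (Finset.mem_Icc.mp ht).2).mul_left _
  rw [← hsum.tsum_eq, ← ENNReal.tsum_mul_left, ← ENNReal.tsum_mul_left, ← ENNReal.tsum_add]
  exact enorm_tsum_le_tsum_enorm.trans (ENNReal.tsum_le_tsum fun k =>
    enorm_sum_weight_mul_le hv hH0 (hb0 k) (hA k) (ht₀ k) hℓ hΛ (h k))

section

variable {Ω : Type*} {m0 : MeasurableSpace Ω} {P : Measure Ω}

/-- The bound on weighted sums of series in probability: block sums that exceed `Λ` are one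
exceptional event, and Markov's inequality handles the terms before time `t₀ k`. The event does
not depend on the weight. -/
theorem measure_exists_weightedSum_gt_le {κ : Type*} [Countable κ] {A : κ → ℕ → ℝ}
    {Z : κ → ℕ → Ω → ℝ} {X : ℕ → Ω → ℝ} {b : κ → ℝ} {t₀ : κ → ℕ} {T ℓ : ℕ}
    {G H Λ D D₀ M : ℝ} (hG0 : 0 ≤ G) (hH0 : 0 ≤ H) (hD0 : 0 ≤ D) (hb0 : ∀ k, 0 ≤ b k)
    (hA : ∀ k, IsBVBdd (A k) T (b k)) (ht₀ : ∀ k, 1 ≤ t₀ k) (hℓ : 1 ≤ ℓ) (hΛ : 0 ≤ Λ)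
    (hM : 0 < M) (hD : ∑' k, ENNReal.ofReal (b k) ≤ ENNReal.ofReal D)
    (hZm : ∀ k t, AEMeasurable (Z k t) P)
    (hD₀ : ∑' k, ENNReal.ofReal (b k) * ∑ t ∈ Finset.Ico 1 (t₀ k), ∫⁻ ω, ‖Z k t ω‖ₑ ∂P
      ≤ ENNReal.ofReal D₀)
    (hX : ∀ t, 1 ≤ t → t ≤ T → ∀ᵐ ω ∂P, HasSum (fun k => A k t * Z k t ω) (X t ω)) :
    P {ω | ∃ v, IsLocalWeight v T G H ∧
        Λ * (G / ℓ + 8 * H) * D + H * M < |∑ t ∈ Finset.Icc 1 T, v t * X t ω|}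
      ≤ P {ω | ∃ k i j, t₀ k ≤ i ∧ i ≤ j ∧ j ≤ T + 1 ∧ j ≤ i + ℓ ∧
          Λ < |∑ t ∈ Finset.Ico i j, Z k t ω|} + ENNReal.ofReal (D₀ / M) := by
  set R : Ω → ℝ≥0∞ := fun ω =>
    ∑' k, ENNReal.ofReal (b k) * ∑ t ∈ Finset.Ico 1 (t₀ k), ‖Z k t ω‖ₑ with hR
  have hRi : ∫⁻ ω, R ω ∂P ≤ ENNReal.ofReal D₀ := by
    refine le_trans (le_of_eq ?_) hD₀
    rw [lintegral_tsum fun k => (Finset.aemeasurable_fun_sum _ fun t _ =>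
      (hZm k t).enorm).const_mul _]
    refine tsum_congr fun k => ?_
    rw [lintegral_const_mul' _ _ ENNReal.ofReal_ne_top,
      lintegral_finsetSum' _ fun t _ => (hZm k t).enorm]
  have hmk : P {ω | ENNReal.ofReal M ≤ R ω} ≤ ENNReal.ofReal (D₀ / M) := by
    rw [ENNReal.ofReal_div_of_pos hM]
    refine (meas_ge_le_lintegral_div (AEMeasurable.tsum fun k =>
      (Finset.aemeasurable_fun_sum _ fun t _ => (hZm k t).enorm).const_mul _)
      (ENNReal.ofReal_pos.mpr hM).ne' ENNReal.ofReal_ne_top).trans ?_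
    gcongr
  refine le_trans (measure_mono_ae ?_) ((measure_union_le _ _).trans (add_le_add le_rfl hmk))
  have hX' : ∀ᵐ ω ∂P, ∀ t, 1 ≤ t → t ≤ T → HasSum (fun k => A k t * Z k t ω) (X t ω) := by
    rw [ae_all_iff]
    intro t
    by_cases h1 : 1 ≤ t <;> by_cases h2 : t ≤ T
    · filter_upwards [hX t h1 h2] with ω h _ _ using h
    all_goals exact ae_of_all _ fun ω h1' h2' => by omega
  filter_upwards [hX'] with ω hω
  rintro ⟨v, hv, hlt⟩
  by_contra hcon
  have hc1 : ∀ k i j, t₀ k ≤ i → i ≤ j → j ≤ T + 1 → j ≤ i + ℓ →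
      |∑ t ∈ Finset.Ico i j, Z k t ω| ≤ Λ := fun k i j h1 h2 h3 h4 =>
    not_lt.mp fun h5 => hcon (Or.inl ⟨k, i, j, h1, h2, h3, h4, h5⟩)
  have hc2 : R ω ≤ ENNReal.ofReal M := le_of_not_ge fun h => hcon (Or.inr h)
  have key := enorm_sum_weight_mul_tsum_le hv hH0 hb0 hA ht₀ hℓ hΛ
    (z := fun k t => Z k t ω) (X := fun t => X t ω) hc1 hω
  have key2 : ‖∑ t ∈ Finset.Icc 1 T, v t * X t ω‖ₑ
      ≤ ENNReal.ofReal (Λ * (G / ℓ + 8 * H) * D + H * M) := by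
    have h1 : ENNReal.ofReal (Λ * (G / ℓ + 8 * H) * D + H * M)
        ≥ ENNReal.ofReal (Λ * (G / ℓ + 8 * H)) * ENNReal.ofReal D
          + ENNReal.ofReal H * ENNReal.ofReal M := by
      rw [← ENNReal.ofReal_mul (by positivity), ← ENNReal.ofReal_mul hH0]
      rw [← ENNReal.ofReal_add (by positivity) (by positivity)]
    exact key.trans (le_trans (add_le_add (by gcongr) (by gcongr)) h1)
  rw [Real.enorm_eq_ofReal_abs] at key2
  have hpos : 0 ≤ Λ * (G / ℓ + 8 * H) * D + H * M := by positivity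
  exact hlt.not_ge ((ENNReal.ofReal_le_ofReal_iff hpos).mp key2)

end

/-! ### Series of random variables and linear processes -/

section Series

variable {Ω : Type*} {m0 : MeasurableSpace Ω} {P : Measure Ω} {κ : Type*} [Countable κ]

theorem ae_summable_norm_mul {A : κ → ℝ} {f : κ → Ω → ℝ} {S : ℝ} (hA : Summable fun k => |A k|)
    (hf : ∀ k, Integrable (f k) P) (hS : ∀ k, ∫ ω, |f k ω| ∂P ≤ S) :
    ∀ᵐ ω ∂P, Summable fun k => ‖A k * f k ω‖ := by
  have hsum : Summable fun k => |A k| * S := hA.mul_right S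
  refine summable_norm_of_tsum_eLpNorm_ne_top le_rfl
    (fun k => ((hf k).const_mul (A k)).aestronglyMeasurable) ?_
  refine ne_top_of_le_ne_top hsum.tsum_ofReal_ne_top (ENNReal.tsum_le_tsum fun k => ?_)
  rw [eLpNorm_one_eq_lintegral_enorm,
    ← ofReal_integral_norm_eq_lintegral_enorm ((hf k).const_mul (A k))]
  refine ENNReal.ofReal_le_ofReal ?_
  simp only [norm_mul, Real.norm_eq_abs]
  rw [integral_const_mul]
  exact mul_le_mul_of_nonneg_left (hS k) (abs_nonneg _)

theorem integrable_tsum_mul {A : κ → ℝ} {f : κ → Ω → ℝ} {S : ℝ} (hA : Summable fun k => |A k|)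
    (hf : ∀ k, Integrable (f k) P) (hS : ∀ k, ∫ ω, |f k ω| ∂P ≤ S) :
    Integrable (fun ω => ∑' k, A k * f k ω) P := by
  have hsum : Summable fun k => |A k| * S := hA.mul_right S
  refine ⟨(AEMeasurable.tsum fun k =>
    ((hf k).const_mul (A k)).aemeasurable).aestronglyMeasurable, ?_⟩
  have h1 : ∫⁻ ω, ‖∑' k, A k * f k ω‖ₑ ∂P ≤ ∑' k, ENNReal.ofReal (|A k| * S) := by
    refine (lintegral_mono fun ω => enorm_tsum_le_tsum_enorm).trans ?_
    rw [lintegral_tsum fun k => ((hf k).const_mul (A k)).aestronglyMeasurable.enorm]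
    refine ENNReal.tsum_le_tsum fun k => ?_
    rw [← ofReal_integral_norm_eq_lintegral_enorm ((hf k).const_mul (A k))]
    refine ENNReal.ofReal_le_ofReal ?_
    simp only [norm_mul, Real.norm_eq_abs]
    rw [integral_const_mul]
    exact mul_le_mul_of_nonneg_left (hS k) (abs_nonneg _)
  exact h1.trans_lt hsum.tsum_ofReal_lt_top

theorem hasSum_mul_integral {A : κ → ℝ} {f : κ → Ω → ℝ} {S : ℝ} (hA : Summable fun k => |A k|)
    (hf : ∀ k, Integrable (f k) P) (hS : ∀ k, ∫ ω, |f k ω| ∂P ≤ S) :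
    HasSum (fun k => A k * ∫ ω, f k ω ∂P) (∫ ω, ∑' k, A k * f k ω ∂P) := by
  have h := hasSum_integral_of_summable_integral_norm (F := fun k ω => A k * f k ω)
    (fun k => (hf k).const_mul (A k)) (Summable.of_nonneg_of_le
      (fun k => integral_nonneg fun _ => norm_nonneg _) (fun k => ?_) (hA.mul_right S))
  · simpa only [integral_const_mul] using h
  · simp only [norm_mul, Real.norm_eq_abs]
    rw [integral_const_mul]
    exact mul_le_mul_of_nonneg_left (hS k) (abs_nonneg _)

/-- A series of integrable variables may be centred term by term. -/
theorem ae_hasSum_mul_sub_integral {A : κ → ℝ} {f : κ → Ω → ℝ} {X : Ω → ℝ} {S : ℝ}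
    (hA : Summable fun k => |A k|) (hf : ∀ k, Integrable (f k) P)
    (hS : ∀ k, ∫ ω, |f k ω| ∂P ≤ S) (hX : X =ᵐ[P] fun ω => ∑' k, A k * f k ω) :
    ∀ᵐ ω ∂P, HasSum (fun k => A k * (f k ω - ∫ ω', f k ω' ∂P)) (X ω - ∫ ω', X ω' ∂P) := by
  filter_upwards [ae_summable_norm_mul hA hf hS, hX] with ω h1 h2
  rw [integral_congr_ae hX, h2]
  simpa only [mul_sub] using h1.of_norm.hasSum.sub (hasSum_mul_integral hA hf hS)

end Series

/-- The linear process `∑ⱼ a_j z_{t-j}` at time `t`. -/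
noncomputable def linearProcess {Ω : Type*} (a : ℕ → ℝ) (z : ℤ → Ω → ℝ) (t : ℤ) (ω : Ω) : ℝ :=
  ∑' j : ℕ, a j * z (t - j) ω

/-- Time-varying coefficients `a j t`, for `1 ≤ t ≤ n`, are bounded and of bounded variation in `t`
by `b j`, with `∑ⱼ (j + 1) b_j ≤ D`. -/
structure IsBVCoeff (a : ℕ → ℕ → ℝ) (n : ℕ) (b : ℕ → ℝ) (D : ℝ) : Prop where
  nonneg : ∀ j, 0 ≤ b j
  bdd : ∀ j, IsBVBdd (a j) n (b j)
  sum_le : ∑' j, ENNReal.ofReal ((j + 1) * b j) ≤ ENNReal.ofReal D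

namespace IsBVCoeff

variable {a a' : ℕ → ℕ → ℝ} {n : ℕ} {b b' : ℕ → ℝ} {D D' : ℝ}

theorem tsum_ofReal_le (ha : IsBVCoeff a n b D) : ∑' j, ENNReal.ofReal (b j) ≤ ENNReal.ofReal D :=
  (ENNReal.tsum_le_tsum fun j => ENNReal.ofReal_le_ofReal
    (le_mul_of_one_le_left (ha.nonneg j) (by simp))).trans ha.sum_le

theorem tsum_mul_ofReal_le (ha : IsBVCoeff a n b D) :
    ∑' j : ℕ, (j : ℝ≥0∞) * ENNReal.ofReal (b j) ≤ ENNReal.ofReal D :=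
  (ENNReal.tsum_le_tsum fun j => by
    rw [← ENNReal.ofReal_natCast, ← ENNReal.ofReal_mul (Nat.cast_nonneg j)]
    exact ENNReal.ofReal_le_ofReal
      (mul_le_mul_of_nonneg_right (by linarith) (ha.nonneg j))).trans ha.sum_le

theorem summable_bound (ha : IsBVCoeff a n b D) : Summable b :=
  (ENNReal.summable_toReal (ne_top_of_le_ne_top ENNReal.ofReal_ne_top ha.tsum_ofReal_le)).congr
    fun j => ENNReal.toReal_ofReal (ha.nonneg j)

theorem summable_abs (ha : IsBVCoeff a n b D) {t : ℕ} (h1 : 1 ≤ t) (h2 : t ≤ n) :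
    Summable fun j => |a j t| :=
  Summable.of_nonneg_of_le (fun _ => abs_nonneg _) (fun j => (ha.bdd j).sup t h1 h2)
    ha.summable_bound

end IsBVCoeff

theorem summable_abs_mul_prod {a a' : ℕ → ℝ} (ha : Summable fun j => |a j|)
    (ha' : Summable fun j => |a' j|) : Summable fun k : ℕ × ℕ => |a k.1 * a' k.2| := by
  simp only [abs_mul]
  exact ha.mul_of_nonneg ha' (fun _ => abs_nonneg _) fun _ => abs_nonneg _

section LinearProcess

variable {Ω : Type*} {m0 : MeasurableSpace Ω} {P : Measure Ω} [IsProbabilityMeasure P]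
  {ι : Type*} {ℱ : Filtration ℤ m0} {u : ι → ℤ → Ω → ℝ} {N : ℤ → Ω → ℝ} {S : ℝ}

namespace IsMDFamily

theorem integral_abs_le (hu : IsMDFamily P ℱ u N S) (c : ι) (t : ℤ) :
    ∫ ω, |u c t ω| ∂P ≤ 1 + S := by
  refine (integral_mono (g := fun ω => 1 + N t ω ^ 2) (hu.integrable c t).abs
    ((integrable_const 1).add (hu.integrable_env_sq t)) fun ω => ?_).trans ?_
  · have h1 := hu.abs_le c t ω
    show |u c t ω| ≤ 1 + N t ω ^ 2
    nlinarith [sq_nonneg (N t ω - 1)]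
  · rw [integral_add (integrable_const 1) (hu.integrable_env_sq t)]
    simpa using hu.integral_env_sq_le t

theorem ae_summable (hu : IsMDFamily P ℱ u N S) (c : ι) {a : ℕ → ℝ} (ha : Summable fun j => |a j|)
    (t : ℤ) : ∀ᵐ ω ∂P, Summable fun j : ℕ => ‖a j * u c (t - j) ω‖ :=
  ae_summable_norm_mul ha (fun _ => hu.integrable c _) fun _ => hu.integral_abs_le c _

theorem integrable_linearProcess (hu : IsMDFamily P ℱ u N S) (c : ι) {a : ℕ → ℝ}
    (ha : Summable fun j => |a j|) (t : ℤ) : Integrable (linearProcess a (u c) t) P :=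
  integrable_tsum_mul ha (fun _ => hu.integrable c _) fun _ => hu.integral_abs_le c _

theorem integral_linearProcess (hu : IsMDFamily P ℱ u N S) (c : ι) {a : ℕ → ℝ}
    (ha : Summable fun j => |a j|) (t : ℤ) : ∫ ω, linearProcess a (u c) t ω ∂P = 0 := by
  refine (hasSum_mul_integral ha (fun j : ℕ => hu.integrable c (t - j))
    fun _ => hu.integral_abs_le c _).unique ?_
  simp only [hu.integral_eq_zero, mul_zero]
  exact hasSum_zero

theorem linearProcess_mul_eq (hu : IsMDFamily P ℱ u N S) (c e : ι) {a a' : ℕ → ℝ}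
    (ha : Summable fun j => |a j|) (ha' : Summable fun j => |a' j|) (t t' : ℤ) :
    (fun ω => linearProcess a (u c) t ω * linearProcess a' (u e) t' ω) =ᵐ[P]
      fun ω => ∑' k : ℕ × ℕ, a k.1 * a' k.2 * (u c (t - k.1) ω * u e (t' - k.2) ω) := by
  filter_upwards [hu.ae_summable c ha t, hu.ae_summable e ha' t'] with ω h1 h2
  rw [linearProcess, linearProcess, tsum_mul_tsum_of_summable_norm h1 h2]
  exact tsum_congr fun k => by ring

theorem integrable_linearProcess_mul (hu : IsMDFamily P ℱ u N S) (c e : ι) {a a' : ℕ → ℝ}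
    (ha : Summable fun j => |a j|) (ha' : Summable fun j => |a' j|) (t t' : ℤ) :
    Integrable (fun ω => linearProcess a (u c) t ω * linearProcess a' (u e) t' ω) P :=
  (integrable_tsum_mul (summable_abs_mul_prod ha ha') (fun _ => hu.integrable_mul c e _ _)
    fun _ => hu.integral_abs_mul_le c e _ _).congr (hu.linearProcess_mul_eq c e ha ha' t t').symm

theorem memLp_linearProcess (hu : IsMDFamily P ℱ u N S) (c : ι) {a : ℕ → ℝ}
    (ha : Summable fun j => |a j|) (t : ℤ) : MemLp (linearProcess a (u c) t) 2 P := by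
  rw [memLp_two_iff_integrable_sq (hu.integrable_linearProcess c ha t).aestronglyMeasurable]
  simpa only [sq] using hu.integrable_linearProcess_mul c c ha ha t t

end IsMDFamily

variable {δ : ℝ} {C : ℝ≥0}

theorem sum_Ico_eq_sum_range_shift (z : ℕ → ℝ) (g : ℤ → ℝ) {i k α : ℕ}
    (h : ∀ r : ℕ, r < k - i → z (i + r) = g ((α : ℤ) + 1 + r)) :
    ∑ t ∈ Finset.Ico i k, z t = ∑ r ∈ Finset.range (k - i), g ((α : ℤ) + 1 + r) := by
  rw [Finset.sum_Ico_eq_sum_range]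
  exact Finset.sum_congr rfl fun r hr => h r (Finset.mem_range.mp hr)

/-- Weighted sums of a time-varying linear process, uniformly over the weights. -/
theorem measure_exists_weightedSum_linearProcess_gt_le [Fintype ι] (hu : IsMDFamily P ℱ u N S)
    (hδ : 1 ≤ δ) (hC : ∀ t, 1 ≤ t → ∫⁻ ω, ‖N t ω‖ₑ ^ δ ∂P ≤ C) {s x : ℝ} (hs : 0 < s)
    (hx : 0 ≤ x) {T p ℓ : ℕ} (hℓ : 1 ≤ ℓ) {a : ℕ → ℕ → ℝ} {b : ℕ → ℝ} {D G H M : ℝ}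
    (hD : 0 ≤ D) (ha : IsBVCoeff a (T + p) b D) (hG : 0 ≤ G) (hH : 0 ≤ H) (hM : 0 < M) (c : ι) :
    P {ω | ∃ v, IsLocalWeight v T G H ∧ (x + s) * (G / ℓ + 8 * H) * D + H * M
        < |∑ t ∈ Finset.Icc 1 T,
          v t * linearProcess (fun j => a j (t + p)) (u c) ((t + p : ℕ) : ℤ) ω|}
      ≤ ENNReal.ofReal ((1 + Fintype.card ι) * ((T + p : ℕ) * (C * s ^ (-δ)))
        + Fintype.card ι * ((T + p : ℕ) + 1) ^ 2
          * (2 * Real.exp (-(s⁻¹ * x) + s⁻¹ ^ 2 * (S * ℓ)))) +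
        ENNReal.ofReal (D * (1 + S) / M) := by
  have hS := hu.nonneg
  -- from time `t₀ j` on, the innovation `z_{t+p-j}` has a positive index
  have hbase := measure_exists_weightedSum_gt_le (P := P) (κ := ℕ) (A := fun j t => a j (t + p))
    (Z := fun j t => u c (((t + p : ℕ) : ℤ) - j))
    (X := fun t => linearProcess (fun j => a j (t + p)) (u c) ((t + p : ℕ) : ℤ))
    (b := b) (t₀ := fun j => max 1 (j + 1 - p)) (T := T) (ℓ := ℓ) (Λ := x + s) (D := D)
    (D₀ := D * (1 + S)) (M := M) hG hH hD ha.nonneg (fun j => (ha.bdd j).shift le_rfl)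
    (fun j => le_max_left _ _) hℓ (by positivity) hM ha.tsum_ofReal_le
    (fun j t => (hu.stronglyMeasurable c _).measurable.aemeasurable) ?_ ?_
  · refine hbase.trans (add_le_add ((measure_mono ?_).trans
      (measure_exists_blockSum_gt_le hu hδ hC hs x (T + p) ℓ)) le_rfl)
    rintro ω ⟨j, i, k, h1, h2, h3, h4, hlt⟩
    have h5 : 1 ≤ i ∧ j + 1 - p ≤ i := max_le_iff.mp h1
    refine ⟨c, i + p - j - 1, k - i, by omega, by omega, ?_⟩
    rwa [sum_Ico_eq_sum_range_shift (α := i + p - j - 1)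
      (fun t => u c (((t + p : ℕ) : ℤ) - j) ω) (fun t => u c t ω) fun r hr => by
        congr 1
        omega] at hlt
  · calc ∑' j : ℕ, ENNReal.ofReal (b j) * ∑ t ∈ Finset.Ico 1 (max 1 (j + 1 - p)),
          ∫⁻ ω, ‖u c (((t + p : ℕ) : ℤ) - j) ω‖ₑ ∂P
        ≤ ∑' j : ℕ, ((j : ℝ≥0∞) * ENNReal.ofReal (b j)) * ENNReal.ofReal (1 + S) := by
          refine ENNReal.tsum_le_tsum fun j => ?_
          rw [mul_comm (j : ℝ≥0∞), mul_assoc]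
          gcongr
          refine (Finset.sum_le_card_nsmul _ _ (ENNReal.ofReal (1 + S)) fun t _ => ?_).trans ?_
          · rw [← ofReal_integral_norm_eq_lintegral_enorm (hu.integrable c _)]
            exact ENNReal.ofReal_le_ofReal (hu.integral_abs_le c _)
          · rw [nsmul_eq_mul, Nat.card_Ico]
            gcongr
            omega
      _ ≤ ENNReal.ofReal D * ENNReal.ofReal (1 + S) := by
          rw [ENNReal.tsum_mul_right]
          gcongr
          exact ha.tsum_mul_ofReal_le
      _ = _ := (ENNReal.ofReal_mul hD).symm
  · intro t h1 h2
    have hsum : Summable fun j => |a j (t + p)| := ha.summable_abs (by omega) (by omega)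
    filter_upwards [hu.ae_summable c hsum ((t + p : ℕ) : ℤ)] with ω h
    exact h.of_norm.hasSum

theorem IsMDFamily.lintegral_enorm_mul_sub_le (hu : IsMDFamily P ℱ u N S) (c e : ι) (t t' : ℤ) :
    ∫⁻ ω, ‖u c t ω * u e t' ω - ∫ ω', u c t ω' * u e t' ω' ∂P‖ₑ ∂P
      ≤ ENNReal.ofReal (2 * S) := by
  have hi := hu.integrable_mul c e t t'
  have h0 := ofReal_integral_norm_eq_lintegral_enorm
    (hi.sub (integrable_const (∫ ω', u c t ω' * u e t' ω' ∂P)))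
  simp only [Pi.sub_apply] at h0
  rw [← h0]
  refine ENNReal.ofReal_le_ofReal ?_
  have h1 : |∫ ω', u c t ω' * u e t' ω' ∂P| ≤ S :=
    (abs_integral_le_integral_abs).trans (hu.integral_abs_mul_le c e t t')
  calc ∫ ω, ‖u c t ω * u e t' ω - ∫ ω', u c t ω' * u e t' ω' ∂P‖ ∂P
      ≤ ∫ ω, (|u c t ω * u e t' ω| + S) ∂P := by
        refine integral_mono (hi.sub (integrable_const _)).norm
          (hi.abs.add (integrable_const _)) fun ω => ?_
        refine (norm_sub_le _ _).trans ?_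
        simp only [Real.norm_eq_abs]
        gcongr
    _ ≤ S + S := by
        rw [integral_add hi.abs (integrable_const _)]
        simpa using hu.integral_abs_mul_le c e t t'
    _ = 2 * S := by ring

/-- The products that involve an innovation at a time before `1` have summable first moments. -/
theorem tsum_presample_le (hu : IsMDFamily P ℱ u N S) {a a' : ℕ → ℕ → ℝ} {n : ℕ} {b b' : ℕ → ℝ}
    {D D' : ℝ} (ha : IsBVCoeff a n b D) (ha' : IsBVCoeff a' n b' D') (hD : 0 ≤ D) (hD' : 0 ≤ D')
    (p : ℕ) (c e : ι) :
    ∑' k : ℕ × ℕ, ENNReal.ofReal (2 * (b k.1 * b' k.2)) *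
          ∑ t ∈ Finset.Ico 1 (max 1 (max (k.1 + 1) (k.2 + 1 - p))),
            ∫⁻ ω, ‖u c ((t : ℤ) - k.1) ω * u e (((t + p : ℕ) : ℤ) - k.2) ω
              - ∫ ω', u c ((t : ℤ) - k.1) ω' * u e (((t + p : ℕ) : ℤ) - k.2) ω' ∂P‖ₑ ∂P
      ≤ ENNReal.ofReal (8 * (D * D') * S) := by
  have hS := hu.nonneg
  calc ∑' k : ℕ × ℕ, ENNReal.ofReal (2 * (b k.1 * b' k.2)) *
        ∑ t ∈ Finset.Ico 1 (max 1 (max (k.1 + 1) (k.2 + 1 - p))),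
          ∫⁻ ω, ‖u c ((t : ℤ) - k.1) ω * u e (((t + p : ℕ) : ℤ) - k.2) ω
            - ∫ ω', u c ((t : ℤ) - k.1) ω' * u e (((t + p : ℕ) : ℤ) - k.2) ω' ∂P‖ₑ ∂P
      ≤ ∑' k : ℕ × ℕ, (((k.1 : ℝ≥0∞) * ENNReal.ofReal (b k.1)) * ENNReal.ofReal (b' k.2)
          + ENNReal.ofReal (b k.1) * ((k.2 : ℝ≥0∞) * ENNReal.ofReal (b' k.2)))
          * (2 * ENNReal.ofReal (2 * S)) := by
        refine ENNReal.tsum_le_tsum fun k => ?_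
        have h1 : ∑ t ∈ Finset.Ico 1 (max 1 (max (k.1 + 1) (k.2 + 1 - p))),
            ∫⁻ ω, ‖u c ((t : ℤ) - k.1) ω * u e (((t + p : ℕ) : ℤ) - k.2) ω
            - ∫ ω', u c ((t : ℤ) - k.1) ω' * u e (((t + p : ℕ) : ℤ) - k.2) ω' ∂P‖ₑ ∂P
            ≤ ((k.1 : ℝ≥0∞) + k.2) * ENNReal.ofReal (2 * S) := by
          refine (Finset.sum_le_card_nsmul _ _ _ fun t _ =>
            hu.lintegral_enorm_mul_sub_le c e _ _).trans ?_
          rw [nsmul_eq_mul, Nat.card_Ico]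
          gcongr
          exact_mod_cast (show max 1 (max (k.1 + 1) (k.2 + 1 - p)) - 1 ≤ k.1 + k.2 by omega)
        refine (mul_le_mul_right h1 _).trans (le_of_eq ?_)
        rw [ENNReal.ofReal_mul zero_le_two, ENNReal.ofReal_mul (ha.nonneg _),
          show ENNReal.ofReal 2 = 2 by norm_num]
        ring
    _ ≤ (ENNReal.ofReal D * ENNReal.ofReal D' + ENNReal.ofReal D * ENNReal.ofReal D')
          * (2 * ENNReal.ofReal (2 * S)) := by
        rw [ENNReal.tsum_mul_right, ENNReal.tsum_add,
          ENNReal.tsum_prod (f := fun i j : ℕ =>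
            ((i : ℝ≥0∞) * ENNReal.ofReal (b i)) * ENNReal.ofReal (b' j)),
          ENNReal.tsum_prod (f := fun i j : ℕ =>
            ENNReal.ofReal (b i) * ((j : ℝ≥0∞) * ENNReal.ofReal (b' j)))]
        simp only [ENNReal.tsum_mul_left, ENNReal.tsum_mul_right]
        gcongr
        · exact ha.tsum_mul_ofReal_le
        · exact ha'.tsum_ofReal_le
        · exact ha.tsum_ofReal_le
        · exact ha'.tsum_mul_ofReal_le
    _ = ENNReal.ofReal (8 * (D * D') * S) := by
        rw [← ENNReal.ofReal_mul hD, ← ENNReal.ofReal_add (by positivity) (by positivity),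
          show (2 : ℝ≥0∞) = ENNReal.ofReal 2 by norm_num, ← ENNReal.ofReal_mul zero_le_two,
          ← ENNReal.ofReal_mul (by positivity)]
        congr 1
        ring

set_option maxHeartbeats 1000000 in
/-- Weighted sums of centred products of two time-varying linear processes, uniformly over the
weights, on the event that the conditional fourth moments are at most `A`. -/
theorem measure_exists_weightedSum_linearProcess_mul_gt_le [Fintype ι]
    (hu : IsMDFamily P ℱ u N S) (hδ : 2 ≤ δ)
    (hC : ∀ t, 1 ≤ t → ∫⁻ ω, ‖N t ω‖ₑ ^ δ ∂P ≤ C) {s x A : ℝ} (hs : 0 < s) (hx : 0 ≤ x)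
    (hA : 0 ≤ A) {T p ℓ : ℕ} (hℓ : 1 ≤ ℓ) {a a' : ℕ → ℕ → ℝ} {b b' : ℕ → ℝ} {D D' G H M : ℝ}
    (hD : 0 ≤ D) (hD' : 0 ≤ D') (ha : IsBVCoeff a (T + p) b D) (ha' : IsBVCoeff a' (T + p) b' D')
    (hG : 0 ≤ G) (hH : 0 ≤ H) (hM : 0 < M) (c e : ι) :
    P {ω | ∃ v, IsLocalWeight v T G H ∧ (x + s ^ 2) * (G / ℓ + 8 * H) * (2 * (D * D')) + H * M
        < |∑ t ∈ Finset.Icc 1 T, v t *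
          (linearProcess (fun j => a j t) (u c) t ω
              * linearProcess (fun j => a' j (t + p)) (u e) ((t + p : ℕ) : ℤ) ω
            - ∫ ω', linearProcess (fun j => a j t) (u c) t ω'
              * linearProcess (fun j => a' j (t + p)) (u e) ((t + p : ℕ) : ℤ) ω' ∂P)|}
      ≤ P {ω | ¬ ∀ t : ℤ, 1 ≤ t →
          condLExp (ℱ (t - 1)) P (fun ω' => ‖N t ω'‖ₑ ^ 4) ω ≤ ENNReal.ofReal A} +
        ENNReal.ofReal ((1 + Fintype.card ι + Fintype.card ι ^ 2)
          * ((T + p : ℕ) * (C * s ^ (-δ)))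
        + Fintype.card ι ^ 2 * ((T + p : ℕ) + 1) ^ 2
          * (2 * Real.exp (-((s ^ 2)⁻¹ * x) + (s ^ 2)⁻¹ ^ 2 * (A * ℓ)))
        + Fintype.card ι ^ 2 * ((T + p : ℕ) + 1) ^ 3
          * (2 * Real.exp (-((s ^ 2)⁻¹ * x)
            + (s ^ 2)⁻¹ ^ 2 * (S * (S * ℓ + (x + s ^ 2)))))) +
        ENNReal.ofReal (8 * (D * D') * S / M) := by
  have hS := hu.nonneg
  have hbb : ∑' k : ℕ × ℕ, ENNReal.ofReal (b k.1) * ENNReal.ofReal (b' k.2)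
      ≤ ENNReal.ofReal (D * D') := by
    rw [ENNReal.tsum_prod (f := fun i j => ENNReal.ofReal (b i) * ENNReal.ofReal (b' j)),
      ENNReal.ofReal_mul hD]
    simp only [ENNReal.tsum_mul_left, ENNReal.tsum_mul_right]
    gcongr
    · exact ha.tsum_ofReal_le
    · exact ha'.tsum_ofReal_le
  have hbase := measure_exists_weightedSum_gt_le (P := P) (κ := ℕ × ℕ)
    (A := fun k t => a k.1 t * a' k.2 (t + p))
    (Z := fun k t ω => u c ((t : ℤ) - k.1) ω * u e (((t + p : ℕ) : ℤ) - k.2) ω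
      - ∫ ω', u c ((t : ℤ) - k.1) ω' * u e (((t + p : ℕ) : ℤ) - k.2) ω' ∂P)
    (X := fun t ω => linearProcess (fun j => a j t) (u c) t ω
              * linearProcess (fun j => a' j (t + p)) (u e) ((t + p : ℕ) : ℤ) ω
            - ∫ ω', linearProcess (fun j => a j t) (u c) t ω'
              * linearProcess (fun j => a' j (t + p)) (u e) ((t + p : ℕ) : ℤ) ω' ∂P)
    (b := fun k => 2 * (b k.1 * b' k.2)) (t₀ := fun k => max 1 (max (k.1 + 1) (k.2 + 1 - p)))
    (T := T) (ℓ := ℓ) (Λ := x + s ^ 2) (D := 2 * (D * D'))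
    (D₀ := 8 * (D * D') * S) (M := M) hG hH (by positivity)
    (fun k => mul_nonneg zero_le_two (mul_nonneg (ha.nonneg _) (ha'.nonneg _)))
    (fun k => ((ha.bdd k.1).shift (T := T) (p := 0) (by omega)).mul (ha.nonneg _) (ha'.nonneg _)
      ((ha'.bdd k.2).shift le_rfl))
    (fun j => le_max_left _ _) hℓ (by positivity) hM ?_
    (fun k t => ((hu.integrable_mul c e _ _).sub (integrable_const _)).aemeasurable) ?_ ?_
  · refine hbase.trans (add_le_add ((measure_mono (fun ω hω => ?_)).trans
      ((measure_union_le _ _).trans (add_le_add le_rfl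
        (measure_exists_blockSum_mul_gt_le hu hδ hC hs hA x (T + p) ℓ)))) le_rfl)
    obtain ⟨k, i, j, h1, h2, h3, h4, hlt⟩ := hω
    rcases em (∀ t : ℤ, 1 ≤ t →
        condLExp (ℱ (t - 1)) P (fun ω' => ‖N t ω'‖ₑ ^ 4) ω ≤ ENNReal.ofReal A) with hω | hω
    swap
    · exact Or.inl hω
    refine Or.inr ⟨hω, ?_⟩
    have h5 : 1 ≤ i ∧ k.1 + 1 ≤ i ∧ k.2 + 1 - p ≤ i :=
      ⟨(max_le_iff.mp h1).1, max_le_iff.mp (max_le_iff.mp h1).2⟩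
    refine ⟨c, e, i - k.1 - 1, i + p - k.2 - 1, j - i, by omega, by omega, by omega, ?_⟩
    refine hlt.trans_eq ?_
    congr 1
    rw [Finset.sum_Ico_eq_sum_range]
    refine Finset.sum_congr rfl fun r _ => ?_
    have e1 : ((i + r : ℕ) : ℤ) - k.1 = ((i - k.1 - 1 : ℕ) : ℤ) + 1 + r := by omega
    have e2 : ((i + r + p : ℕ) : ℤ) - k.2 = ((i + p - k.2 - 1 : ℕ) : ℤ) + 1 + r := by omega
    simp only [e1, e2]
  · simp only [ENNReal.ofReal_mul zero_le_two, ENNReal.ofReal_mul (ha.nonneg _)]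
    rw [ENNReal.tsum_mul_left]
    gcongr
  · exact tsum_presample_le hu ha ha' hD hD' p c e
  · intro t h1 h2
    have hs1 : Summable fun j => |a j t| := ha.summable_abs h1 (by omega)
    have hs2 : Summable fun j => |a' j (t + p)| := ha'.summable_abs (by omega) (by omega)
    have hX := hu.linearProcess_mul_eq c e hs1 hs2 t ((t + p : ℕ) : ℤ)
    have key := ae_hasSum_mul_sub_integral (A := fun k : ℕ × ℕ => a k.1 t * a' k.2 (t + p))
      (f := fun k ω => u c ((t : ℤ) - k.1) ω * u e (((t + p : ℕ) : ℤ) - k.2) ω) (S := S)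
      (summable_abs_mul_prod hs1 hs2) (fun _ => hu.integrable_mul c e _ _)
      (fun _ => hu.integral_abs_mul_le c e _ _) hX
    filter_upwards [key] with ω h
    exact h

end LinearProcess

/-! ### Rates of convergence, uniformly over the weights -/

section Rates

/-- The tail probability `T θ ^ q` in terms of the rate `T ^ (2 / q) θ ^ 2`. -/
theorem mul_rpow_eq_rpow {T θ q : ℝ} (hT : 0 < T) (hθ : 0 ≤ θ) (hq : 0 < q) :
    T * θ ^ q = (T ^ (2 / q) * θ ^ 2) ^ (q / 2) := by
  rw [Real.mul_rpow (Real.rpow_nonneg hT.le _) (sq_nonneg _), ← Real.rpow_mul hT.le,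
    ← Real.rpow_natCast, ← Real.rpow_mul hθ, show 2 / q * (q / 2) = 1 by field_simp,
    Real.rpow_one, show ((2 : ℕ) : ℝ) * (q / 2) = q by push_cast; ring]

/-- Exponential tails of order `T ^ (-(k + 1))` survive a union over `O(T ^ k)` events. -/
theorem pow_mul_exp_le {T : ℕ} (hT : 1 ≤ T) (p k : ℕ) {y : ℝ}
    (hy : y ≤ -((k + 1) * Real.log T)) :
    ((T + p : ℕ) + 1 : ℝ) ^ k * (2 * Real.exp y) ≤ 2 * (p + 2) ^ k / T := by
  have hT0 : (0 : ℝ) < T := by exact_mod_cast hT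
  have hT1 : (1 : ℝ) ≤ T := by exact_mod_cast hT
  have h1 : Real.exp y ≤ ((T : ℝ) ^ (k + 1))⁻¹ := by
    refine (Real.exp_le_exp.mpr hy).trans (le_of_eq ?_)
    rw [Real.exp_neg, show ((k : ℝ) + 1) * Real.log T = Real.log ((T : ℝ) ^ (k + 1)) by
      rw [Real.log_pow]; push_cast; ring, Real.exp_log (pow_pos hT0 _)]
  have h2 : ((T + p : ℕ) + 1 : ℝ) ≤ (p + 2) * T := by
    push_cast
    nlinarith [(Nat.cast_nonneg p : (0 : ℝ) ≤ p)]
  calc ((T + p : ℕ) + 1 : ℝ) ^ k * (2 * Real.exp y)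
      ≤ ((p + 2) * T : ℝ) ^ k * (2 * ((T : ℝ) ^ (k + 1))⁻¹) := by gcongr
    _ = _ := by
        rw [mul_pow, pow_succ]
        field_simp

theorem div_div_add_one_le {y η : ℝ} (hy : 0 ≤ y) (hη : 0 < η) : y / (y / η + 1) ≤ η := by
  rw [div_le_iff₀ (by positivity), mul_add, mul_div_cancel₀ _ hη.ne']
  linarith

theorem ceil_inv_bounds {d : ℝ} (hd : 0 < d) (hd1 : d ≤ 1) :
    1 ≤ ⌈d⁻¹⌉₊ ∧ (⌈d⁻¹⌉₊ : ℝ)⁻¹ ≤ d ∧ d * ⌈d⁻¹⌉₊ ≤ 2 := by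
  have h1 : 0 < d⁻¹ := inv_pos.mpr hd
  refine ⟨Nat.one_le_iff_ne_zero.mpr (Nat.ceil_pos.mpr h1).ne', ?_, ?_⟩
  · exact inv_le_of_inv_le₀ hd (Nat.le_ceil _)
  · have h2 := (Nat.ceil_lt_add_one h1.le).le
    calc d * ⌈d⁻¹⌉₊ ≤ d * (d⁻¹ + 1) := by gcongr
      _ = 1 + d := by rw [mul_add, mul_inv_cancel₀ hd.ne', mul_one]
      _ ≤ 2 := by linarith

/-- With blocks of length `⌈1/d⌉` and block sums of order `log T / θ`, where `θ ^ 2 = d log T`,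
the bound for a weighted sum is of order `θ`. -/
theorem weightedSum_bound_le {d L θ G D M K : ℝ} (hd : 0 < d) (hd1 : d ≤ 1) (hL : 1 ≤ L)
    (hθ : 0 < θ) (hθ2 : θ ^ 2 = d * L) (hG : 0 ≤ G) (hD : 0 ≤ D) (hM : 0 ≤ M) (hK : 0 ≤ K) :
    (K * L * θ⁻¹ + θ⁻¹) * (G / ⌈d⁻¹⌉₊ + 8 * (G * d)) * D + G * d * M
      ≤ (9 * (K + 1) * G * D + G * M) * θ := by
  obtain ⟨_, h2, _⟩ := ceil_inv_bounds hd hd1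
  have hdθ : d ≤ θ := by
    have h3 : d ^ 2 ≤ θ ^ 2 := by rw [hθ2]; nlinarith
    exact (pow_le_pow_iff_left₀ hd.le hθ.le two_ne_zero).mp h3
  have h4 : K * L * θ⁻¹ + θ⁻¹ ≤ (K + 1) * (L * θ⁻¹) := by
    have : 0 < θ⁻¹ := inv_pos.mpr hθ
    nlinarith
  have h5 : G / ⌈d⁻¹⌉₊ + 8 * (G * d) ≤ 9 * (G * d) := by
    rw [div_eq_mul_inv]
    nlinarith [mul_le_mul_of_nonneg_left h2 hG]
  have h6 : (K + 1) * (L * θ⁻¹) * (9 * (G * d)) * D = 9 * (K + 1) * G * D * θ := by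
    have : d * L * θ⁻¹ = θ := by rw [← hθ2]; field_simp
    calc _ = 9 * (K + 1) * G * D * (d * L * θ⁻¹) := by ring
      _ = _ := by rw [this]
  calc _ ≤ (K + 1) * (L * θ⁻¹) * (9 * (G * d)) * D + G * θ * M := by gcongr
    _ = _ := by rw [h6]; ring

theorem tendsto_zero_of_tendsto_rpow_mul {d : ℕ → ℝ} (hd0 : ∀ T, 0 ≤ d T) {q : ℝ} (hq : 0 ≤ q)
    (h : Tendsto (fun T : ℕ => (T : ℝ) ^ q * d T * Real.log T) atTop (𝓝 0)) :
    Tendsto (fun T : ℕ => d T * Real.log T) atTop (𝓝 0) := by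
  refine squeeze_zero' (Eventually.of_forall fun T =>
    mul_nonneg (hd0 T) (Real.log_natCast_nonneg T)) ?_ h
  filter_upwards [eventually_ge_atTop 1] with T hT
  rw [mul_assoc]
  exact le_mul_of_one_le_left (mul_nonneg (hd0 T) (Real.log_natCast_nonneg T))
    (Real.one_le_rpow (by exact_mod_cast hT) hq)

theorem eventually_rate_le {d : ℕ → ℝ} {r q c₁ c₂ η : ℝ} (hq : 0 < q)
    (h : Tendsto (fun T : ℕ => (T : ℝ) ^ r * d T * Real.log T) atTop (𝓝 0)) (hη : 0 < η) :
    ∀ᶠ T : ℕ in atTop, c₁ * ((T : ℝ) ^ r * d T * Real.log T) ^ q + c₂ / T ≤ η := by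
  have h1 : Tendsto (fun T : ℕ => c₁ * ((T : ℝ) ^ r * d T * Real.log T) ^ q + c₂ / T) atTop
      (𝓝 (c₁ * (0 : ℝ) ^ q + 0)) :=
    ((h.rpow_const (Or.inr hq.le)).const_mul c₁).add (tendsto_const_div_atTop_nhds_zero_nat c₂)
  rw [Real.zero_rpow hq.ne', mul_zero, add_zero] at h1
  exact h1.eventually (eventually_le_nhds hη)

theorem eventually_one_le_log_natCast : ∀ᶠ T : ℕ in atTop, 1 ≤ Real.log T :=
  (Real.tendsto_log_atTop.comp tendsto_natCast_atTop_atTop).eventually_ge_atTop 1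

end Rates

section UniformRate

variable {Ω : Type*} {m0 : MeasurableSpace Ω} {P : Measure Ω}

/-- The weighted sums `∑_{t ≤ T} v_t X_{T,t}` are `O_P(√(d_T log T))` uniformly over the weights
`v` of mass at most `G`, and of supremum and total variation at most `G d_T`. Sample sizes with
`d_T = 0` are left out: there all weights vanish. -/
def IsUniformBigOP (P : Measure Ω) (d : ℕ → ℝ) (X : ℕ → ℕ → Ω → ℝ) : Prop :=
  ∀ G : ℝ, 0 ≤ G → ∀ η : ℝ, 0 < η → ∃ M : ℝ, ∀ᶠ T : ℕ in atTop, 0 < d T →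
    P {ω | ∃ v, IsLocalWeight v T G (G * d T) ∧
      M * √(d T * Real.log T) < |∑ t ∈ Finset.Icc 1 T, v t * X T t ω|} ≤ ENNReal.ofReal η

variable [IsProbabilityMeasure P] {ι : Type*} [Fintype ι] {ℱ : Filtration ℤ m0}
  {u : ℕ → ι → ℤ → Ω → ℝ} {N : ℤ → Ω → ℝ} {S δ : ℝ} {C : ℝ≥0} {d : ℕ → ℝ}

/-- A linear process with coefficients of bounded variation in time, read at times shifted by `p`,
has weighted sums of order `√(d_T log T)`. -/
theorem isUniformBigOP_linearProcess (hd0 : ∀ T, 0 ≤ d T) (hδ : 2 < δ)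
    (hd : Tendsto (fun T : ℕ => (T : ℝ) ^ (2 / δ) * d T * Real.log T) atTop (𝓝 0))
    (hu : ∀ T, IsMDFamily P ℱ (u T) N S) (hC : ∀ t, 1 ≤ t → ∫⁻ ω, ‖N t ω‖ₑ ^ δ ∂P ≤ C)
    {a : ℕ → ℕ → ℕ → ℝ} {D : ℝ} (hD : 0 ≤ D) (p : ℕ)
    (ha : ∀ᶠ T in atTop, ∃ b, IsBVCoeff (a T) (T + p) b D) (c : ι) :
    IsUniformBigOP P d fun T t =>
      linearProcess (fun j => a T j (t + p)) (u T c) ((t + p : ℕ) : ℤ) := by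
  intro G hG η hη
  have hS := (hu 0).nonneg
  set κ : ℝ := ((Fintype.card ι : ℕ) : ℝ) with hκ
  -- `K` makes Freedman's exponent at most `-3 log T`, against a union over `O(T ^ 2)` intervals;
  -- `M₁` makes the probability of large presample terms at most `η / 2`
  set K : ℝ := 2 * S + 3 with hK
  set M₁ : ℝ := D * (1 + S) / (η / 2) + 1 with hM₁
  have hM₁0 : 0 < M₁ := by positivity
  have hdL := tendsto_zero_of_tendsto_rpow_mul hd0 (by positivity) hd
  refine ⟨9 * (K + 1) * G * D + G * M₁, ?_⟩
  filter_upwards [ha, eventually_one_le_log_natCast, eventually_ge_atTop 1,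
    hdL.eventually (eventually_le_nhds zero_lt_one),
    eventually_rate_le (c₁ := (1 + κ) * ((p + 1) * C)) (c₂ := κ * (2 * (p + 2) ^ 2))
      (q := δ / 2) (by positivity) hd (half_pos hη)] with T ⟨b, hb⟩ hL hT hdL1 hrate hdT
  have hT0 : (0 : ℝ) < T := by exact_mod_cast hT
  have hT1 : (1 : ℝ) ≤ T := by exact_mod_cast hT
  set L := Real.log T with hLdef
  have hd1 : d T ≤ 1 := by nlinarith
  set θ : ℝ := √(d T * L) with hθdef
  have hdL0 : 0 < d T * L := by positivity
  have hθ : 0 < θ := Real.sqrt_pos.mpr hdL0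
  have hθ2 : θ ^ 2 = d T * L := Real.sq_sqrt hdL0.le
  obtain ⟨hl1, hl2, hl3⟩ := ceil_inv_bounds hdT hd1
  have hmain := measure_exists_weightedSum_linearProcess_gt_le (hu T) (by linarith) hC
    (s := θ⁻¹) (x := K * L * θ⁻¹) (inv_pos.mpr hθ) (by positivity) hl1 hD hb hG
    (H := G * d T) (by positivity) hM₁0 c
  have hbd := weightedSum_bound_le hdT hd1 hL hθ hθ2 hG hD hM₁0.le (K := K) (by positivity)
  refine (measure_mono ?_).trans (hmain.trans ?_)
  · rintro ω ⟨v, hv, hlt⟩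
    exact ⟨v, hv, hbd.trans_lt hlt⟩
  · have h1 : D * (1 + S) / M₁ ≤ η / 2 := div_div_add_one_le (by positivity) (half_pos hη)
    have h2 : ((T + p : ℕ) : ℝ) * (C * θ⁻¹ ^ (-δ))
        ≤ (p + 1) * C * ((T : ℝ) ^ (2 / δ) * d T * L) ^ (δ / 2) := by
      rw [Real.inv_rpow hθ.le, Real.rpow_neg hθ.le, inv_inv, mul_assoc ((T : ℝ) ^ (2 / δ)),
        ← hθ2, ← mul_rpow_eq_rpow hT0 hθ.le (by linarith)]
      have h3 : ((T + p : ℕ) : ℝ) ≤ (p + 1) * T := by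
        push_cast
        nlinarith [(Nat.cast_nonneg p : (0 : ℝ) ≤ p)]
      calc ((T + p : ℕ) : ℝ) * (C * θ ^ δ) ≤ (p + 1) * T * (C * θ ^ δ) := by gcongr
        _ = _ := by ring
    have h4 : ((T + p : ℕ) + 1 : ℝ) ^ 2 * (2 * Real.exp (-(θ⁻¹⁻¹ * (K * L * θ⁻¹))
        + θ⁻¹⁻¹ ^ 2 * (S * ⌈(d T)⁻¹⌉₊))) ≤ 2 * (p + 2) ^ 2 / T := by
      refine pow_mul_exp_le hT p 2 ?_
      rw [inv_inv, hθ2, show θ * (K * L * θ⁻¹) = K * L by field_simp]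
      have h5 : d T * L * (S * ⌈(d T)⁻¹⌉₊) ≤ S * L * 2 := by
        calc _ = S * L * (d T * ⌈(d T)⁻¹⌉₊) := by ring
          _ ≤ _ := by gcongr
      push_cast
      rw [hK]
      linarith
    rw [← ENNReal.ofReal_add (by positivity) (by positivity)]
    refine ENNReal.ofReal_le_ofReal ?_
    calc _ ≤ ((1 + κ) * ((p + 1) * C * ((T : ℝ) ^ (2 / δ) * d T * L) ^ (δ / 2))
          + κ * (2 * (p + 2) ^ 2 / T)) + η / 2 := by
          rw [mul_assoc κ]
          gcongr
      _ = ((1 + κ) * ((p + 1) * C) * ((T : ℝ) ^ (2 / δ) * d T * L) ^ (δ / 2)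
          + κ * (2 * (p + 2) ^ 2) / T) + η / 2 := by ring
      _ ≤ _ := by linarith

set_option maxHeartbeats 1000000 in
/-- Centred products of two linear processes with coefficients of bounded variation in time, at a
fixed distance `p`, have weighted sums of order `√(d_T log T)`. The bound `A` for the conditional
fourth moments may depend on the exceptional probability `η`. -/
theorem isUniformBigOP_linearProcess_mul (hd0 : ∀ T, 0 ≤ d T) (hδ : 2 < δ)
    (hd : Tendsto (fun T : ℕ => (T : ℝ) ^ (4 / δ) * d T * Real.log T) atTop (𝓝 0))
    (hu : ∀ T, IsMDFamily P ℱ (u T) N S) (hC : ∀ t, 1 ≤ t → ∫⁻ ω, ‖N t ω‖ₑ ^ δ ∂P ≤ C)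
    (h4 : ∀ η : ℝ, 0 < η → ∃ A : ℝ, 0 ≤ A ∧ P {ω | ¬ ∀ t : ℤ, 1 ≤ t →
      condLExp (ℱ (t - 1)) P (fun ω' => ‖N t ω'‖ₑ ^ 4) ω ≤ ENNReal.ofReal A} ≤ ENNReal.ofReal η)
    {a a' : ℕ → ℕ → ℕ → ℝ} {D D' : ℝ} (hD : 0 ≤ D) (hD' : 0 ≤ D') (p : ℕ)
    (ha : ∀ᶠ T in atTop, ∃ b, IsBVCoeff (a T) (T + p) b D)
    (ha' : ∀ᶠ T in atTop, ∃ b, IsBVCoeff (a' T) (T + p) b D') (c e : ι) :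
    IsUniformBigOP P d fun T t ω =>
      linearProcess (fun j => a T j t) (u T c) t ω
          * linearProcess (fun j => a' T j (t + p)) (u T e) ((t + p : ℕ) : ℤ) ω
        - ∫ ω', linearProcess (fun j => a T j t) (u T c) t ω'
          * linearProcess (fun j => a' T j (t + p)) (u T e) ((t + p : ℕ) : ℤ) ω' ∂P := by
  intro G hG η hη
  have hS := (hu 0).nonneg
  obtain ⟨A, hA, hPA⟩ := h4 (η / 3) (by positivity)
  set κ : ℝ := ((Fintype.card ι : ℕ) : ℝ) with hκ
  -- `K` makes Freedman's exponent at most `-3 log T` for products at equal times and `-4 log T`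
  -- for products at different times, where the union is over `O(T ^ 3)` pairs of intervals
  set K : ℝ := 2 * A + 4 * S ^ 2 + 10 with hK
  set M₁ : ℝ := 8 * (D * D') * S / (η / 3) + 1 with hM₁
  have hM₁0 : 0 < M₁ := by positivity
  have hdL := tendsto_zero_of_tendsto_rpow_mul hd0 (by positivity) hd
  have hε : 0 < (2 * (S + 1))⁻¹ ^ 2 := by positivity
  refine ⟨9 * (K + 1) * G * (2 * (D * D')) + G * M₁, ?_⟩
  filter_upwards [ha, ha', eventually_one_le_log_natCast, eventually_ge_atTop 1,
    hdL.eventually (eventually_le_nhds zero_lt_one), hdL.eventually (eventually_le_nhds hε),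
    eventually_rate_le (c₁ := (1 + κ + κ ^ 2) * ((p + 1) * C))
      (c₂ := κ ^ 2 * (2 * (p + 2) ^ 2) + κ ^ 2 * (2 * (p + 2) ^ 3))
      (q := δ / 2 / 2) (by positivity) hd (show 0 < η / 3 by positivity)]
    with T ⟨b, hb⟩ ⟨b', hb'⟩ hL hT hdL1 hdL2 hrate hdT
  have hT0 : (0 : ℝ) < T := by exact_mod_cast hT
  have hT1 : (1 : ℝ) ≤ T := by exact_mod_cast hT
  set L := Real.log T with hLdef
  have hd1 : d T ≤ 1 := by nlinarith
  set θ : ℝ := √(d T * L) with hθdef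
  have hdL0 : 0 < d T * L := by positivity
  have hθ : 0 < θ := Real.sqrt_pos.mpr hdL0
  have hθ2 : θ ^ 2 = d T * L := Real.sq_sqrt hdL0.le
  have hθS : θ * S ≤ 1 / 2 := by
    have h1 : θ ≤ (2 * (S + 1))⁻¹ := by
      rw [← hθ2] at hdL2
      exact (pow_le_pow_iff_left₀ hθ.le (by positivity) two_ne_zero).mp hdL2
    calc θ * S ≤ (2 * (S + 1))⁻¹ * (S + 1) := by gcongr; linarith
      _ = 1 / 2 := by field_simp
  obtain ⟨hl1, hl2, hl3⟩ := ceil_inv_bounds hdT hd1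
  -- the truncation level `s` satisfies `s ^ 2 = θ⁻¹`
  set s : ℝ := (√θ)⁻¹ with hs
  have hsθ : s ^ 2 = θ⁻¹ := by rw [hs, inv_pow, Real.sq_sqrt hθ.le]
  have hs0 : 0 < s := inv_pos.mpr (Real.sqrt_pos.mpr hθ)
  have hmain := measure_exists_weightedSum_linearProcess_mul_gt_le (hu T) hδ.le hC
    (s := s) (x := K * L * θ⁻¹) hs0 (by positivity) hA hl1 hD hD' hb hb' hG
    (H := G * d T) (by positivity) hM₁0 c e
  have hbd := weightedSum_bound_le hdT hd1 hL hθ hθ2 hG (show 0 ≤ 2 * (D * D') by positivity)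
    hM₁0.le (K := K) (by positivity)
  simp only [hsθ] at hmain
  refine (measure_mono ?_).trans (hmain.trans ?_)
  · rintro ω ⟨v, hv, hlt⟩
    exact ⟨v, hv, hbd.trans_lt hlt⟩
  · have h1 : 8 * (D * D') * S / M₁ ≤ η / 3 :=
      div_div_add_one_le (by positivity) (by positivity)
    have h2 : ((T + p : ℕ) : ℝ) * (C * s ^ (-δ))
        ≤ (p + 1) * C * ((T : ℝ) ^ (4 / δ) * d T * L) ^ (δ / 2 / 2) := by
      have hsd : s ^ (-δ) = θ ^ (δ / 2) := by
        rw [hs, Real.inv_rpow (Real.sqrt_nonneg _), Real.rpow_neg (Real.sqrt_nonneg _), inv_inv,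
          Real.sqrt_eq_rpow, ← Real.rpow_mul hθ.le]
        congr 1
        ring
      rw [hsd, mul_assoc ((T : ℝ) ^ (4 / δ)), ← hθ2,
        show 4 / δ = 2 / (δ / 2) by field_simp; norm_num, ← mul_rpow_eq_rpow hT0 hθ.le (by linarith)]
      have h3 : ((T + p : ℕ) : ℝ) ≤ (p + 1) * T := by
        push_cast
        nlinarith [(Nat.cast_nonneg p : (0 : ℝ) ≤ p)]
      calc ((T + p : ℕ) : ℝ) * (C * θ ^ (δ / 2)) ≤ (p + 1) * T * (C * θ ^ (δ / 2)) := by gcongr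
        _ = _ := by ring
    have hexp : θ * (K * L * θ⁻¹) = K * L := by field_simp
    have h3 : ((T + p : ℕ) + 1 : ℝ) ^ 2 * (2 * Real.exp (-(θ⁻¹⁻¹ * (K * L * θ⁻¹))
        + θ⁻¹⁻¹ ^ 2 * (A * ⌈(d T)⁻¹⌉₊))) ≤ 2 * (p + 2) ^ 2 / T := by
      refine pow_mul_exp_le hT p 2 ?_
      rw [inv_inv, hθ2, hexp]
      have h5 : d T * L * (A * ⌈(d T)⁻¹⌉₊) ≤ A * L * 2 := by
        calc _ = A * L * (d T * ⌈(d T)⁻¹⌉₊) := by ring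
          _ ≤ _ := by gcongr
      push_cast
      rw [hK]
      nlinarith [mul_nonneg (sq_nonneg S) (zero_le_one.trans hL)]
    have h6 : ((T + p : ℕ) + 1 : ℝ) ^ 3 * (2 * Real.exp (-(θ⁻¹⁻¹ * (K * L * θ⁻¹))
        + θ⁻¹⁻¹ ^ 2 * (S * (S * ⌈(d T)⁻¹⌉₊ + (K * L * θ⁻¹ + θ⁻¹)))))
        ≤ 2 * (p + 2) ^ 3 / T := by
      refine pow_mul_exp_le hT p 3 ?_
      rw [inv_inv, hexp]
      have h7 : θ ^ 2 * (S * (S * ⌈(d T)⁻¹⌉₊ + (K * L * θ⁻¹ + θ⁻¹)))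
          ≤ S ^ 2 * L * 2 + 1 / 2 * (K * L + 1) := by
        calc _ = S ^ 2 * L * (d T * ⌈(d T)⁻¹⌉₊) + θ * S * (K * L + 1) := by
              have : θ ^ 2 * (S * (S * ⌈(d T)⁻¹⌉₊ + (K * L * θ⁻¹ + θ⁻¹)))
                  = S ^ 2 * ⌈(d T)⁻¹⌉₊ * θ ^ 2 + θ * (θ * θ⁻¹) * S * (K * L + 1) := by ring
              rw [this, hθ2, mul_inv_cancel₀ hθ.ne']
              ring
          _ ≤ _ := by gcongr
      push_cast
      rw [hK] at h7 ⊢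
      nlinarith [mul_nonneg hA (zero_le_one.trans hL)]
    have hb0 : 0 ≤ C * s ^ (-δ) := by positivity
    refine (add_le_add (add_le_add hPA le_rfl) le_rfl).trans ?_
    rw [← ENNReal.ofReal_add (by positivity) (by positivity),
      ← ENNReal.ofReal_add (by positivity) (by positivity)]
    refine ENNReal.ofReal_le_ofReal ?_
    calc _ ≤ η / 3 + ((1 + κ + κ ^ 2)
            * ((p + 1) * C * ((T : ℝ) ^ (4 / δ) * d T * L) ^ (δ / 2 / 2))
          + κ ^ 2 * (2 * (p + 2) ^ 2 / T) + κ ^ 2 * (2 * (p + 2) ^ 3 / T)) + η / 3 := by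
          rw [mul_assoc (κ ^ 2), mul_assoc (κ ^ 2)]
          gcongr
      _ = η / 3 + ((1 + κ + κ ^ 2) * ((p + 1) * C)
            * ((T : ℝ) ^ (4 / δ) * d T * L) ^ (δ / 2 / 2)
          + (κ ^ 2 * (2 * (p + 2) ^ 2) + κ ^ 2 * (2 * (p + 2) ^ 3)) / T) + η / 3 := by ring
      _ ≤ _ := by linarith

end UniformRate

/-! ### Calculus of uniform rates -/

section UniformCalculus

variable {Ω : Type*} {m0 : MeasurableSpace Ω} {P : Measure Ω} {d : ℕ → ℝ}

theorem IsLocalWeight.mono {v : ℕ → ℝ} {T : ℕ} {G G' H H' : ℝ} (hv : IsLocalWeight v T G H)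
    (hG : G ≤ G') (hH : H ≤ H') : IsLocalWeight v T G' H' where
  toIsBVBdd := hv.toIsBVBdd.mono hH
  mass := hv.mass.trans hG

theorem IsUniformBigOP.zero : IsUniformBigOP P d fun _ _ _ => 0 := fun G _ η _ =>
  ⟨0, Eventually.of_forall fun T _ => by simp⟩

theorem IsUniformBigOP.add {X Y : ℕ → ℕ → Ω → ℝ} (hX : IsUniformBigOP P d X)
    (hY : IsUniformBigOP P d Y) : IsUniformBigOP P d fun T t ω => X T t ω + Y T t ω := by
  intro G hG η hη
  obtain ⟨M₁, h₁⟩ := hX G hG (η / 2) (half_pos hη)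
  obtain ⟨M₂, h₂⟩ := hY G hG (η / 2) (half_pos hη)
  refine ⟨M₁ + M₂, ?_⟩
  filter_upwards [h₁, h₂] with T h₁ h₂ hd
  rw [← add_halves η, ENNReal.ofReal_add (half_pos hη).le (half_pos hη).le]
  refine (measure_mono ?_).trans ((measure_union_le _ _).trans (add_le_add (h₁ hd) (h₂ hd)))
  rintro ω ⟨v, hv, hlt⟩
  simp only [mul_add, Finset.sum_add_distrib] at hlt
  rw [add_mul] at hlt
  rcases lt_or_ge (M₁ * √(d T * Real.log T)) |∑ t ∈ Finset.Icc 1 T, v t * X T t ω| with h | h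
  · exact Or.inl ⟨v, hv, h⟩
  · refine Or.inr ⟨v, hv, ?_⟩
    linarith [abs_add_le (∑ t ∈ Finset.Icc 1 T, v t * X T t ω)
      (∑ t ∈ Finset.Icc 1 T, v t * Y T t ω)]

theorem IsUniformBigOP.sum {κ : Type*} (s : Finset κ) {X : κ → ℕ → ℕ → Ω → ℝ}
    (hX : ∀ k, IsUniformBigOP P d (X k)) :
    IsUniformBigOP P d fun T t ω => ∑ k ∈ s, X k T t ω := by
  classical
  induction s using Finset.induction_on with
  | empty => simpa using IsUniformBigOP.zero
  | insert k s hk ih =>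
    simp only [Finset.sum_insert hk]
    exact (hX k).add ih

theorem IsUniformBigOP.congr {X Y : ℕ → ℕ → Ω → ℝ} (hX : IsUniformBigOP P d X)
    (h : ∀ T t, 1 ≤ T → 1 ≤ t → X T t =ᵐ[P] Y T t) : IsUniformBigOP P d Y := by
  intro G hG η hη
  obtain ⟨M, hM⟩ := hX G hG η hη
  refine ⟨M, ?_⟩
  filter_upwards [hM, eventually_ge_atTop 1] with T hM hT hd
  refine (measure_mono_ae ?_).trans (hM hd)
  have h' : ∀ᵐ ω ∂P, ∀ t, 1 ≤ t → X T t ω = Y T t ω := by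
    rw [ae_all_iff]
    intro t
    by_cases ht : 1 ≤ t
    · filter_upwards [h T t hT ht] with ω hω _ using hω
    · exact ae_of_all _ fun ω h => absurd h ht
  filter_upwards [h'] with ω hω
  rintro ⟨v, hv, hlt⟩
  refine ⟨v, hv, hlt.trans_eq ?_⟩
  congr 1
  exact Finset.sum_congr rfl fun t ht => by rw [hω t (Finset.mem_Icc.mp ht).1]

/-- A factor that is bounded and of bounded variation is absorbed into the weights. -/
theorem IsUniformBigOP.mul_of_isBVBdd {X : ℕ → ℕ → Ω → ℝ} (hX : IsUniformBigOP P d X)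
    (hd0 : ∀ T, 0 ≤ d T) {f : ℕ → ℕ → ℝ} {D : ℝ} (hD : 0 ≤ D)
    (hf : ∀ᶠ T in atTop, IsBVBdd (f T) T D) :
    IsUniformBigOP P d fun T t ω => f T t * X T t ω := by
  intro G hG η hη
  obtain ⟨M, hM⟩ := hX (2 * G * D) (by positivity) η hη
  refine ⟨M, ?_⟩
  filter_upwards [hM, hf] with T hM hf hd
  refine (measure_mono ?_).trans (hM hd)
  rintro ω ⟨v, hv, hlt⟩
  have hGd : 0 ≤ G * d T := mul_nonneg hG (hd0 T)
  refine ⟨fun t => v t * f T t, (hv.mul hGd hD hf).mono ?_ (le_of_eq (by ring)), ?_⟩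
  · nlinarith [mul_nonneg hG hD]
  · simpa only [mul_assoc] using hlt

end UniformCalculus

/-! ### Frobenius norms and matrix weights -/

section Weights

theorem sqrt_sum_sq_le_sum_abs {κ : Type*} [Fintype κ] (f : κ → ℝ) :
    √(∑ k, f k ^ 2) ≤ ∑ k, |f k| := by
  refine Real.sqrt_le_iff.mpr ⟨Finset.sum_nonneg fun _ _ => abs_nonneg _, ?_⟩
  simpa only [sq_abs] using
    Finset.sum_sq_le_sq_sum_of_nonneg (s := Finset.univ) (f := fun k => |f k|)
      fun _ _ => abs_nonneg _

theorem frobenius_norm_eq_sqrt {m n : ℕ} (A : Matrix (Fin m) (Fin n) ℝ) :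
    ‖A‖ = √(∑ i, ∑ j, A i j ^ 2) := by
  rw [Matrix.frobenius_norm_def, Real.sqrt_eq_rpow]
  congr 1
  refine Finset.sum_congr rfl fun i _ => Finset.sum_congr rfl fun j _ => ?_
  rw [show (2 : ℝ) = ((2 : ℕ) : ℝ) by norm_num, Real.rpow_natCast, Real.norm_eq_abs, sq_abs]

theorem abs_entry_le_frobenius_norm {m n : ℕ} (A : Matrix (Fin m) (Fin n) ℝ) (i : Fin m)
    (j : Fin n) : |A i j| ≤ ‖A‖ := by
  rw [frobenius_norm_eq_sqrt, ← Real.sqrt_sq_eq_abs]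
  refine Real.sqrt_le_sqrt ?_
  exact (Finset.single_le_sum (f := fun j => A i j ^ 2) (fun _ _ => sq_nonneg _)
    (Finset.mem_univ j)).trans (Finset.single_le_sum (f := fun i => ∑ j, A i j ^ 2)
      (fun _ _ => Finset.sum_nonneg fun _ _ => sq_nonneg _) (Finset.mem_univ i))

theorem frobenius_norm_le_sum_abs {m n : ℕ} (A : Matrix (Fin m) (Fin n) ℝ) :
    ‖A‖ ≤ ∑ i, ∑ j, |A i j| := by
  rw [frobenius_norm_eq_sqrt, ← Fintype.sum_prod_type', ← Fintype.sum_prod_type']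
  exact sqrt_sum_sq_le_sum_abs fun k : Fin m × Fin n => A k.1 k.2

theorem euclidean_norm_le_sum_abs {n : ℕ} (x : EuclideanSpace ℝ (Fin n)) :
    ‖x‖ ≤ ∑ i, |x i| := by
  rw [EuclideanSpace.norm_eq]
  simpa only [Real.norm_eq_abs, sq_abs] using sqrt_sum_sq_le_sum_abs fun i => x i

variable {m d : ℕ} {a b : ℝ} {W : ℕ → ℕ → ℝ → Matrix (Fin m) (Fin d) ℝ}

theorem weightSup_nonneg (a b : ℝ) (W : ℕ → ℕ → ℝ → Matrix (Fin m) (Fin d) ℝ) (T : ℕ) :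
    0 ≤ weightSup a b W T := Real.iSup_nonneg fun _ => norm_nonneg _

theorem IsWeight.exists_norm_le (hW : IsWeight a b W) {T t : ℕ} (h1 : 1 ≤ t) (h2 : t ≤ T) :
    ∃ C, ∀ τ ∈ Icc a b, ‖W T t τ‖ ≤ C := by
  have h : ∀ (i : Fin m) (k : Fin d), ∃ C, ∀ τ ∈ Icc a b, |W T t τ i k| ≤ C := fun i k => by
    obtain ⟨K, hK⟩ := hW.lipschitz T t h1 h2 i k
    obtain ⟨C, hC⟩ := isCompact_Icc.exists_bound_of_continuousOn hK.continuousOn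
    exact ⟨C, hC⟩
  choose C hC using h
  exact ⟨∑ i, ∑ k, C i k, fun τ hτ => (frobenius_norm_le_sum_abs _).trans
    (Finset.sum_le_sum fun i _ => Finset.sum_le_sum fun k _ => hC i k τ hτ)⟩

theorem IsWeight.norm_le_weightSup (hW : IsWeight a b W) {T t : ℕ} (h1 : 1 ≤ t) (h2 : t ≤ T)
    {τ : ℝ} (hτ : τ ∈ Icc a b) : ‖W T t τ‖ ≤ weightSup a b W T := by
  have h : ∀ s : Finset.Icc 1 T, ∃ C, ∀ τ ∈ Icc a b, ‖W T s τ‖ ≤ C := fun s =>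
    hW.exists_norm_le (Finset.mem_Icc.mp s.2).1 (Finset.mem_Icc.mp s.2).2
  choose C hC using h
  have hbdd : BddAbove (range fun q : Icc a b × Finset.Icc 1 T => ‖W T q.2 q.1‖) := by
    refine ⟨∑ s, |C s|, ?_⟩
    rintro _ ⟨q, rfl⟩
    exact (hC q.2 q.1 q.1.2).trans ((le_abs_self _).trans
      (Finset.single_le_sum (f := fun s => |C s|) (fun _ _ => abs_nonneg _)
        (Finset.mem_univ q.2)))
  exact le_ciSup hbdd (⟨τ, hτ⟩, ⟨t, Finset.mem_Icc.mpr ⟨h1, h2⟩⟩)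

/-- Every entry of the matrix weights is an admissible scalar weight, with one constant `G`. -/
theorem IsWeight.exists_isLocalWeight (hW : IsWeight a b W) :
    ∃ G : ℝ, 0 ≤ G ∧ ∀ᶠ T in atTop, ∀ τ ∈ Icc a b, ∀ i k,
      IsLocalWeight (fun t => W T t τ i k) T G (G * weightSup a b W T) := by
  obtain ⟨c₁, h₁⟩ := hW.sum_bdd.bound
  obtain ⟨c₂, h₂⟩ := hW.var_bdd.bound
  refine ⟨max 1 (max c₁ c₂), zero_le_one.trans (le_max_left _ _), ?_⟩
  filter_upwards [h₁, h₂] with T h₁ h₂ τ hτ i k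
  have hd0 := weightSup_nonneg a b W T
  have hb : ∀ t, 1 ≤ t → t ≤ T → ∀ {τ}, τ ∈ Icc a b → ‖W T t τ‖ ≤ weightSup a b W T :=
    fun t h1 h2 _ hτ => hW.norm_le_weightSup h1 h2 hτ
  refine ⟨⟨fun t h1 h2 => ?_, ?_⟩, ?_⟩
  · refine ((abs_entry_le_frobenius_norm _ i k).trans (hb t h1 h2 hτ)).trans ?_
    exact le_mul_of_one_le_left hd0 (le_max_left _ _)
  · have hbdd : BddAbove (range fun τ : Icc a b =>
        ∑ t ∈ Finset.Ico 1 T, ‖W T (t + 1) τ - W T t τ‖) := by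
      refine ⟨∑ t ∈ Finset.Ico 1 T, (weightSup a b W T + weightSup a b W T), ?_⟩
      rintro _ ⟨τ, rfl⟩
      refine Finset.sum_le_sum fun t ht => ?_
      rw [Finset.mem_Ico] at ht
      exact (norm_sub_le _ _).trans (add_le_add (hb _ (by omega) (by omega) τ.2)
        (hb _ (by omega) (by omega) τ.2))
    calc ∑ t ∈ Finset.Ico 1 T, |W T (t + 1) τ i k - W T t τ i k|
        ≤ ∑ t ∈ Finset.Ico 1 T, ‖W T (t + 1) τ - W T t τ‖ :=
          Finset.sum_le_sum fun t _ =>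
            abs_entry_le_frobenius_norm (W T (t + 1) τ - W T t τ) i k
      _ ≤ ⨆ τ : Icc a b, ∑ t ∈ Finset.Ico 1 T, ‖W T (t + 1) τ - W T t τ‖ :=
          le_ciSup hbdd ⟨τ, hτ⟩
      _ ≤ c₂ * weightSup a b W T := by
          rw [Real.norm_eq_abs, Real.norm_eq_abs, abs_of_nonneg hd0] at h₂
          exact (le_abs_self _).trans h₂
      _ ≤ _ := by
          gcongr
          exact (le_max_right _ _).trans (le_max_right _ _)
  · have hbdd : BddAbove (range fun τ : Icc a b => ∑ t ∈ Finset.Icc 1 T, ‖W T t τ‖) := by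
      refine ⟨∑ t ∈ Finset.Icc 1 T, weightSup a b W T, ?_⟩
      rintro _ ⟨τ, rfl⟩
      refine Finset.sum_le_sum fun t ht => ?_
      rw [Finset.mem_Icc] at ht
      exact hb _ ht.1 ht.2 τ.2
    calc ∑ t ∈ Finset.Icc 1 T, |W T t τ i k|
        ≤ ∑ t ∈ Finset.Icc 1 T, ‖W T t τ‖ :=
          Finset.sum_le_sum fun t _ => abs_entry_le_frobenius_norm _ i k
      _ ≤ ⨆ τ : Icc a b, ∑ t ∈ Finset.Icc 1 T, ‖W T t τ‖ := le_ciSup hbdd ⟨τ, hτ⟩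
      _ ≤ c₁ := by
          rw [Real.norm_eq_abs, norm_one, mul_one] at h₁
          exact (le_abs_self _).trans h₁
      _ ≤ _ := (le_max_left _ _).trans (le_max_right _ _)

variable {Ω : Type*} {m0 : MeasurableSpace Ω} {P : Measure Ω}

/-- A supremum over `τ` is of order `√(d_T log T)` when it is dominated by finitely many scalar
weighted sums. -/
theorem IsWeight.isBigOP_iSup (hab : a ≤ b) (hW : IsWeight a b W) {J : Type*} [Fintype J]
    (row : J → Fin m) (col : J → Fin d) {X : J → ℕ → ℕ → Ω → ℝ}
    (hX : ∀ j, IsUniformBigOP P (weightSup a b W) (X j)) {F : ℕ → ℝ → Ω → ℝ}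
    (hF0 : ∀ T τ ω, 0 ≤ F T τ ω)
    (hF : ∀ T τ ω, F T τ ω
      ≤ ∑ j, |∑ t ∈ Finset.Icc 1 T, W T t τ (row j) (col j) * X j T t ω|) :
    IsBigOP P (fun T ω => ⨆ τ : Icc a b, F T τ ω)
      fun T => √(weightSup a b W T * Real.log T) := by
  intro η hη
  obtain ⟨G, hG, hGW⟩ := hW.exists_isLocalWeight
  have : Nonempty (Icc a b) := ⟨⟨a, left_mem_Icc.mpr hab⟩⟩
  set η' : ℝ := η / (Fintype.card J + 1) with hη'
  have hη'0 : 0 < η' := by positivity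
  choose M hM using fun j => hX j G hG η' hη'0
  refine ⟨∑ j, M j, ?_⟩
  filter_upwards [eventually_all.mpr hM, hGW] with T hM hGW
  set r := √(weightSup a b W T * Real.log T) with hr
  rcases (weightSup_nonneg a b W T).eq_or_lt with hd | hd
  · -- all weights vanish
    have hsup : ∀ ω, ⨆ τ : Icc a b, F T τ ω = 0 := fun ω => by
      have h0 : ∀ τ : Icc a b, F T τ ω = 0 := fun τ => by
        refine le_antisymm ((hF T τ ω).trans (le_of_eq ?_)) (hF0 _ _ _)
        refine Finset.sum_eq_zero fun j _ => ?_
        rw [abs_eq_zero]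
        refine Finset.sum_eq_zero fun t ht => ?_
        rw [Finset.mem_Icc] at ht
        have h1 := (hGW τ τ.2 (row j) (col j)).sup t ht.1 ht.2
        rw [← hd, mul_zero] at h1
        rw [abs_nonpos_iff.mp h1, zero_mul]
      simp [h0]
    have hr0 : r = 0 := by rw [hr, ← hd, zero_mul, Real.sqrt_zero]
    simp [hsup, hr0]
  · have hsub : {ω | (∑ j, M j) * r < |⨆ τ : Icc a b, F T τ ω|}
        ⊆ ⋃ j, {ω | ∃ v, IsLocalWeight v T G (G * weightSup a b W T) ∧
          M j * r < |∑ t ∈ Finset.Icc 1 T, v t * X j T t ω|} := by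
      intro ω hω
      by_contra hcon
      simp only [mem_iUnion, mem_ofPred_eq, not_exists, not_and, not_lt] at hcon
      refine (lt_irrefl ((∑ j, M j) * r)) (lt_of_lt_of_le hω ?_)
      rw [abs_of_nonneg (Real.iSup_nonneg fun _ => hF0 _ _ _)]
      refine ciSup_le fun τ => (hF T τ ω).trans ?_
      rw [Finset.sum_mul]
      exact Finset.sum_le_sum fun j _ => hcon j _ (hGW τ τ.2 (row j) (col j))
    refine (measure_mono hsub).trans ((measure_iUnion_le_card_mul _ fun j => hM j hd).trans ?_)
    refine ENNReal.ofReal_le_ofReal ?_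
    rw [hη', mul_div_assoc', div_le_iff₀ (by positivity)]
    nlinarith

end Weights

/-! ### Linear combinations of the innovations -/

section Innovations

variable {Ω : Type*} [MeasurableSpace Ω] {P : Measure Ω} {d : ℕ}
  {ε : ℤ → Ω → EuclideanSpace ℝ (Fin d)} {hε : ∀ t, StronglyMeasurable (ε t)} {δ : ℝ}

theorem lintegral_enorm_const_mul_rpow_le {f : Ω → ℝ} {κ : ℝ≥0} {C : ℝ≥0} (hδ : 0 ≤ δ)
    (hC : ∫⁻ ω, ‖f ω‖ₑ ^ δ ∂P ≤ C) :
    ∫⁻ ω, ‖(κ : ℝ) * f ω‖ₑ ^ δ ∂P ≤ (κ ^ δ * C : ℝ≥0) := by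
  have h1 : ∀ ω, ‖(κ : ℝ) * f ω‖ₑ ^ δ = ((κ ^ δ : ℝ≥0) : ℝ≥0∞) * ‖f ω‖ₑ ^ δ := fun ω => by
    rw [enorm_mul, ENNReal.mul_rpow_of_nonneg _ _ hδ, ENNReal.coe_rpow_of_nonneg _ hδ]
    congr 2
    simp [enorm_eq_nnnorm]
  simp only [h1]
  rw [lintegral_const_mul' _ _ ENNReal.coe_ne_top, ENNReal.coe_mul]
  gcongr

theorem abs_coord_le_norm (x : EuclideanSpace ℝ (Fin d)) (i : Fin d) : |x i| ≤ ‖x‖ := by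
  simpa using PiLp.norm_apply_le x i

theorem condExp_sum_mul {κ : Type*} [Fintype κ] {m : MeasurableSpace Ω} (w : κ → ℝ)
    {f : κ → Ω → ℝ} {σ : κ → ℝ} (hf : ∀ k, Integrable (f k) P)
    (hσ : ∀ k, P[f k | m] =ᵐ[P] fun _ => σ k) :
    P[fun ω => ∑ k, w k * f k ω | m] =ᵐ[P] fun _ => ∑ k, w k * σ k := by
  have e : (fun ω => ∑ k, w k * f k ω) = ∑ k, w k • f k := by
    funext ω
    simp [Finset.sum_apply]
  have h1 := condExp_finsetSum (μ := P) (s := Finset.univ) (f := fun k => w k • f k)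
    (fun k _ => (hf k).smul (w k)) m
  have h2 : ∀ᵐ ω ∂P, ∀ k, (P[w k • f k | m]) ω = w k * σ k := by
    rw [ae_all_iff]
    intro k
    filter_upwards [condExp_smul (μ := P) (w k) (f k) m, hσ k] with ω h1 h2
    rw [h1, Pi.smul_apply, h2, smul_eq_mul]
  rw [e]
  filter_upwards [h1, h2] with ω h1 h2
  rw [h1, Finset.sum_apply]
  exact Finset.sum_congr rfl fun k _ => h2 k

namespace IsInnovation

theorem condExp_coord (h : IsInnovation P ε hε δ) (t : ℤ) (i : Fin d) :
    P[fun ω => ε t ω i | innovFiltration ε hε (t - 1)] =ᵐ[P] fun _ => 0 := by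
  have h1 := ContinuousLinearMap.comp_condExp_comm (m := innovFiltration ε hε (t - 1))
    (h.integrable t) (EuclideanSpace.proj i : EuclideanSpace ℝ (Fin d) →L[ℝ] ℝ)
  filter_upwards [h1, h.mds t] with ω h1 h2
  have h3 : (P[fun ω => ε t ω i | innovFiltration ε hε (t - 1)]) ω
      = ((EuclideanSpace.proj i : EuclideanSpace ℝ (Fin d) →L[ℝ] ℝ)
        ∘ P[ε t | innovFiltration ε hε (t - 1)]) ω := h1.symm
  rw [h3, Function.comp_apply, h2]
  simp

theorem stronglyMeasurable_coord (hε : ∀ t, StronglyMeasurable (ε t)) (t : ℤ) (i : Fin d) :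
    StronglyMeasurable[innovFiltration ε hε t] fun ω => ε t ω i :=
  (EuclideanSpace.proj i : EuclideanSpace ℝ (Fin d) →L[ℝ] ℝ).continuous.comp_stronglyMeasurable
    (Filtration.stronglyAdapted_natural hε t)

variable [IsProbabilityMeasure P]

/-- The conditional expectation of a non-integrable function would be `0`, not `1`. -/
theorem integrable_sq (h : IsInnovation P ε hε δ) (t : ℤ) (i : Fin d) :
    Integrable (fun ω => ε t ω i * ε t ω i) P := by
  by_contra hni
  have h1 := h.condCov t i i
  rw [condExp_of_not_integrable hni] at h1
  obtain ⟨ω, hω⟩ := h1.exists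
  simp at hω

theorem memLp_coord (h : IsInnovation P ε hε δ) (t : ℤ) (i : Fin d) :
    MemLp (fun ω => ε t ω i) 2 P := by
  rw [memLp_two_iff_integrable_sq ((stronglyMeasurable_coord hε t i).mono
    ((innovFiltration ε hε).le t)).aestronglyMeasurable]
  simpa only [sq] using h.integrable_sq t i

theorem integral_sq (h : IsInnovation P ε hε δ) (t : ℤ) (i : Fin d) :
    ∫ ω, ε t ω i * ε t ω i ∂P = 1 := by
  rw [← integral_condExp ((innovFiltration ε hε).le (t - 1)), integral_congr_ae (h.condCov t i i)]
  simp

theorem integrable_norm_sq (h : IsInnovation P ε hε δ) (t : ℤ) :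
    Integrable (fun ω => ‖ε t ω‖ ^ 2) P := by
  simp only [EuclideanSpace.real_norm_sq_eq]
  simp only [sq]
  exact integrable_finsetSum _ fun i _ => h.integrable_sq t i

theorem integral_norm_sq (h : IsInnovation P ε hε δ) (t : ℤ) :
    ∫ ω, ‖ε t ω‖ ^ 2 ∂P = d := by
  simp only [EuclideanSpace.real_norm_sq_eq]
  simp only [sq]
  rw [integral_finsetSum _ fun i _ => h.integrable_sq t i]
  simp [h.integral_sq]

/-- Bounded deterministic linear combinations of the coordinates of the innovations form a family
of martingale differences. -/
theorem isMDFamily (h : IsInnovation P ε hε δ) {ι : Type*} (w : ι → ℤ → Fin d → ℝ) {κ : ℝ}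
    (hκ : 0 ≤ κ) (hw : ∀ c t, ∑ k, |w c t k| ≤ κ) :
    IsMDFamily P (innovFiltration ε hε) (fun c t ω => ∑ k, w c t k * ε t ω k)
      (fun t ω => κ * ‖ε t ω‖) (κ ^ 2 * d) where
  adapted c t := Finset.stronglyMeasurable_fun_sum _ fun k _ =>
    (stronglyMeasurable_coord hε t k).const_mul _
  adapted_env t := (Filtration.stronglyAdapted_natural hε t).norm.const_mul κ
  abs_le c t ω := by
    refine (Finset.abs_sum_le_sum_abs _ _).trans ?_
    calc ∑ k, |w c t k * ε t ω k| ≤ ∑ k, |w c t k| * ‖ε t ω‖ := by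
          refine Finset.sum_le_sum fun k _ => ?_
          rw [abs_mul]
          exact mul_le_mul_of_nonneg_left (abs_coord_le_norm _ k) (abs_nonneg _)
      _ ≤ κ * ‖ε t ω‖ := by
          rw [← Finset.sum_mul]
          exact mul_le_mul_of_nonneg_right (hw c t) (norm_nonneg _)
  env_nonneg t ω := mul_nonneg hκ (norm_nonneg _)
  integrable_env_sq t := by
    simp only [mul_pow]
    exact (h.integrable_norm_sq t).const_mul _
  integral_env_sq_le t := by
    simp only [mul_pow]
    rw [integral_const_mul, h.integral_norm_sq]
  condExp_eq_zero c t := by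
    simpa using condExp_sum_mul (w c t)
      (fun k => (h.memLp_coord t k).integrable (by norm_num)) (h.condExp_coord t)
  condExp_mul c e t := by
    have h1 := condExp_sum_mul (P := P) (κ := Fin d × Fin d)
      (m := innovFiltration ε hε (t - 1)) (fun k => w c t k.1 * w e t k.2)
      (f := fun k ω => ε t ω k.1 * ε t ω k.2)
      (σ := fun k => (1 : Matrix (Fin d) (Fin d) ℝ) k.1 k.2)
      (fun k => (h.memLp_coord t k.1).integrable_mul (h.memLp_coord t k.2))
      (fun k => h.condCov t k.1 k.2)
    have e1 : (fun ω => ∑ k : Fin d × Fin d, w c t k.1 * w e t k.2 * (ε t ω k.1 * ε t ω k.2))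
        = fun ω => (∑ k, w c t k * ε t ω k) * ∑ k, w e t k * ε t ω k := by
      funext ω
      rw [Finset.sum_mul_sum, ← Fintype.sum_prod_type']
      exact Finset.sum_congr rfl fun k _ => by ring
    rw [e1] at h1
    have h2 : ∫ ω, (∑ k, w c t k * ε t ω k) * ∑ k, w e t k * ε t ω k ∂P
        = ∑ k : Fin d × Fin d, w c t k.1 * w e t k.2
          * (1 : Matrix (Fin d) (Fin d) ℝ) k.1 k.2 := by
      rw [← integral_condExp ((innovFiltration ε hε).le (t - 1)), integral_congr_ae h1]
      simp
    rw [h2]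
    exact h1

end IsInnovation

variable [IsProbabilityMeasure P]

/-- The almost surely finite random bound on the conditional fourth moments is replaced by a
deterministic one on an event of probability close to `1`. -/
theorem exists_condLExp_bound (h4 : BddCondFourthMoment P ε hε) (κ : ℝ≥0) {η : ℝ} (hη : 0 < η) :
    ∃ A : ℝ, 0 ≤ A ∧ P {ω | ¬ ∀ t : ℤ, 1 ≤ t →
      condLExp (innovFiltration ε hε (t - 1)) P (fun ω' => ‖(κ : ℝ) * ‖ε t ω'‖‖ₑ ^ 4) ω
        ≤ ENNReal.ofReal A} ≤ ENNReal.ofReal η := by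
  set g : Ω → ℝ≥0∞ := fun ω => ⨆ (t : ℤ) (_ : 1 ≤ t),
    condLExp (innovFiltration ε hε (t - 1)) P (fun ω' => ‖ε t ω'‖ₑ ^ 4) ω with hg
  have hgm : Measurable g := by
    refine Measurable.iSup fun t => Measurable.iSup fun _ => ?_
    exact measurable_condLExp' _ _ _
  have hlim : Tendsto (fun n : ℕ => P {ω | (n : ℝ≥0∞) < g ω}) atTop (𝓝 0) := by
    have h1 := tendsto_measure_iInter_atTop (μ := P) (s := fun n : ℕ => {ω | (n : ℝ≥0∞) < g ω})
      (fun n => (measurableSet_lt measurable_const hgm).nullMeasurableSet)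
      (fun i j hij ω (hω : (j : ℝ≥0∞) < g ω) =>
        show (i : ℝ≥0∞) < g ω from lt_of_le_of_lt (Nat.cast_le.mpr hij) hω)
      ⟨0, measure_ne_top _ _⟩
    have h2 : P (⋂ n : ℕ, {ω | (n : ℝ≥0∞) < g ω}) = 0 := by
      refine measure_mono_null (fun ω hω => ?_) (ae_iff.mp h4)
      simp only [mem_iInter, mem_ofPred_eq] at hω
      simp only [mem_ofPred_eq, not_lt, top_le_iff]
      exact ENNReal.eq_top_of_forall_nnreal_le fun r => by
        obtain ⟨n, hn⟩ := exists_nat_ge r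
        exact le_trans (by exact_mod_cast hn) (hω n).le
    rwa [h2] at h1
  obtain ⟨n, hn⟩ := (hlim.eventually (eventually_le_nhds (ENNReal.ofReal_pos.mpr hη))).exists
  refine ⟨(κ : ℝ) ^ 4 * n, by positivity, le_trans (measure_mono_ae ?_) hn⟩
  have hsm : ∀ᵐ ω ∂P, ∀ t : ℤ,
      condLExp (innovFiltration ε hε (t - 1)) P (fun ω' => ‖(κ : ℝ) * ‖ε t ω'‖‖ₑ ^ 4) ω
        = (κ : ℝ≥0∞) ^ 4
          * condLExp (innovFiltration ε hε (t - 1)) P (fun ω' => ‖ε t ω'‖ₑ ^ 4) ω := by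
    rw [ae_all_iff]
    intro t
    have h1 := condLExp_smul' (P := P) (mΩ := innovFiltration ε hε (t - 1))
      (fun ω' => ‖ε t ω'‖ₑ ^ 4) (c := (κ : ℝ≥0∞) ^ 4) (by simp)
    have e : (fun ω' => ‖(κ : ℝ) * ‖ε t ω'‖‖ₑ ^ 4)
        = (κ : ℝ≥0∞) ^ 4 • fun ω' => ‖ε t ω'‖ₑ ^ 4 := by
      funext ω'
      simp [mul_pow, enorm_eq_nnnorm]
    rw [e]
    filter_upwards [h1] with ω h1
    rw [h1, Pi.smul_apply, smul_eq_mul]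
  filter_upwards [hsm] with ω hsm
  intro hω
  by_contra hcon
  refine hω fun t ht => ?_
  have hle : g ω ≤ n := not_lt.mp hcon
  rw [hsm t, ENNReal.ofReal_mul (by positivity), ENNReal.ofReal_pow κ.coe_nonneg,
    ENNReal.ofReal_coe_nnreal, ENNReal.ofReal_natCast]
  gcongr
  exact (le_iSup₂ (f := fun (t : ℤ) (_ : 1 ≤ t) =>
    condLExp (innovFiltration ε hε (t - 1)) P (fun ω' => ‖ε t ω'‖ₑ ^ 4) ω) t ht).trans hle

end Innovations

/-! ### Stacked innovations and coefficients -/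

section Stacking

theorem exists_eventually_le_of_limsup_lt_top {f : ℕ → ℝ≥0∞} (h : limsup f atTop < ∞) :
    ∃ C : ℝ≥0, ∀ᶠ T in atTop, f T ≤ C := by
  obtain ⟨C, h1, -⟩ := ENNReal.lt_iff_exists_nnreal_btwn.mp h
  exact ⟨C, (eventually_lt_of_limsup_lt h1).mono fun _ => le_of_lt⟩

/-- A bound for the supremum and for the total variation of `g` on `{1, …, T + p}` that uses the
increments on `{1, …, T}` only: the increments beyond `T` are bounded by the values of `g`. -/
noncomputable def bvBound {E : Type*} [SeminormedAddCommGroup E] (g : ℕ → E) (T p : ℕ) : ℝ :=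
  ‖g 1‖ + ∑ t ∈ Finset.Ico 1 T, ‖g (t + 1) - g t‖ + 2 * ∑ q ∈ Finset.range (p + 1), ‖g (T + q)‖

section BVBound

variable {E : Type*} [SeminormedAddCommGroup E] (g : ℕ → E) (T p : ℕ)

theorem bvBound_nonneg : 0 ≤ bvBound g T p := by
  rw [bvBound]
  positivity

theorem ofReal_bvBound : ENNReal.ofReal (bvBound g T p)
    = ‖g 1‖ₑ + ∑ t ∈ Finset.Ico 1 T, ‖g (t + 1) - g t‖ₑ
      + 2 * ∑ q ∈ Finset.range (p + 1), ‖g (T + q)‖ₑ := by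
  rw [bvBound, ENNReal.ofReal_add (by positivity) (by positivity),
    ENNReal.ofReal_add (by positivity) (by positivity), ENNReal.ofReal_mul (by norm_num),
    ENNReal.ofReal_sum_of_nonneg (fun _ _ => norm_nonneg _),
    ENNReal.ofReal_sum_of_nonneg (fun _ _ => norm_nonneg _)]
  simp only [ofReal_norm, ENNReal.ofReal_ofNat]

variable {g T p}

theorem ofReal_bvBound_le {C V : ℝ≥0} (hT : 1 ≤ T) (hC : ∀ t, 1 ≤ t → ‖g t‖ₑ ≤ C)
    (hV : ∑ t ∈ Finset.Ico 1 T, ‖g (t + 1) - g t‖ₑ ≤ V) :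
    ENNReal.ofReal (bvBound g T p) ≤ ENNReal.ofReal (C + V + 2 * ((p + 1 : ℕ) * C)) := by
  rw [ofReal_bvBound]
  have h1 : ∑ q ∈ Finset.range (p + 1), ‖g (T + q)‖ₑ ≤ (p + 1 : ℕ) * C := by
    refine (Finset.sum_le_sum fun q _ => hC (T + q) (by omega)).trans ?_
    simp
  rw [show (C + V + 2 * ((p + 1 : ℕ) * C) : ℝ) = ((C + V + 2 * ((p + 1 : ℕ) * C) : ℝ≥0) : ℝ) by
    push_cast; rfl, ENNReal.ofReal_coe_nnreal]
  push_cast at h1 ⊢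
  gcongr
  exact hC 1 le_rfl

theorem isBVBdd_bvBound {f : ℕ → ℝ} (hT : 1 ≤ T) (hf : ∀ t, |f t| ≤ ‖g t‖)
    (hf' : ∀ t, |f (t + 1) - f t| ≤ ‖g (t + 1) - g t‖) : IsBVBdd f (T + p) (bvBound g T p) where
  sup t h1 h2 := by
    rw [bvBound]
    have hv : 0 ≤ ∑ t ∈ Finset.Ico 1 T, ‖g (t + 1) - g t‖ :=
      Finset.sum_nonneg fun _ _ => norm_nonneg _
    have hs : 0 ≤ ∑ q ∈ Finset.range (p + 1), ‖g (T + q)‖ :=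
      Finset.sum_nonneg fun _ _ => norm_nonneg _
    rcases le_or_gt t T with h | h
    · have h3 := abs_le_abs_add_variation f le_rfl h1
      have h4 : ∑ s ∈ Finset.Ico 1 t, |f (s + 1) - f s|
          ≤ ∑ s ∈ Finset.Ico 1 T, ‖g (s + 1) - g s‖ :=
        (Finset.sum_le_sum fun s _ => hf' s).trans
          (Finset.sum_le_sum_of_subset_of_nonneg (Finset.Ico_subset_Ico le_rfl h)
            fun _ _ _ => norm_nonneg _)
      linarith [hf 1]
    · have h3 : ‖g t‖ ≤ ∑ q ∈ Finset.range (p + 1), ‖g (T + q)‖ := by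
        have h4 := Finset.single_le_sum (f := fun q => ‖g (T + q)‖)
          (fun _ _ => norm_nonneg _) (Finset.mem_range.mpr (show t - T < p + 1 by omega))
        simpa only [Nat.add_sub_cancel' h.le] using h4
      linarith [hf t, norm_nonneg (g 1), norm_nonneg (g t)]
  var := by
    rw [bvBound, ← Finset.sum_Ico_consecutive _ hT (Nat.le_add_right T p)]
    have h1 : ∑ s ∈ Finset.Ico 1 T, |f (s + 1) - f s|
        ≤ ∑ s ∈ Finset.Ico 1 T, ‖g (s + 1) - g s‖ := Finset.sum_le_sum fun s _ => hf' s
    have h2 : ∑ s ∈ Finset.Ico T (T + p), |f (s + 1) - f s|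
        ≤ 2 * ∑ q ∈ Finset.range (p + 1), ‖g (T + q)‖ := by
      rw [Finset.sum_Ico_eq_sum_range, Nat.add_sub_cancel_left, two_mul]
      refine (Finset.sum_le_sum fun q _ => (hf' (T + q)).trans (norm_sub_le _ _)).trans ?_
      rw [Finset.sum_add_distrib]
      refine add_le_add ?_ ?_
      · rw [Finset.sum_range_succ']
        exact le_add_of_nonneg_right (norm_nonneg _)
      · rw [Finset.sum_range_succ]
        exact le_add_of_nonneg_right (norm_nonneg _)
    linarith [norm_nonneg (g 1)]

end BVBound

variable {d : ℕ}

/-- The rows of the coordinates of `ε_t`, followed by those of `B_{0,t} ε_t` for `t ≥ 1`. The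
variation of `B_{0,t}` in `t` is not controlled, so the instantaneous term is treated as an
innovation of its own rather than as a term of the moving average. -/
def stackedRow (B : ℕ → ℕ → ℕ → Matrix (Fin d) (Fin d) ℝ) (T : ℕ) :
    Fin d ⊕ Fin d → ℤ → Fin d → ℝ
  | .inl c, _, k => if k = c then 1 else 0
  | .inr s, t, k => if 1 ≤ T ∧ 1 ≤ t then B T 0 t.toNat s k else 0

/-- The innovations `(ε_t, B_{0,t} ε_t)`, coordinate by coordinate. -/
noncomputable def stackedInnov {Ω : Type*} (B : ℕ → ℕ → ℕ → Matrix (Fin d) (Fin d) ℝ)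
    (ε : ℤ → Ω → EuclideanSpace ℝ (Fin d)) (T : ℕ) (c : Fin d ⊕ Fin d) (t : ℤ) (ω : Ω) : ℝ :=
  ∑ k, stackedRow B T c t k * ε t ω k

/-- The coefficients of coordinate `r` of `∑ⱼ B_{j,t} ε_{t-j}` in terms of the stacked
innovations: `B_{j,t}` for `j ≥ 1`, and the identity on the second block for `j = 0`. -/
def stackedCoeff (B : ℕ → ℕ → ℕ → Matrix (Fin d) (Fin d) ℝ) (r : Fin d) :
    Fin d ⊕ Fin d → ℕ → ℕ → ℕ → ℝ
  | .inl c, T, j, t => if j = 0 then 0 else B T j t r c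
  | .inr s, _, j, _ => if j = 0 ∧ s = r then 1 else 0

/-- The part of coordinate `r` of `∑ⱼ B_{j,t} ε_{t-j}` due to the stacked innovation `c`. -/
noncomputable def stackedProcess {Ω : Type*} (B : ℕ → ℕ → ℕ → Matrix (Fin d) (Fin d) ℝ)
    (ε : ℤ → Ω → EuclideanSpace ℝ (Fin d)) (r : Fin d) (c : Fin d ⊕ Fin d) (T t : ℕ) :
    Ω → ℝ :=
  linearProcess (fun j => stackedCoeff B r c T j t) (stackedInnov B ε T c) t

variable {μ : ℕ → ℕ → EuclideanSpace ℝ (Fin d)} {B : ℕ → ℕ → ℕ → Matrix (Fin d) (Fin d) ℝ}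

namespace IsVMACoeff

theorem exists_sum_abs_stackedRow_le (h : IsVMACoeff μ B) :
    ∃ κ : ℝ≥0, ∀ T c t, ∑ k, |stackedRow B T c t k| ≤ κ := by
  obtain ⟨C, hC⟩ := h.bdd_coeff_zero
  refine ⟨1 + d * C, fun T c t => ?_⟩
  push_cast
  rcases c with c | s
  · have e : ∑ k, |stackedRow B T (.inl c) t k| = 1 := by
      simp [stackedRow, apply_ite abs]
    rw [e]
    exact le_add_of_nonneg_right (by positivity)
  · have h1 : ∀ k, |stackedRow B T (.inr s) t k| ≤ C := fun k => by
      by_cases hT : 1 ≤ T ∧ 1 ≤ t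
      · have h2 := hC T t.toNat hT.1 (by omega)
        rw [enorm_eq_nnnorm, ENNReal.coe_le_coe] at h2
        simp only [stackedRow, if_pos hT]
        exact (abs_entry_le_frobenius_norm _ s k).trans (by exact_mod_cast h2)
      · simp [stackedRow, if_neg hT]
    refine (Finset.sum_le_sum fun k _ => h1 k).trans ?_
    simp

theorem summable_abs_stackedCoeff (h : IsVMACoeff μ B) (r : Fin d) (c : Fin d ⊕ Fin d) {T t : ℕ}
    (hT : 1 ≤ T) (ht : 1 ≤ t) : Summable fun j => |stackedCoeff B r c T j t| := by
  rcases c with c | s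
  · obtain ⟨C, hC⟩ := h.bdd_coeff
    have h1 := ENNReal.summable_toReal (ne_top_of_le_ne_top ENNReal.coe_ne_top (hC T t hT ht))
    refine Summable.of_nonneg_of_le (fun _ => abs_nonneg _) (fun j => ?_) h1
    rw [ENNReal.toReal_mul, ENNReal.toReal_natCast, toReal_enorm]
    rcases Nat.eq_zero_or_pos j with rfl | hj
    · simp [stackedCoeff]
    · simp only [stackedCoeff, if_neg hj.ne']
      exact (abs_entry_le_frobenius_norm _ r c).trans
        (le_mul_of_one_le_left (norm_nonneg _) (by exact_mod_cast hj))
  · refine summable_of_ne_finset_zero (s := {0}) fun j hj => ?_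
    rw [Finset.mem_singleton] at hj
    simp [stackedCoeff, hj]

theorem exists_isBVCoeff (h : IsVMACoeff μ B) (p : ℕ) :
    ∃ D : ℝ, 0 ≤ D ∧ ∀ r c, ∀ᶠ T in atTop,
      ∃ b, IsBVCoeff (stackedCoeff B r c T) (T + p) b D := by
  obtain ⟨C, hC⟩ := h.bdd_coeff
  obtain ⟨V, hV⟩ := exists_eventually_le_of_limsup_lt_top h.var_coeff
  refine ⟨((1 + 2 * (C + V + 2 * ((p + 1 : ℕ) * C)) : ℝ≥0) : ℝ), NNReal.coe_nonneg _,
    fun r c => ?_⟩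
  filter_upwards [hV, eventually_ge_atTop 1] with T hV hT
  rcases c with c | s
  · refine ⟨fun j => if j = 0 then 0 else bvBound (B T j) T p, fun j => ?_, fun j => ?_, ?_⟩
    · split_ifs
      exacts [le_rfl, bvBound_nonneg _ _ _]
    · rcases Nat.eq_zero_or_pos j with rfl | hj
      · exact ⟨fun t _ _ => by simp [stackedCoeff], by simp [stackedCoeff]⟩
      · have e : stackedCoeff B r (.inl c) T j = fun t => B T j t r c := by
          funext t
          simp [stackedCoeff, hj.ne']
        rw [e, if_neg hj.ne']
        exact isBVBdd_bvBound hT (fun t => abs_entry_le_frobenius_norm _ r c)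
          fun t => abs_entry_le_frobenius_norm (B T j (t + 1) - B T j t) r c
    · rw [ENNReal.ofReal_coe_nnreal]
      have h1 : ∀ j : ℕ,
          ENNReal.ofReal ((j + 1) * if j = 0 then 0 else bvBound (B T j) T p)
            ≤ 2 * ((j * ‖B T j 1‖ₑ + ∑ t ∈ Finset.Ico 1 T, j * ‖B T j (t + 1) - B T j t‖ₑ)
              + 2 * ∑ q ∈ Finset.range (p + 1), j * ‖B T j (T + q)‖ₑ) := fun j => by
        rcases Nat.eq_zero_or_pos j with rfl | hj
        · simp
        · have hj1 : ((j : ℝ) + 1) ≤ 2 * j := by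
            have : (1 : ℝ) ≤ j := by exact_mod_cast hj
            linarith
          rw [if_neg hj.ne']
          calc _ ≤ ENNReal.ofReal (2 * j * bvBound (B T j) T p) :=
                ENNReal.ofReal_le_ofReal
                  (mul_le_mul_of_nonneg_right hj1 (bvBound_nonneg _ _ _))
            _ = 2 * (j * ENNReal.ofReal (bvBound (B T j) T p)) := by
                rw [ENNReal.ofReal_mul (by positivity), ENNReal.ofReal_mul (by norm_num),
                  ENNReal.ofReal_natCast, ENNReal.ofReal_ofNat, mul_assoc]
            _ = _ := by
                rw [ofReal_bvBound, ← Finset.mul_sum, ← Finset.mul_sum]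
                ring
      refine (ENNReal.tsum_le_tsum h1).trans ?_
      rw [ENNReal.tsum_mul_left, ENNReal.tsum_add, ENNReal.tsum_add, ENNReal.tsum_mul_left,
        Summable.tsum_finsetSum (fun _ _ => ENNReal.summable),
        Summable.tsum_finsetSum (fun _ _ => ENNReal.summable)]
      have h2 : ∑ q ∈ Finset.range (p + 1), ∑' j : ℕ, (j : ℝ≥0∞) * ‖B T j (T + q)‖ₑ
          ≤ (p + 1 : ℕ) * C := by
        refine (Finset.sum_le_sum fun q _ => hC T (T + q) hT (by omega)).trans ?_
        simp
      push_cast at h2 ⊢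
      refine le_trans ?_ le_add_self
      gcongr
      exact hC T 1 hT le_rfl
  · refine ⟨fun j => if j = 0 then 1 else 0, fun j => ?_, fun j => ⟨fun t _ _ => ?_, ?_⟩, ?_⟩
    · split_ifs <;> norm_num
    · by_cases hj : j = 0 <;> by_cases hs : s = r <;> simp [stackedCoeff, hj, hs]
    · by_cases hj : j = 0 <;> simp [stackedCoeff, hj]
    · rw [tsum_eq_single 0 fun j hj => by simp [hj], ENNReal.ofReal_coe_nnreal]
      simp

/-- The trend, read at a time shifted by `q ≤ p`, is of bounded variation. -/
theorem exists_isBVBdd_trend (h : IsVMACoeff μ B) (q : ℕ) :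
    ∃ D : ℝ, 0 ≤ D ∧ ∀ r, ∀ᶠ T in atTop, IsBVBdd (fun t => μ T (t + q) r) T D := by
  obtain ⟨C, hC⟩ := h.bdd_trend
  obtain ⟨V, hV⟩ := exists_eventually_le_of_limsup_lt_top h.var_trend
  refine ⟨C + V + 2 * ((q + 1 : ℕ) * C), by positivity, fun r => ?_⟩
  filter_upwards [hV, eventually_ge_atTop 1] with T hV hT
  have h1 : IsBVBdd (fun t => μ T t r) (T + q) (bvBound (μ T) T q) :=
    isBVBdd_bvBound hT (fun t => abs_coord_le_norm _ r)
      fun t => abs_coord_le_norm (μ T (t + 1) - μ T t) r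
  exact (h1.shift le_rfl).mono ((ENNReal.ofReal_le_ofReal_iff (by positivity)).mp
    (ofReal_bvBound_le hT (fun t ht => hC T t hT ht) hV))

end IsVMACoeff

end Stacking

/-! ### Decomposition of the process and of its cross products -/

section Decomposition

theorem toEuclideanLin_apply_coord {m n : ℕ} (A : Matrix (Fin m) (Fin n) ℝ)
    (v : EuclideanSpace ℝ (Fin n)) (i : Fin m) :
    Matrix.toEuclideanLin A v i = ∑ k, A i k * v k := by
  simp [Matrix.toLpLin_apply, Matrix.mulVec, dotProduct]

/-- Coordinate by coordinate, the coefficients act on the innovations as the stacked coefficients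
act on the stacked innovations. -/
theorem sum_stackedCoeff_mul {Ω : Type*} {d : ℕ} (B : ℕ → ℕ → ℕ → Matrix (Fin d) (Fin d) ℝ)
    (ε : ℤ → Ω → EuclideanSpace ℝ (Fin d)) (r : Fin d) {T t : ℕ} (hT : 1 ≤ T) (ht : 1 ≤ t)
    (j : ℕ) (ω : Ω) :
    ∑ c, stackedCoeff B r c T j t * stackedInnov B ε T c ((t : ℤ) - j) ω
      = ∑ k, B T j t r k * ε ((t : ℤ) - j) ω k := by
  rw [Fintype.sum_sum_type]
  rcases Nat.eq_zero_or_pos j with rfl | hj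
  · have ht' : (1 : ℤ) ≤ t := by exact_mod_cast ht
    simp [stackedCoeff, stackedInnov, stackedRow, hT, ht']
  · simp [stackedCoeff, stackedInnov, stackedRow, hj.ne']

variable {Ω : Type*} [MeasurableSpace Ω] {P : Measure Ω} {d : ℕ}
  {ε : ℤ → Ω → EuclideanSpace ℝ (Fin d)} {hε : ∀ t, StronglyMeasurable (ε t)} {δ : ℝ}
  {μ : ℕ → ℕ → EuclideanSpace ℝ (Fin d)} {B : ℕ → ℕ → ℕ → Matrix (Fin d) (Fin d) ℝ}
  {x : ℕ → ℕ → Ω → EuclideanSpace ℝ (Fin d)}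

theorem IsInnovation.exists_moment_le (h : IsInnovation P ε hε δ) (hδ : 2 < δ) (κ : ℝ≥0) :
    ∃ C : ℝ≥0, ∀ t : ℤ, 1 ≤ t → ∫⁻ ω, ‖(κ : ℝ) * ‖ε t ω‖‖ₑ ^ δ ∂P ≤ C := by
  obtain ⟨C, hC⟩ := h.moment
  refine ⟨κ ^ δ * C, fun t ht => lintegral_enorm_const_mul_rpow_le (by linarith) ?_⟩
  simpa only [enorm_norm] using hC t ht

variable [IsProbabilityMeasure P]

theorem IsInnovation.exists_isMDFamily_stackedInnov (h : IsInnovation P ε hε δ)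
    (hc : IsVMACoeff μ B) :
    ∃ κ : ℝ≥0, ∀ T, IsMDFamily P (innovFiltration ε hε) (stackedInnov B ε T)
      (fun t ω => κ * ‖ε t ω‖) ((κ : ℝ) ^ 2 * d) := by
  obtain ⟨κ, hκ⟩ := hc.exists_sum_abs_stackedRow_le
  exact ⟨κ, fun T => h.isMDFamily (stackedRow B T) κ.coe_nonneg (hκ T)⟩

section Fixed

variable {N : ℤ → Ω → ℝ} {S : ℝ} {T t : ℕ}

theorem IsTVVMA.ae_eq (hx : IsTVVMA P μ B ε x) (hc : IsVMACoeff μ B)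
    (hu : IsMDFamily P (innovFiltration ε hε) (stackedInnov B ε T) N S) (hT : 1 ≤ T)
    (ht : 1 ≤ t) (r : Fin d) :
    (fun ω => x T t ω r) =ᵐ[P] fun ω => μ T t r + ∑ c, stackedProcess B ε r c T t ω := by
  have h1 : ∀ᵐ ω ∂P, ∀ c, Summable fun j : ℕ =>
      ‖stackedCoeff B r c T j t * stackedInnov B ε T c ((t : ℤ) - j) ω‖ := by
    rw [ae_all_iff]
    exact fun c => hu.ae_summable c (hc.summable_abs_stackedCoeff r c hT ht) t
  filter_upwards [hx T t hT ht, h1] with ω h0 h1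
  have h2 := (EuclideanSpace.proj r : EuclideanSpace ℝ (Fin d) →L[ℝ] ℝ).hasSum h0
  have h3 := hasSum_sum (s := Finset.univ) fun c _ => (h1 c).of_norm.hasSum
  simp only [sum_stackedCoeff_mul B ε r hT ht] at h3
  simp only [EuclideanSpace.coe_proj, toEuclideanLin_apply_coord] at h2
  have h4 := h2.unique h3
  rw [PiLp.sub_apply] at h4
  exact sub_eq_iff_eq_add'.mp h4

theorem memLp_stackedProcess (hc : IsVMACoeff μ B)
    (hu : IsMDFamily P (innovFiltration ε hε) (stackedInnov B ε T) N S) (hT : 1 ≤ T)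
    (ht : 1 ≤ t) (r : Fin d) (c : Fin d ⊕ Fin d) : MemLp (stackedProcess B ε r c T t) 2 P :=
  hu.memLp_linearProcess c (hc.summable_abs_stackedCoeff r c hT ht) t

theorem integral_stackedProcess (hc : IsVMACoeff μ B)
    (hu : IsMDFamily P (innovFiltration ε hε) (stackedInnov B ε T) N S) (hT : 1 ≤ T)
    (ht : 1 ≤ t) (r : Fin d) (c : Fin d ⊕ Fin d) : ∫ ω, stackedProcess B ε r c T t ω ∂P = 0 :=
  hu.integral_linearProcess c (hc.summable_abs_stackedCoeff r c hT ht) t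

theorem integrable_stackedProcess (hc : IsVMACoeff μ B)
    (hu : IsMDFamily P (innovFiltration ε hε) (stackedInnov B ε T) N S) (hT : 1 ≤ T)
    (ht : 1 ≤ t) (r : Fin d) (c : Fin d ⊕ Fin d) : Integrable (stackedProcess B ε r c T t) P :=
  hu.integrable_linearProcess c (hc.summable_abs_stackedCoeff r c hT ht) t

theorem IsTVVMA.memLp (hx : IsTVVMA P μ B ε x) (hc : IsVMACoeff μ B)
    (hu : IsMDFamily P (innovFiltration ε hε) (stackedInnov B ε T) N S) (hT : 1 ≤ T)
    (ht : 1 ≤ t) : MemLp (x T t) 2 P := by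
  rw [memLp_piLp_iff]
  intro r
  refine MemLp.ae_eq (hx.ae_eq hc hu hT ht r).symm ?_
  have h1 : MemLp (fun ω => ∑ c, stackedProcess B ε r c T t ω) 2 P :=
    memLp_finsetSum _ fun c _ => memLp_stackedProcess hc hu hT ht r c
  have h2 : MemLp (fun _ : Ω => μ T t r) 2 P := memLp_const _
  exact h2.add h1

theorem IsTVVMA.sub_integral_ae_eq (hx : IsTVVMA P μ B ε x) (hc : IsVMACoeff μ B)
    (hu : IsMDFamily P (innovFiltration ε hε) (stackedInnov B ε T) N S) (hT : 1 ≤ T)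
    (ht : 1 ≤ t) (r : Fin d) :
    (fun ω => ∑ c, stackedProcess B ε r c T t ω)
      =ᵐ[P] fun ω => (x T t ω - ∫ ω', x T t ω' ∂P) r := by
  have h1 : (∫ ω', x T t ω' ∂P) r = μ T t r := by
    rw [eval_integral_piLp fun i => ((memLp_piLp_iff.mp (hx.memLp hc hu hT ht)) i).integrable
      (by norm_num), integral_congr_ae (hx.ae_eq hc hu hT ht r),
      integral_add (integrable_const _)
        (integrable_finsetSum _ fun c _ => integrable_stackedProcess hc hu hT ht r c),
      integral_finsetSum _ fun c _ => integrable_stackedProcess hc hu hT ht r c]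
    simp [integral_stackedProcess hc hu hT ht]
  filter_upwards [hx.ae_eq hc hu hT ht r] with ω hω
  rw [PiLp.sub_apply, h1, hω, add_sub_cancel_left]

theorem IsTVVMA.centredOuter_ae_eq (hx : IsTVVMA P μ B ε x) (hc : IsVMACoeff μ B)
    (hu : IsMDFamily P (innovFiltration ε hε) (stackedInnov B ε T) N S) (hT : 1 ≤ T)
    (ht : 1 ≤ t) (p : ℕ) (r s : Fin d) :
    (fun ω => (μ T t r * ∑ c, stackedProcess B ε s c T (t + p) ω
        + μ T (t + p) s * ∑ c, stackedProcess B ε r c T t ω)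
        + ∑ q : (Fin d ⊕ Fin d) × (Fin d ⊕ Fin d),
          (stackedProcess B ε r q.1 T t ω * stackedProcess B ε s q.2 T (t + p) ω
            - ∫ ω', stackedProcess B ε r q.1 T t ω' * stackedProcess B ε s q.2 T (t + p) ω' ∂P))
      =ᵐ[P] fun ω => centredOuter P (x T t) (x T (t + p)) ω r s := by
  have htp : 1 ≤ t + p := by omega
  have h0 : (fun ω => x T t ω r * x T (t + p) ω s) =ᵐ[P] fun ω =>
      μ T t r * μ T (t + p) s + (μ T t r * ∑ c, stackedProcess B ε s c T (t + p) ω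
        + μ T (t + p) s * ∑ c, stackedProcess B ε r c T t ω)
        + ∑ q : (Fin d ⊕ Fin d) × (Fin d ⊕ Fin d),
          stackedProcess B ε r q.1 T t ω * stackedProcess B ε s q.2 T (t + p) ω := by
    filter_upwards [hx.ae_eq hc hu hT ht r, hx.ae_eq hc hu hT htp s] with ω h1 h2
    rw [h1, h2, Fintype.sum_prod_type]
    dsimp only
    rw [← Finset.sum_mul_sum]
    ring
  have hY : ∀ {t : ℕ}, 1 ≤ t → ∀ r, Integrable (fun ω => ∑ c, stackedProcess B ε r c T t ω) P :=
    fun ht r => integrable_finsetSum _ fun c _ => integrable_stackedProcess hc hu hT ht r c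
  have hY0 : ∀ {t : ℕ}, 1 ≤ t → ∀ r, ∫ ω, ∑ c, stackedProcess B ε r c T t ω ∂P = 0 :=
    fun ht r => by
      rw [integral_finsetSum _ fun c _ => integrable_stackedProcess hc hu hT ht r c]
      simp [integral_stackedProcess hc hu hT ht]
  have hZ : ∀ q : (Fin d ⊕ Fin d) × (Fin d ⊕ Fin d), Integrable (fun ω =>
      stackedProcess B ε r q.1 T t ω * stackedProcess B ε s q.2 T (t + p) ω) P := fun q =>
    (memLp_stackedProcess hc hu hT ht r q.1).integrable_mul
      (memLp_stackedProcess hc hu hT htp s q.2)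
  have hlin : Integrable (fun ω => μ T t r * ∑ c, stackedProcess B ε s c T (t + p) ω
      + μ T (t + p) s * ∑ c, stackedProcess B ε r c T t ω) P :=
    ((hY htp s).const_mul _).add ((hY ht r).const_mul _)
  have hE : ∫ ω, x T t ω r * x T (t + p) ω s ∂P = μ T t r * μ T (t + p) s
      + ∑ q : (Fin d ⊕ Fin d) × (Fin d ⊕ Fin d),
        ∫ ω, stackedProcess B ε r q.1 T t ω * stackedProcess B ε s q.2 T (t + p) ω ∂P := by
    have hconst : Integrable (fun ω => μ T t r * μ T (t + p) s
        + (μ T t r * ∑ c, stackedProcess B ε s c T (t + p) ω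
          + μ T (t + p) s * ∑ c, stackedProcess B ε r c T t ω)) P := (integrable_const _).add hlin
    rw [integral_congr_ae h0, integral_add hconst
        (integrable_finsetSum _ fun q _ => hZ q),
      integral_add (integrable_const _) hlin,
      integral_add ((hY htp s).const_mul _) ((hY ht r).const_mul _),
      integral_const, integral_const_mul, integral_const_mul, hY0 htp, hY0 ht,
      integral_finsetSum _ fun q _ => hZ q]
    simp
  filter_upwards [h0] with ω h0
  rw [centredOuter, Matrix.of_apply, h0, hE, Finset.sum_sub_distrib]
  ring

end Fixed

/-! ### Rates for the centred process and its cross products -/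

theorem isUniformBigOP_stackedProcess (h : IsInnovation P ε hε δ) (hδ : 2 < δ)
    (hc : IsVMACoeff μ B) {w : ℕ → ℝ} (hw0 : ∀ T, 0 ≤ w T)
    (hw : Tendsto (fun T : ℕ => (T : ℝ) ^ (2 / δ) * w T * Real.log T) atTop (𝓝 0)) (p : ℕ)
    (r : Fin d) (c : Fin d ⊕ Fin d) :
    IsUniformBigOP P w fun T t => stackedProcess B ε r c T (t + p) := by
  obtain ⟨κ, hu⟩ := h.exists_isMDFamily_stackedInnov hc
  obtain ⟨C, hC⟩ := h.exists_moment_le hδ κ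
  obtain ⟨D, hD, hb⟩ := hc.exists_isBVCoeff p
  exact isUniformBigOP_linearProcess hw0 hδ hw hu hC hD p (hb r c) c

theorem isUniformBigOP_stackedProcess_mul (h : IsInnovation P ε hε δ) (hδ : 2 < δ)
    (hc : IsVMACoeff μ B) (h4 : BddCondFourthMoment P ε hε) {w : ℕ → ℝ} (hw0 : ∀ T, 0 ≤ w T)
    (hw : Tendsto (fun T : ℕ => (T : ℝ) ^ (4 / δ) * w T * Real.log T) atTop (𝓝 0)) (p : ℕ)
    (r s : Fin d) (c e : Fin d ⊕ Fin d) :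
    IsUniformBigOP P w fun T t ω =>
      stackedProcess B ε r c T t ω * stackedProcess B ε s e T (t + p) ω
        - ∫ ω', stackedProcess B ε r c T t ω' * stackedProcess B ε s e T (t + p) ω' ∂P := by
  obtain ⟨κ, hu⟩ := h.exists_isMDFamily_stackedInnov hc
  obtain ⟨C, hC⟩ := h.exists_moment_le hδ κ
  obtain ⟨D, hD, hb⟩ := hc.exists_isBVCoeff p
  exact isUniformBigOP_linearProcess_mul hw0 hδ hw hu hC
    (fun η hη => exists_condLExp_bound h4 κ hη) hD hD p (hb r c) (hb s e) c e

theorem tendsto_rpow_mul_of_le {w : ℕ → ℝ} (hw0 : ∀ T, 0 ≤ w T) {q q' : ℝ} (hq : q ≤ q')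
    (hw : Tendsto (fun T : ℕ => (T : ℝ) ^ q' * w T * Real.log T) atTop (𝓝 0)) :
    Tendsto (fun T : ℕ => (T : ℝ) ^ q * w T * Real.log T) atTop (𝓝 0) := by
  refine squeeze_zero' ?_ ?_ hw
  · filter_upwards [eventually_ge_atTop 1] with T hT
    have hT1 : (1 : ℝ) ≤ T := by exact_mod_cast hT
    exact mul_nonneg (mul_nonneg (by positivity) (hw0 T)) (Real.log_nonneg hT1)
  · filter_upwards [eventually_ge_atTop 1] with T hT
    have hT1 : (1 : ℝ) ≤ T := by exact_mod_cast hT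
    have := hw0 T
    have := Real.log_nonneg hT1
    gcongr

variable {m : ℕ} {a b : ℝ} {W : ℕ → ℕ → ℝ → Matrix (Fin m) (Fin d) ℝ}

theorem IsTVVMA.isBigOP_supWeightedSum (hab : a ≤ b) (hδ : 2 < δ) (h : IsInnovation P ε hε δ)
    (hc : IsVMACoeff μ B) (hx : IsTVVMA P μ B ε x) (hW : IsWeight a b W)
    (hd : Tendsto (fun T : ℕ => (T : ℝ) ^ (2 / δ) * weightSup a b W T * Real.log T) atTop (𝓝 0)) :
    IsBigOP P (supWeightedSum P a b W x) fun T => √(weightSup a b W T * Real.log T) := by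
  obtain ⟨κ, hu⟩ := h.exists_isMDFamily_stackedInnov hc
  refine hW.isBigOP_iSup hab (J := Fin m × Fin d) (fun j => j.1) (fun j => j.2)
    (X := fun j T t ω => (x T t ω - ∫ ω', x T t ω' ∂P) j.2) (fun j => ?_)
    (F := fun T τ ω => ‖∑ t ∈ Finset.Icc 1 T,
      Matrix.toEuclideanLin (W T t τ) (x T t ω - ∫ ω', x T t ω' ∂P)‖)
    (fun _ _ _ => norm_nonneg _) fun T τ ω => ?_
  · exact (IsUniformBigOP.sum Finset.univ fun c =>
      isUniformBigOP_stackedProcess h hδ hc (weightSup_nonneg a b W) hd 0 j.2 c).congr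
        fun T t hT ht => hx.sub_integral_ae_eq hc (hu T) hT ht j.2
  · refine (euclidean_norm_le_sum_abs _).trans ?_
    rw [Fintype.sum_prod_type]
    refine Finset.sum_le_sum fun i _ => ?_
    refine le_trans (le_of_eq ?_) (Finset.abs_sum_le_sum_abs _ _)
    congr 1
    rw [WithLp.ofLp_sum, Finset.sum_apply, Finset.sum_comm]
    exact Finset.sum_congr rfl fun t _ => toEuclideanLin_apply_coord _ _ i

theorem IsTVVMA.isBigOP_supWeightedCross (hab : a ≤ b) (hδ : 2 < δ) (h : IsInnovation P ε hε δ)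
    (hc : IsVMACoeff μ B) (hx : IsTVVMA P μ B ε x) (hW : IsWeight a b W)
    (hd : Tendsto (fun T : ℕ => (T : ℝ) ^ (4 / δ) * weightSup a b W T * Real.log T) atTop (𝓝 0))
    (h4 : BddCondFourthMoment P ε hε) (p : ℕ) :
    IsBigOP P (supWeightedCross P a b W x p) fun T => √(weightSup a b W T * Real.log T) := by
  obtain ⟨κ, hu⟩ := h.exists_isMDFamily_stackedInnov hc
  have hd0 := weightSup_nonneg a b W
  have hd' := tendsto_rpow_mul_of_le hd0 (q := 2 / δ) (by gcongr; norm_num) hd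
  refine hW.isBigOP_iSup hab (J := Fin m × Fin d × Fin d) (fun j => j.1) (fun j => j.2.2)
    (X := fun j T t ω => centredOuter P (x T t) (x T (t + p)) ω j.2.2 j.2.1) (fun j => ?_)
    (F := fun T τ ω => ‖∑ t ∈ Finset.Icc 1 T,
      W T t τ * centredOuter P (x T t) (x T (t + p)) ω‖)
    (fun _ _ _ => norm_nonneg _) fun T τ ω => ?_
  · obtain ⟨D, hD, hμ⟩ := hc.exists_isBVBdd_trend 0
    obtain ⟨D', hD', hμ'⟩ := hc.exists_isBVBdd_trend p
    have h1 := (IsUniformBigOP.sum Finset.univ fun c =>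
      isUniformBigOP_stackedProcess h hδ hc hd0 hd' p j.2.1 c).mul_of_isBVBdd hd0 hD (hμ j.2.2)
    have h2 := (IsUniformBigOP.sum Finset.univ fun c =>
      isUniformBigOP_stackedProcess h hδ hc hd0 hd' 0 j.2.2 c).mul_of_isBVBdd hd0 hD' (hμ' j.2.1)
    have h3 := IsUniformBigOP.sum Finset.univ fun q : (Fin d ⊕ Fin d) × (Fin d ⊕ Fin d) =>
      isUniformBigOP_stackedProcess_mul h hδ hc h4 hd0 hd p j.2.2 j.2.1 q.1 q.2
    exact ((h1.add h2).add h3).congr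
      fun T t hT ht => hx.centredOuter_ae_eq hc (hu T) hT ht p j.2.2 j.2.1
  · refine (frobenius_norm_le_sum_abs _).trans ?_
    simp only [Fintype.sum_prod_type]
    refine Finset.sum_le_sum fun i _ => Finset.sum_le_sum fun s _ => ?_
    refine le_trans (le_of_eq ?_) (Finset.abs_sum_le_sum_abs _ _)
    congr 1
    rw [Matrix.sum_apply, Finset.sum_comm]
    exact Finset.sum_congr rfl fun t _ => Matrix.mul_apply

end Decomposition

theorem theorem2p1 {Ω : Type*} [MeasurableSpace Ω] (P : Measure Ω) [IsProbabilityMeasure P]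
    {m d : ℕ} (a b : ℝ) (hab : a ≤ b) (δ : ℝ) (hδ : 2 < δ)
    (ε : ℤ → Ω → EuclideanSpace ℝ (Fin d)) (hε : ∀ t, StronglyMeasurable (ε t))
    (hinnov : IsInnovation P ε hε δ)
    (μ : ℕ → ℕ → EuclideanSpace ℝ (Fin d)) (B : ℕ → ℕ → ℕ → Matrix (Fin d) (Fin d) ℝ)
    (hcoeff : IsVMACoeff μ B)
    (x : ℕ → ℕ → Ω → EuclideanSpace ℝ (Fin d)) (hx : IsTVVMA P μ B ε x)
    (W : ℕ → ℕ → ℝ → Matrix (Fin m) (Fin d) ℝ) (hW : IsWeight a b W) :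
    (∀ T t : ℕ, 1 ≤ T → 1 ≤ t → MemLp (x T t) 2 P) ∧
    (Tendsto (fun T : ℕ => (T : ℝ) ^ (2 / δ) * weightSup a b W T * Real.log T) atTop (𝓝 0) →
      IsBigOP P (supWeightedSum P a b W x)
        (fun T => Real.sqrt (weightSup a b W T * Real.log T))) ∧
    (Tendsto (fun T : ℕ => (T : ℝ) ^ (4 / δ) * weightSup a b W T * Real.log T) atTop (𝓝 0) →
      BddCondFourthMoment P ε hε →
      ∀ p : ℕ, IsBigOP P (supWeightedCross P a b W x p)
        (fun T => Real.sqrt (weightSup a b W T * Real.log T))) := by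
  obtain ⟨κ, hu⟩ := hinnov.exists_isMDFamily_stackedInnov hcoeff
  exact ⟨fun T t hT ht => hx.memLp hcoeff (hu T) hT ht,
    fun hd => hx.isBigOP_supWeightedSum hab hδ hinnov hcoeff hW hd,
    fun hd h4 p => hx.isBigOP_supWeightedCross hab hδ hinnov hcoeff hW hd h4 p⟩
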